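/- \textbf{Setting.} A two-state non-commutative probability space $(\mathcal A,\varphi,\psi)$ is a unital complex algebra $\mathcal A$ with two linear functionals $\varphi,\psi$ such that $\varphi(1)=\psi(1)=1$. Let $\Gamma=\{(\mathcal A_{k,\ell},\mathcal A_{k,r})\}_{k\in K}$ be a family of pairs of unital subalgebras of $\mathcal A$. \emph{c-bi-freeness.} A two-state vector space with a specified state-vector is $(\mathcal X,\mathcal X^\circ,\xi,\varphi)$ with $\mathcal X=\mathbb C\xi\oplus\mathcal X^\circ$, $\xi\ne0$, and $\varphi:\mathcal X\to\mathbb C$ linear with $\varphi(\xi)=1$; let $\psi:\mathcal X\to\mathbb C$ be linear with $\psi(\xi)=1$, $\ker\psi=\mathcal X^\circ$, and for linear operators $T$ on $\mathcal X$ let $\varphi_\xi(T)=\varphi(T\xi)$, $\psi_\xi(T)=\psi(T\xi)$. The c-free product of $\{(\mathcal X_k,\mathcal X_k^\circ,\xi_k,\varphi_k)\}_{k\in K}$ is $\mathcal X=\mathbb C\xi\oplus\mathcal X^\circ$, $\mathcal X^\circ=\bigoplus_{n\ge1}\bigoplus_{k_1\ne\cdots\ne k_n}\mathcal X_{k_1}^\circ\otimes\cdots\otimes\mathcal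 X_{k_n}^\circ$, with $\varphi(\xi)=1$ and $\varphi(x_1\otimes\cdots\otimes x_n)=\varphi_{k_1}(x_1)\cdots\varphi_{k_n}(x_n)$. Let $\mathcal X(\ell,k)$, resp. $\mathcal X(r,k)$, be the span of $\xi$ and the summands with $k_1\neq k$, resp. $k_n\ne k$. The identifications $\mathcal X\cong\mathcal X_k\otimes\mathcal X(\ell,k)$ and $\mathcal X\cong\mathcal X(r,k)\otimes\mathcal X_k$ give the left and right representations $\lambda_k(T)=T\otimes I$ and $\rho_k(T)=I\otimes T$ of $\mathcal L(\mathcal X_k)$ on $\mathcal X$. A \emph{representation} $R$ of $\Gamma$ consists of two-state vector spaces $(\mathcal X_k,\mathcal X_k^\circ,\xi_k,\varphi_k)$ and unital homomorphisms $\ell_k:\mathcal A_{k,\ell}\to\mathcal L(\mathcal X_k)$, $r_k:\mathcal A_{k,r}\to\mathcal L(\mathcal X_k)$, $k\in K$. Its joint pair-distribution is the pair of functionals on $*_{k\in K}(\mathcal A_{k,\ell}*\mathcal A_{k,r})$ obtained by composing $\varphi_\xi$ and $\psi_\xi$ with the homomorphism into $\mathcal L(\mathcal X)$ that extends all $\lambda_k\circ\ell_k$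 and $\rho_k\circ r_k$; its $k$-th pair-distribution is the pair of functionals on $\mathcal A_{k,\ell}*\mathcal A_{k,r}$ obtained from $(\varphi_k)_{\xi_k}$, $(\psi_k)_{\xi_k}$ and the homomorphism that extends $\ell_k$ and $r_k$. The joint pair-distribution and the $k$-th pair-distribution of $\Gamma$ are defined in the same way from $\varphi,\psi$ and the inclusions into $\mathcal A$. The family $\Gamma$ is \emph{c-bi-free} with respect to $(\varphi,\psi)$ if its joint pair-distribution equals that of some representation. \emph{Partitions.} For $\chi:[n]\to\{\ell,r\}$ let $\prec_\chi$ order $[n]$ by putting first the left nodes ($\chi(i)=\ell$), increasingly, and then the right nodes, decreasingly. $\mathcal{BNC}(\chi)$ is the set of partitions of $[n]$ that are non-crossing for $\prec_\chi$, ordered by refinement, and $\mu_{\mathcal{BNC}}$ is its Möbius function. For $\omega:[n]\to K$, $\sigma\le\omega$ means that $\omega$ is constant on every block of $\sigma$. For $V=\{s_1<\cdots<s_m\}\subseteq[n]$ let $a_V=a_{s_1}\cdots a_{s_m}$, and let $\psi_\pi(a_1,\dots,a_n)=\prod_{V\in\pi}\psi(a_V)$. \emph{Diagrams.} A diagram $D$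 on $[n]$ is a partition of $[n]$ together with a set of blocks, called the spines that reach the top; $|D|$ is the number of blocks plus the number of spines that reach the top. The set $\mathcal{LR}(\chi,\omega)$ consists of the diagrams obtained by adding the nodes $n,n-1,\dots,1$ successively, keeping the spines that reach the top (each of one colour) ordered from left to right: when node $i$ is added and the spine nearest to it (the leftmost one if $\chi(i)=\ell$, the rightmost one if $\chi(i)=r$) exists and has colour $\omega(i)$, then $i$ is joined to this spine, and the spine either continues to reach the top or ends; otherwise $i$ is either an isolated node, whose block does not reach the top, or starts a new spine of colour $\omega(i)$ that reaches the top and is placed leftmost if $\chi(i)=\ell$ and rightmost if $\chi(i)=r$. A \emph{lateral refinement} of $D$ is obtained by cutting blocks of $D$, including those that reach the top, between consecutive nodes, that is, by splitting every block $V$ into sets of consecutive elements of $V$ (for the usual order); if $V$ reaches the top in $D$, then of its pieces exactly the one containing $\min V$ reaches the top, and otherwise none of them does. A \emph{capping} of $D$ has the same partition, and some (possibly none) of the spines that reach the top in $D$ no longer do. Write $D'\ge_{\mathrm{latcap}}D$ if $D$ is a capping of a lateral refinement of $D'$, and let $\mathcal{LR}^{\mathrm{latcap}}(\chi,\omega)$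 be the set of all $D$ with $D'\ge_{\mathrm{latcap}}D$ for some $D'\in\mathcal{LR}(\chi,\omega)$. Let $\varphi_D(a_1,\dots,a_n)$ be the product of the $\varphi(a_V)$ over the blocks $V$ that reach the top in $D$ and of the $\psi(a_V)$ over the other blocks. \textbf{Theorem.} (1) $\Gamma$ is c-bi-free with respect to $(\varphi,\psi)$ if and only if for all $n\ge1$, $\chi:[n]\to\{\ell,r\}$, $\omega:[n]\to K$ and $a_i\in\mathcal A_{\omega(i),\chi(i)}$ $(1\le i\le n)$, \[ \psi(a_1\cdots a_n)=\sum_{\pi\in\mathcal{BNC}(\chi)}\Bigl[\sum_{\substack{\sigma\in\mathcal{BNC}(\chi)\\ \pi\le\sigma\le\omega}}\mu_{\mathcal{BNC}}(\pi,\sigma)\Bigr]\psi_\pi(a_1,\dots,a_n) \] and \[ \varphi(a_1\cdots a_n)=\sum_{D\in\mathcal{LR}^{\mathrm{latcap}}(\chi,\omega)}\Bigl[\sum_{\substack{D'\in\mathcal{LR}(\chi,\omega)\\ D'\ge_{\mathrm{latcap}}D}}(-1)^{|D|-|D'|}\Bigr]\varphi_D(a_1,\dots,a_n). \] (2) Consequently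 c-bi-freeness does not depend on the representation chosen: two representations of $\Gamma$ with the same $k$-th pair-distribution for every $k\in K$ have the same joint pair-distribution; and if $R$ is any representation whose $k$-th pair-distribution equals that of $\Gamma$ for every $k\in K$, then $\Gamma$ is c-bi-free if and only if the joint pair-distribution of $\Gamma$ equals that of $R$. -/

import Mathlib

open scoped TensorProduct DirectSum Classical

universe u v w w₁

noncomputable section

namespace CBiFree

/-! ### Two-state vector spaces with a specified state-vector -/

/-- A two-state vector space with a specified state-vector `(X, X°, ξ, φ)`. The subspace `circ`
is `X°`; it has codimension one because it is a complement of the line through `ξ ≠ 0`. -/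
structure TwoStateSpace (X : Type*) [AddCommGroup X] [Module ℂ X] where
  circ : Submodule ℂ X
  ξ : X
  ξ_ne_zero : ξ ≠ 0
  isCompl : IsCompl (ℂ ∙ ξ) circ
  φ : X →ₗ[ℂ] ℂ
  φ_ξ : φ ξ = 1

namespace TwoStateSpace

variable {X : Type*} [AddCommGroup X] [Module ℂ X] (S : TwoStateSpace X)

/-- The functional `ψ`, given by `ψ x • ξ = p x`, where `p` is the projection onto `ℂ ξ` along
`X°`. -/
def ψ : X →ₗ[ℂ] ℂ :=
  (LinearEquiv.toSpanNonzeroSingleton ℂ X S.ξ S.ξ_ne_zero).symm.toLinearMap ∘ₗ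
    (ℂ ∙ S.ξ).projectionOnto S.circ S.isCompl

/-- The projection `1 - p` of `X` onto `X°` along `ℂ ξ`. -/
def toCirc : X →ₗ[ℂ] S.circ := S.circ.projectionOnto (ℂ ∙ S.ξ) S.isCompl.symm

/-- The state `φ_ξ (T) = φ (T ξ)` on the algebra of linear operators on `X`. -/
def φState : Module.End ℂ X →ₗ[ℂ] ℂ := S.φ ∘ₗ LinearMap.applyₗ S.ξ

/-- The state `ψ_ξ (T) = ψ (T ξ)` on the algebra of linear operators on `X`. -/
def ψState : Module.End ℂ X →ₗ[ℂ] ℂ := S.ψ ∘ₗ LinearMap.applyₗ S.ξ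

theorem ψ_smul_ξ (x : X) :
    S.ψ x • S.ξ = ((ℂ ∙ S.ξ).projectionOnto S.circ S.isCompl x : X) := by
  have h := LinearEquiv.apply_symm_apply
    (LinearEquiv.toSpanNonzeroSingleton ℂ X S.ξ S.ξ_ne_zero)
    ((ℂ ∙ S.ξ).projectionOnto S.circ S.isCompl x)
  exact congrArg Subtype.val h

theorem ψ_smul_add_toCirc (x : X) : S.ψ x • S.ξ + (S.toCirc x : X) = x := by
  rw [ψ_smul_ξ]
  exact Submodule.projection_add_projection_eq_self S.isCompl x

theorem toCirc_coe (x : S.circ) : S.toCirc (x : X) = x :=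
  Submodule.projectionOnto_apply_left _ x

theorem ψ_coe (x : S.circ) : S.ψ (x : X) = 0 := by
  have h := S.ψ_smul_add_toCirc (x : X)
  rw [toCirc_coe] at h
  have h2 : S.ψ (x : X) • S.ξ = 0 := by simpa using h
  exact (smul_eq_zero.1 h2).resolve_right S.ξ_ne_zero

theorem ψ_ξ : S.ψ S.ξ = 1 := by
  have h := S.ψ_smul_ξ S.ξ
  rw [Submodule.projectionOnto_apply_of_mem_left _ (Submodule.mem_span_singleton_self _)] at h
  have h2 : (S.ψ S.ξ - 1) • S.ξ = 0 := by rw [sub_smul, one_smul]; simpa [sub_eq_zero] using h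
  exact sub_eq_zero.1 ((smul_eq_zero.1 h2).resolve_right S.ξ_ne_zero)

theorem toCirc_ξ : S.toCirc S.ξ = 0 := by
  have h := S.ψ_smul_add_toCirc S.ξ
  rw [ψ_ξ, one_smul] at h
  exact Subtype.ext (by simpa using h)

end TwoStateSpace

/-! ### Stripping the first or the last leg off a tensor -/

section Strip

variable (M : Type*) [AddCommGroup M] [Module ℂ M]

/-- Auxiliary representation used to define `stripLeft`. -/
def stripLeftAux :
    TensorAlgebra ℂ M →ₐ[ℂ] Module.End ℂ (TensorAlgebra ℂ M × (M ⊗[ℂ] TensorAlgebra ℂ M)) :=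
  TensorAlgebra.lift ℂ
    { toFun := fun v =>
        ((LinearMap.mulLeft ℂ (TensorAlgebra.ι ℂ v)).prod
          (TensorProduct.mk ℂ M (TensorAlgebra ℂ M) v)) ∘ₗ LinearMap.fst ℂ _ _
      map_add' := fun v w => by ext <;> simp [add_mul]
      map_smul' := fun c v => by ext <;> simp }

/-- The linear map with `1 ↦ 0` and `v * t ↦ v ⊗ t` for `v` of degree one. -/
def stripLeft : TensorAlgebra ℂ M →ₗ[ℂ] M ⊗[ℂ] TensorAlgebra ℂ M :=
  LinearMap.snd ℂ _ _ ∘ₗ LinearMap.applyₗ (1, 0) ∘ₗ (stripLeftAux M).toLinearMap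

theorem stripLeftAux_fst (t : TensorAlgebra ℂ M)
    (p : TensorAlgebra ℂ M × (M ⊗[ℂ] TensorAlgebra ℂ M)) :
    (stripLeftAux M t p).1 = t * p.1 := by
  induction t using TensorAlgebra.induction generalizing p with
  | algebraMap r => simp [Algebra.smul_def]
  | ι x => simp [stripLeftAux]
  | mul a b ha hb => simp [ha, hb, mul_assoc]
  | add a b ha hb => simp [ha, hb, add_mul]

theorem stripLeft_one : stripLeft M 1 = 0 := by simp [stripLeft]

theorem stripLeft_ι_mul (v : M) (t : TensorAlgebra ℂ M) :
    stripLeft M (TensorAlgebra.ι ℂ v * t) = v ⊗ₜ t := by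
  have h := stripLeftAux_fst M t (1, 0)
  simp only [mul_one] at h
  simp only [stripLeft, LinearMap.comp_apply, AlgHom.toLinearMap_apply, map_mul,
    LinearMap.applyₗ_apply_apply, Module.End.mul_apply, LinearMap.snd_apply]
  conv_lhs => rw [stripLeftAux]
  simp only [TensorAlgebra.lift_ι_apply, LinearMap.coe_mk, AddHom.coe_mk, LinearMap.comp_apply,
    LinearMap.fst_apply, LinearMap.prod_apply]
  exact congrArg (fun s => v ⊗ₜ[ℂ] s) h

/-- Auxiliary anti-representation used to define `stripRight`. -/
def stripRightAux :
    TensorAlgebra ℂ M →ₐ[ℂ] (Module.End ℂ (TensorAlgebra ℂ M × (TensorAlgebra ℂ M ⊗[ℂ] M)))ᵐᵒᵖ :=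
  TensorAlgebra.lift ℂ ((MulOpposite.opLinearEquiv ℂ).toLinearMap ∘ₗ
    { toFun := fun v =>
        ((LinearMap.mulRight ℂ (TensorAlgebra.ι ℂ v)).prod
          ((TensorProduct.mk ℂ (TensorAlgebra ℂ M) M).flip v)) ∘ₗ LinearMap.fst ℂ _ _
      map_add' := fun v w => by ext <;> simp [mul_add]
      map_smul' := fun c v => by ext <;> simp })

/-- The linear map with `1 ↦ 0` and `t * v ↦ t ⊗ v` for `v` of degree one. -/
def stripRight : TensorAlgebra ℂ M →ₗ[ℂ] TensorAlgebra ℂ M ⊗[ℂ] M :=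
  LinearMap.snd ℂ _ _ ∘ₗ LinearMap.applyₗ (1, 0) ∘ₗ
    (MulOpposite.opLinearEquiv ℂ).symm.toLinearMap ∘ₗ (stripRightAux M).toLinearMap

theorem stripRightAux_fst (t : TensorAlgebra ℂ M)
    (p : TensorAlgebra ℂ M × (TensorAlgebra ℂ M ⊗[ℂ] M)) :
    ((stripRightAux M t).unop p).1 = p.1 * t := by
  induction t using TensorAlgebra.induction generalizing p with
  | algebraMap r =>
    simp [Algebra.algebraMap_eq_smul_one]
  | ι x => simp [stripRightAux]
  | mul a b ha hb => simp [ha, hb, mul_assoc]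
  | add a b ha hb => simp [ha, hb, mul_add]

theorem stripRight_one : stripRight M 1 = 0 := by simp [stripRight]

theorem stripRight_mul_ι (v : M) (t : TensorAlgebra ℂ M) :
    stripRight M (t * TensorAlgebra.ι ℂ v) = t ⊗ₜ v := by
  have h := stripRightAux_fst M t (1, 0)
  simp only [one_mul] at h
  simp only [stripRight, LinearMap.comp_apply, AlgHom.toLinearMap_apply, map_mul,
    LinearMap.applyₗ_apply_apply, LinearEquiv.coe_coe, MulOpposite.coe_opLinearEquiv_symm,
    MulOpposite.unop_mul, Module.End.mul_apply, LinearMap.snd_apply]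
  conv_lhs => rw [stripRightAux]
  simp only [TensorAlgebra.lift_ι_apply, LinearMap.coe_mk, AddHom.coe_mk, LinearMap.comp_apply,
    LinearEquiv.coe_coe, MulOpposite.coe_opLinearEquiv, MulOpposite.unop_op,
    LinearMap.fst_apply, LinearMap.prod_apply]
  exact congrArg (fun s => s ⊗ₜ[ℂ] v) h

end Strip

/-! ### The c-free product of two-state vector spaces -/

section FreeProduct

variable {K : Type*} {X : K → Type*} [∀ k, AddCommGroup (X k)] [∀ k, Module ℂ (X k)]
  (S : ∀ k, TwoStateSpace (X k))

/-- The tensor algebra of `⨁ k, X°_k`, that is, the direct sum of all the tensor products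
`X°_{k_1} ⊗ ⋯ ⊗ X°_{k_n}`; the free product space is a subspace of it. -/
abbrev Tensors : Type _ := TensorAlgebra ℂ (⨁ k, (S k).circ)

/-- The inclusion of `X°_k` as tensors of length one. -/
def leg (k : K) : (S k).circ →ₗ[ℂ] Tensors S :=
  TensorAlgebra.ι ℂ ∘ₗ DirectSum.lof ℂ K (fun k => (S k).circ) k

/-- The subspace `X°_{k_1} ⊗ ⋯ ⊗ X°_{k_n}` for the word `k_1, …, k_n`; it is `ℂ 1` for the
empty word. -/
def wordSpace (w : List K) : Submodule ℂ (Tensors S) :=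
  (w.map fun k => LinearMap.range (leg S k)).prod

/-- Words `k_1, …, k_n` with `k_1 ≠ k_2 ≠ ⋯ ≠ k_n`. -/
def Alternating (w : List K) : Prop := w.IsChain (· ≠ ·)

/-- The free product space `ℂ ξ ⊕ ⨁_{n ≥ 1} ⨁_{k_1 ≠ ⋯ ≠ k_n} X°_{k_1} ⊗ ⋯ ⊗ X°_{k_n}`, where
`ξ` is the unit `1` of the tensor algebra. -/
def freeSpace : Submodule ℂ (Tensors S) :=
  ⨆ w : {w : List K // Alternating w}, wordSpace S w.1

/-- The subspace of `freeSpace` spanned by the words that do not begin with `k`. -/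
def freeSpaceLeft (k : K) : Submodule ℂ (Tensors S) :=
  ⨆ w : {w : List K // Alternating w ∧ w.head? ≠ some k}, wordSpace S w.1

/-- The subspace of `freeSpace` spanned by the words that do not end with `k`. -/
def freeSpaceRight (k : K) : Submodule ℂ (Tensors S) :=
  ⨆ w : {w : List K // Alternating w ∧ w.getLast? ≠ some k}, wordSpace S w.1

/-- The subspace `⨁_{n ≥ 1} ⨁_{k_1 ≠ ⋯ ≠ k_n} X°_{k_1} ⊗ ⋯ ⊗ X°_{k_n}`. -/
def freeSpaceCirc : Submodule ℂ (Tensors S) :=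
  ⨆ w : {w : List K // Alternating w ∧ w ≠ []}, wordSpace S w.1

/-- The inclusion of `X_k = ℂ ξ_k ⊕ X°_k` into the tensors: `ξ_k ↦ 1` and `x ↦ x` on `X°_k`. -/
def embed (k : K) : X k →ₗ[ℂ] Tensors S :=
  (S k).ψ.smulRight 1 + leg S k ∘ₗ (S k).toCirc

theorem embed_apply (k : K) (x : X k) :
    embed S k x = (S k).ψ x • 1 + leg S k ((S k).toCirc x) := rfl

theorem wordSpace_nil : wordSpace S [] = 1 := rfl

theorem wordSpace_cons (k : K) (w : List K) :
    wordSpace S (k :: w) = LinearMap.range (leg S k) * wordSpace S w := by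
  simp [wordSpace]

theorem wordSpace_concat (k : K) (w : List K) :
    wordSpace S (w ++ [k]) = wordSpace S w * LinearMap.range (leg S k) := by
  simp [wordSpace]

theorem wordSpace_le {w : List K} (h : Alternating w) : wordSpace S w ≤ freeSpace S :=
  le_iSup (fun w : {w : List K // Alternating w} => wordSpace S w.1) ⟨w, h⟩

theorem one_mem_freeSpace : (1 : Tensors S) ∈ freeSpace S :=
  wordSpace_le S (w := []) (by simp [Alternating])
    (by rw [wordSpace_nil]; exact Submodule.one_le.1 le_rfl)

theorem freeSpaceCirc_le : freeSpaceCirc S ≤ freeSpace S :=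
  iSup_le fun w => wordSpace_le S w.2.1

theorem freeSpaceLeft_le (k : K) : freeSpaceLeft S k ≤ freeSpace S :=
  iSup_le fun w => wordSpace_le S w.2.1

theorem freeSpaceRight_le (k : K) : freeSpaceRight S k ≤ freeSpace S :=
  iSup_le fun w => wordSpace_le S w.2.1

theorem alternating_cons {k : K} {w : List K} (h : Alternating w) (hk : w.head? ≠ some k) :
    Alternating (k :: w) := by
  rw [Alternating, List.isChain_cons]
  exact ⟨fun y hy e => hk (by rw [e]; exact hy), h⟩

theorem alternating_concat {k : K} {w : List K} (h : Alternating w)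
    (hk : w.getLast? ≠ some k) : Alternating (w ++ [k]) := by
  rw [Alternating, List.isChain_append]
  refine ⟨h, by simp, ?_⟩
  intro x hx y hy e
  simp only [List.head?_cons, Option.mem_def, Option.some.injEq] at hy
  exact hk (by rw [hy, ← e]; exact hx)

theorem leg_mul_mem {k : K} (x : (S k).circ) {y : Tensors S} (hy : y ∈ freeSpaceLeft S k) :
    leg S k x * y ∈ freeSpace S := by
  have : freeSpaceLeft S k ≤ (freeSpace S).comap (LinearMap.mulLeft ℂ (leg S k x)) := by
    refine iSup_le fun w y hy => ?_
    refine wordSpace_le S (alternating_cons w.2.1 w.2.2) ?_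
    rw [wordSpace_cons]
    exact Submodule.mul_mem_mul ⟨x, rfl⟩ hy
  exact this hy

theorem mul_leg_mem {k : K} (x : (S k).circ) {y : Tensors S} (hy : y ∈ freeSpaceRight S k) :
    y * leg S k x ∈ freeSpace S := by
  have : freeSpaceRight S k ≤ (freeSpace S).comap (LinearMap.mulRight ℂ (leg S k x)) := by
    refine iSup_le fun w y hy => ?_
    refine wordSpace_le S (alternating_concat w.2.1 w.2.2) ?_
    rw [wordSpace_concat]
    exact Submodule.mul_mem_mul hy ⟨x, rfl⟩
  exact this hy

theorem embed_mul_mem {k : K} (x : X k) {y : Tensors S} (hy : y ∈ freeSpaceLeft S k) :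
    embed S k x * y ∈ freeSpace S := by
  rw [embed_apply, add_mul, smul_mul_assoc, one_mul]
  exact add_mem (Submodule.smul_mem _ _ (freeSpaceLeft_le S k hy)) (leg_mul_mem S _ hy)

theorem mul_embed_mem {k : K} (x : X k) {y : Tensors S} (hy : y ∈ freeSpaceRight S k) :
    y * embed S k x ∈ freeSpace S := by
  rw [embed_apply, mul_add, mul_smul_comm, mul_one]
  exact add_mem (Submodule.smul_mem _ _ (freeSpaceRight_le S k hy)) (mul_leg_mem S _ hy)

/-- The map `V_k : X_k ⊗ X(ℓ, k) → X`, `x ⊗ y ↦ x y`, with `ξ_k ⊗ y ↦ y`. -/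
def leftMap (k : K) : X k ⊗[ℂ] freeSpaceLeft S k →ₗ[ℂ] freeSpace S :=
  TensorProduct.lift <| LinearMap.mk₂ ℂ
    (fun x y => ⟨embed S k x * y, embed_mul_mem S x y.2⟩)
    (fun x x' y => Subtype.ext (by simp [add_mul]))
    (fun c x y => Subtype.ext (by simp))
    (fun x y y' => Subtype.ext (by simp [mul_add]))
    (fun c x y => Subtype.ext (by simp))

/-- The map `W_k : X(r, k) ⊗ X_k → X`, `y ⊗ x ↦ y x`, with `y ⊗ ξ_k ↦ y`. -/
def rightMap (k : K) : freeSpaceRight S k ⊗[ℂ] X k →ₗ[ℂ] freeSpace S :=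
  TensorProduct.lift <| LinearMap.mk₂ ℂ
    (fun y x => ⟨y * embed S k x, mul_embed_mem S x y.2⟩)
    (fun y y' x => Subtype.ext (by simp [add_mul]))
    (fun c y x => Subtype.ext (by simp))
    (fun y x x' => Subtype.ext (by simp [mul_add]))
    (fun c y x => Subtype.ext (by simp))

theorem leftMap_tmul (k : K) (x : X k) (y : freeSpaceLeft S k) :
    (leftMap S k (x ⊗ₜ y) : Tensors S) = embed S k x * y := rfl

theorem rightMap_tmul (k : K) (y : freeSpaceRight S k) (x : X k) :
    (rightMap S k (y ⊗ₜ x) : Tensors S) = y * embed S k x := rfl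

/-- Strips a first leg in `X°_k`. -/
def stripLeftAt (k : K) : Tensors S →ₗ[ℂ] (S k).circ ⊗[ℂ] Tensors S :=
  LinearMap.rTensor _ (DirectSum.component ℂ K (fun k => (S k).circ) k) ∘ₗ stripLeft _

/-- Strips a last leg in `X°_k`. -/
def stripRightAt (k : K) : Tensors S →ₗ[ℂ] Tensors S ⊗[ℂ] (S k).circ :=
  LinearMap.lTensor _ (DirectSum.component ℂ K (fun k => (S k).circ) k) ∘ₗ stripRight _

theorem stripLeftAt_leg_mul (k : K) (x : (S k).circ) (y : Tensors S) :
    stripLeftAt S k (leg S k x * y) = x ⊗ₜ y := by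
  simp [stripLeftAt, leg, stripLeft_ι_mul, DirectSum.component.lof_self]

theorem stripRightAt_mul_leg (k : K) (x : (S k).circ) (y : Tensors S) :
    stripRightAt S k (y * leg S k x) = y ⊗ₜ x := by
  simp [stripRightAt, leg, stripRight_mul_ι, DirectSum.component.lof_self]

theorem stripLeftAt_eq_zero {k : K} {y : Tensors S} (hy : y ∈ freeSpaceLeft S k) :
    stripLeftAt S k y = 0 := by
  have : freeSpaceLeft S k ≤ LinearMap.ker (stripLeftAt S k) := by
    refine iSup_le ?_
    rintro ⟨w, hw, hk⟩
    cases w with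
    | nil =>
      change wordSpace S [] ≤ _
      rw [wordSpace_nil, Submodule.one_le, LinearMap.mem_ker]
      simp [stripLeftAt, stripLeft_one]
    | cons j w =>
      change wordSpace S (j :: w) ≤ _
      rw [wordSpace_cons, Submodule.mul_le]
      rintro _ ⟨x, rfl⟩ t -
      have hjk : j ≠ k := fun e => hk (by simp [e])
      rw [LinearMap.mem_ker]
      simp [stripLeftAt, leg, stripLeft_ι_mul, DirectSum.component.of, hjk]
  exact this hy

theorem stripRightAt_eq_zero {k : K} {y : Tensors S} (hy : y ∈ freeSpaceRight S k) :
    stripRightAt S k y = 0 := by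
  have : freeSpaceRight S k ≤ LinearMap.ker (stripRightAt S k) := by
    refine iSup_le ?_
    rintro ⟨w, hw, hk⟩
    rcases List.eq_nil_or_concat' w with rfl | ⟨w, j, rfl⟩
    · change wordSpace S [] ≤ _
      rw [wordSpace_nil, Submodule.one_le, LinearMap.mem_ker]
      simp [stripRightAt, stripRight_one]
    · change wordSpace S (w ++ [j]) ≤ _
      rw [wordSpace_concat, Submodule.mul_le]
      rintro t - _ ⟨x, rfl⟩
      have hjk : j ≠ k := fun e => hk (by simp [e])
      rw [LinearMap.mem_ker]
      simp [stripRightAt, leg, stripRight_mul_ι, DirectSum.component.of, hjk]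
  exact this hy

theorem leftMap_injective (k : K) : Function.Injective (leftMap S k) := by
  let m : (S k).circ ⊗[ℂ] Tensors S →ₗ[ℂ] Tensors S :=
    LinearMap.mul' ℂ _ ∘ₗ LinearMap.rTensor _ (leg S k)
  let G : Tensors S →ₗ[ℂ] X k ⊗[ℂ] Tensors S :=
    LinearMap.rTensor _ (S k).circ.subtype ∘ₗ stripLeftAt S k +
      TensorProduct.mk ℂ _ _ (S k).ξ ∘ₗ (LinearMap.id - m ∘ₗ stripLeftAt S k)
  have key : G ∘ₗ (freeSpace S).subtype ∘ₗ leftMap S k =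
      LinearMap.lTensor (X k) (freeSpaceLeft S k).subtype := by
    refine TensorProduct.ext' fun x y => ?_
    have h1 : stripLeftAt S k (embed S k x * y) = (S k).toCirc x ⊗ₜ (y : Tensors S) := by
      rw [embed_apply, add_mul, map_add, stripLeftAt_leg_mul, smul_mul_assoc, one_mul, map_smul,
        stripLeftAt_eq_zero S y.2, smul_zero, zero_add]
    have h2 : embed S k x * (y : Tensors S) - leg S k ((S k).toCirc x) * y = (S k).ψ x • y := by
      rw [embed_apply, add_mul, smul_mul_assoc, one_mul, add_sub_cancel_right]
    simp only [G, m, LinearMap.comp_apply, LinearMap.add_apply, LinearMap.sub_apply,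
      Submodule.subtype_apply, leftMap_tmul, h1, LinearMap.rTensor_tmul, LinearMap.id_apply,
      LinearMap.mul'_apply, h2, LinearMap.lTensor_tmul, TensorProduct.mk_apply]
    rw [← TensorProduct.smul_tmul, ← TensorProduct.add_tmul, add_comm,
      (S k).ψ_smul_add_toCirc x]
  have hinj : Function.Injective (LinearMap.lTensor (X k) (freeSpaceLeft S k).subtype) :=
    Module.Flat.lTensor_preserves_injective_linearMap _ (Submodule.injective_subtype _)
  rw [← key] at hinj
  intro a b h
  refine hinj ?_
  simp only [LinearMap.comp_apply, h]

theorem rightMap_injective (k : K) : Function.Injective (rightMap S k) := by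
  let m : Tensors S ⊗[ℂ] (S k).circ →ₗ[ℂ] Tensors S :=
    LinearMap.mul' ℂ _ ∘ₗ LinearMap.lTensor _ (leg S k)
  let G : Tensors S →ₗ[ℂ] Tensors S ⊗[ℂ] X k :=
    LinearMap.lTensor _ (S k).circ.subtype ∘ₗ stripRightAt S k +
      (TensorProduct.mk ℂ _ _).flip (S k).ξ ∘ₗ (LinearMap.id - m ∘ₗ stripRightAt S k)
  have key : G ∘ₗ (freeSpace S).subtype ∘ₗ rightMap S k =
      LinearMap.rTensor (X k) (freeSpaceRight S k).subtype := by
    refine TensorProduct.ext' fun y x => ?_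
    have h1 : stripRightAt S k (y * embed S k x) = (y : Tensors S) ⊗ₜ (S k).toCirc x := by
      rw [embed_apply, mul_add, map_add, stripRightAt_mul_leg, mul_smul_comm, mul_one, map_smul,
        stripRightAt_eq_zero S y.2, smul_zero, zero_add]
    have h2 : (y : Tensors S) * embed S k x - y * leg S k ((S k).toCirc x) = (S k).ψ x • y := by
      rw [embed_apply, mul_add, mul_smul_comm, mul_one, add_sub_cancel_right]
    simp only [G, m, LinearMap.comp_apply, LinearMap.add_apply, LinearMap.sub_apply,
      Submodule.subtype_apply, rightMap_tmul, h1, LinearMap.rTensor_tmul, LinearMap.id_apply,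
      LinearMap.mul'_apply, h2, LinearMap.lTensor_tmul, TensorProduct.mk_apply,
      LinearMap.flip_apply]
    rw [TensorProduct.smul_tmul, ← TensorProduct.tmul_add, add_comm,
      (S k).ψ_smul_add_toCirc x]
  have hinj : Function.Injective (LinearMap.rTensor (X k) (freeSpaceRight S k).subtype) :=
    Module.Flat.rTensor_preserves_injective_linearMap _ (Submodule.injective_subtype _)
  rw [← key] at hinj
  intro a b h
  refine hinj ?_
  simp only [LinearMap.comp_apply, h]

theorem embed_ξ (k : K) : embed S k (S k).ξ = 1 := by
  rw [embed_apply, (S k).ψ_ξ, (S k).toCirc_ξ, map_zero, add_zero, one_smul]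

theorem embed_coe (k : K) (x : (S k).circ) : embed S k (x : X k) = leg S k x := by
  rw [embed_apply, (S k).ψ_coe, (S k).toCirc_coe, zero_smul, zero_add]

theorem leftMap_surjective (k : K) : Function.Surjective (leftMap S k) := by
  have main : freeSpace S ≤ (LinearMap.range (leftMap S k)).map (freeSpace S).subtype := by
    refine iSup_le ?_
    rintro ⟨w, hw⟩
    by_cases hk : w.head? = some k
    · obtain ⟨w, rfl⟩ : ∃ v, w = k :: v := by
        cases w with
        | nil => simp at hk
        | cons j v => exact ⟨v, by simp at hk; rw [hk]⟩
      have hw2 : Alternating w ∧ w.head? ≠ some k := by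
        rw [Alternating, List.isChain_cons] at hw
        exact ⟨hw.2, fun e => hw.1 k e rfl⟩
      change wordSpace S (k :: w) ≤ _
      rw [wordSpace_cons, Submodule.mul_le]
      rintro _ ⟨x, rfl⟩ t ht
      have ht2 : t ∈ freeSpaceLeft S k :=
        le_iSup (fun w : {w : List K // Alternating w ∧ w.head? ≠ some k} => wordSpace S w.1)
          ⟨w, hw2⟩ ht
      refine ⟨_, ⟨(x : X k) ⊗ₜ ⟨t, ht2⟩, rfl⟩, ?_⟩
      rw [Submodule.subtype_apply, leftMap_tmul, embed_coe]
    · intro t ht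
      have ht2 : t ∈ freeSpaceLeft S k :=
        le_iSup (fun w : {w : List K // Alternating w ∧ w.head? ≠ some k} => wordSpace S w.1)
          ⟨w, hw, hk⟩ ht
      refine ⟨_, ⟨(S k).ξ ⊗ₜ ⟨t, ht2⟩, rfl⟩, ?_⟩
      rw [Submodule.subtype_apply, leftMap_tmul, embed_ξ, one_mul]
  intro z
  obtain ⟨_, ⟨u, rfl⟩, hu⟩ := main z.2
  exact ⟨u, Subtype.ext hu⟩

theorem rightMap_surjective (k : K) : Function.Surjective (rightMap S k) := by
  have main : freeSpace S ≤ (LinearMap.range (rightMap S k)).map (freeSpace S).subtype := by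
    refine iSup_le ?_
    rintro ⟨w, hw⟩
    by_cases hk : w.getLast? = some k
    · obtain ⟨w, rfl⟩ : ∃ v, w = v ++ [k] := by
        rcases List.eq_nil_or_concat' w with rfl | ⟨v, j, rfl⟩
        · simp at hk
        · exact ⟨v, by simp at hk; rw [hk]⟩
      have hw2 : Alternating w ∧ w.getLast? ≠ some k := by
        rw [Alternating, List.isChain_append] at hw
        exact ⟨hw.1, fun e => hw.2.2 k e k (by simp) rfl⟩
      change wordSpace S (w ++ [k]) ≤ _
      rw [wordSpace_concat, Submodule.mul_le]
      rintro t ht _ ⟨x, rfl⟩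
      have ht2 : t ∈ freeSpaceRight S k :=
        le_iSup (fun w : {w : List K // Alternating w ∧ w.getLast? ≠ some k} => wordSpace S w.1)
          ⟨w, hw2⟩ ht
      refine ⟨_, ⟨⟨t, ht2⟩ ⊗ₜ (x : X k), rfl⟩, ?_⟩
      rw [Submodule.subtype_apply, rightMap_tmul, embed_coe]
    · intro t ht
      have ht2 : t ∈ freeSpaceRight S k :=
        le_iSup (fun w : {w : List K // Alternating w ∧ w.getLast? ≠ some k} => wordSpace S w.1)
          ⟨w, hw, hk⟩ ht
      refine ⟨_, ⟨⟨t, ht2⟩ ⊗ₜ (S k).ξ, rfl⟩, ?_⟩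
      rw [Submodule.subtype_apply, rightMap_tmul, embed_ξ, mul_one]
  intro z
  obtain ⟨_, ⟨u, rfl⟩, hu⟩ := main z.2
  exact ⟨u, Subtype.ext hu⟩

/-- The identification `V_k : X_k ⊗ X(ℓ, k) ≃ X`. -/
def leftEquiv (k : K) : (X k ⊗[ℂ] freeSpaceLeft S k) ≃ₗ[ℂ] freeSpace S :=
  LinearEquiv.ofBijective (leftMap S k) ⟨leftMap_injective S k, leftMap_surjective S k⟩

/-- The identification `W_k : X(r, k) ⊗ X_k ≃ X`. -/
def rightEquiv (k : K) : (freeSpaceRight S k ⊗[ℂ] X k) ≃ₗ[ℂ] freeSpace S :=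
  LinearEquiv.ofBijective (rightMap S k) ⟨rightMap_injective S k, rightMap_surjective S k⟩

/-- The left representation `λ_k (T) = V_k (T ⊗ I) V_k⁻¹`. -/
def leftRep (k : K) : Module.End ℂ (X k) →ₐ[ℂ] Module.End ℂ (freeSpace S) :=
  ((leftEquiv S k).conjAlgEquiv ℂ).toAlgHom.comp
    (Module.End.rTensorAlgHom ℂ (X k) (freeSpaceLeft S k))

/-- The right representation `ρ_k (T) = W_k (I ⊗ T) W_k⁻¹`. -/
def rightRep (k : K) : Module.End ℂ (X k) →ₐ[ℂ] Module.End ℂ (freeSpace S) :=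
  ((rightEquiv S k).conjAlgEquiv ℂ).toAlgHom.comp
    (Module.End.lTensorAlgHom ℂ (X k) (freeSpaceRight S k))

theorem freeSpaceCirc_le_ker : freeSpaceCirc S ≤
    LinearMap.ker (TensorAlgebra.algebraMapInv (R := ℂ)
      (M := ⨁ k, (S k).circ)).toLinearMap := by
  refine iSup_le ?_
  rintro ⟨w, hw, hne⟩
  cases w with
  | nil => exact absurd rfl hne
  | cons j w =>
    change wordSpace S (j :: w) ≤ _
    rw [wordSpace_cons, Submodule.mul_le]
    rintro _ ⟨x, rfl⟩ t -
    simp [leg, TensorAlgebra.algebraMapInv]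

/-- The c-free product `(X, X°, ξ, φ)` of a family of two-state vector spaces with specified
state-vectors: `ξ = 1`, and `φ (x_1 ⊗ ⋯ ⊗ x_n) = φ_{k_1} (x_1) ⋯ φ_{k_n} (x_n)` for
`x_i ∈ X°_{k_i}`. -/
def freeProduct : TwoStateSpace (freeSpace S) where
  circ := (freeSpaceCirc S).comap (freeSpace S).subtype
  ξ := ⟨1, one_mem_freeSpace S⟩
  ξ_ne_zero := fun h => one_ne_zero (congrArg Subtype.val h)
  isCompl := by
    constructor
    · rw [Submodule.disjoint_def]
      intro z hz hz2
      obtain ⟨c, rfl⟩ := Submodule.mem_span_singleton.1 hz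
      have h := freeSpaceCirc_le_ker S hz2
      have hc : c = 0 := by simpa using h
      rw [hc, zero_smul]
    · rw [codisjoint_iff, eq_top_iff]
      rintro ⟨z, hz⟩ -
      have main : freeSpace S ≤ (ℂ ∙ (1 : Tensors S)) ⊔ freeSpaceCirc S := by
        refine iSup_le ?_
        rintro ⟨w, hw⟩
        by_cases hne : w = []
        · subst hne
          refine le_trans ?_ le_sup_left
          change wordSpace S [] ≤ _
          rw [wordSpace_nil, Submodule.one_le]
          exact Submodule.mem_span_singleton_self _
        · exact le_trans (le_iSup (fun w : {w : List K // Alternating w ∧ w ≠ []} =>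
            wordSpace S w.1) ⟨w, hw, hne⟩) le_sup_right
      obtain ⟨a, ha, b, hb, hab⟩ := Submodule.mem_sup.1 (main hz)
      obtain ⟨c, rfl⟩ := Submodule.mem_span_singleton.1 ha
      refine Submodule.mem_sup.2 ⟨c • ⟨1, one_mem_freeSpace S⟩,
        Submodule.smul_mem _ _ (Submodule.mem_span_singleton_self _),
        ⟨b, freeSpaceCirc_le S hb⟩, hb, Subtype.ext hab⟩
  φ := (TensorAlgebra.lift ℂ (DirectSum.toModule ℂ K ℂ
    fun k => (S k).φ ∘ₗ (S k).circ.subtype)).toLinearMap ∘ₗ (freeSpace S).subtype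
  φ_ξ := by simp

end FreeProduct

/-! ### Pairs of algebras, joint pair-distributions and c-bi-freeness -/

/-- The two sides `ℓ` and `r`. -/
inductive Side : Type
  | left : Side
  | right : Side

section Independence


variable {K : Type v} {A : Type u} [Ring A] [Algebra ℂ A] (𝒜 : K → Side → Subalgebra ℂ A)

/-- The free product `*_{k ∈ K} (A_{k,ℓ} * A_{k,r})` of all the algebras `A_{k,ℓ}`, `A_{k,r}`. -/
abbrev JointAlgebra : Type _ :=
  LinearAlgebra.FreeProduct ℂ (fun p : K × Side => 𝒜 p.1 p.2)

/-- The free product `A_{k,ℓ} * A_{k,r}`. -/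
abbrev PairAlgebra (k : K) : Type _ :=
  LinearAlgebra.FreeProduct ℂ (fun s : Side => 𝒜 k s)

/-- The functional `f ∘ τ` on `*_{k ∈ K} (A_{k,ℓ} * A_{k,r})`, where `τ` is the homomorphism
that extends the homomorphisms `h k s` of the algebras `A_{k,s}`. -/
def jointDistribution {B : Type*} [Semiring B] [Algebra ℂ B] (f : B →ₗ[ℂ] ℂ)
    (h : ∀ k s, 𝒜 k s →ₐ[ℂ] B) : JointAlgebra 𝒜 →ₗ[ℂ] ℂ :=
  f ∘ₗ (LinearAlgebra.FreeProduct.lift ℂ (fun p : K × Side => 𝒜 p.1 p.2)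
    (fun {p} => h p.1 p.2)).toLinearMap

/-- The functional `f ∘ τ` on `A_{k,ℓ} * A_{k,r}`, where `τ` is the homomorphism that extends
the homomorphisms `h s` of the algebras `A_{k,s}`. -/
def pairDistribution {B : Type*} [Semiring B] [Algebra ℂ B] (f : B →ₗ[ℂ] ℂ) (k : K)
    (h : ∀ s, 𝒜 k s →ₐ[ℂ] B) : PairAlgebra 𝒜 k →ₗ[ℂ] ℂ :=
  f ∘ₗ (LinearAlgebra.FreeProduct.lift ℂ (fun s : Side => 𝒜 k s)
    (fun {s} => h s)).toLinearMap

/-- A choice of two-state vector spaces with specified state-vectors `(X_k, X°_k, ξ_k, φ_k)`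
and of unital homomorphisms `ℓ_k : A_{k,ℓ} → L(X_k)` and `r_k : A_{k,r} → L(X_k)`, written
`hom k left` and `hom k right`. -/
structure Rep where
  X : K → Type w
  [group : ∀ k, AddCommGroup (X k)]
  [module : ∀ k, Module ℂ (X k)]
  space : ∀ k, TwoStateSpace (X k)
  hom : ∀ k s, 𝒜 k s →ₐ[ℂ] Module.End ℂ (X k)

attribute [instance] Rep.group Rep.module

namespace Rep

variable {𝒜} (R : Rep.{u, v, w} 𝒜)

/-- The homomorphisms `λ_k ∘ ℓ_k` and `ρ_k ∘ r_k` into the operators on the c-free product. -/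
def act (k : K) : ∀ s, 𝒜 k s →ₐ[ℂ] Module.End ℂ (freeSpace R.space)
  | Side.left => (leftRep R.space k).comp (R.hom k Side.left)
  | Side.right => (rightRep R.space k).comp (R.hom k Side.right)

/-- The first component `μ` of the joint pair-distribution of the family
`{(λ_k ∘ ℓ_k (A_{k,ℓ}), ρ_k ∘ r_k (A_{k,r}))}` in `(L(X), φ_ξ, ψ_ξ)`. -/
def jointφ : JointAlgebra 𝒜 →ₗ[ℂ] ℂ :=
  jointDistribution 𝒜 (freeProduct R.space).φState R.act

/-- The second component `ν` of the joint pair-distribution of the family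
`{(λ_k ∘ ℓ_k (A_{k,ℓ}), ρ_k ∘ r_k (A_{k,r}))}` in `(L(X), φ_ξ, ψ_ξ)`. -/
def jointψ : JointAlgebra 𝒜 →ₗ[ℂ] ℂ :=
  jointDistribution 𝒜 (freeProduct R.space).ψState R.act

/-- The first component of the pair-distribution of the pair `(ℓ_k, r_k)` in
`(L(X_k), φ_{ξ_k}, ψ_{ξ_k})`. -/
def pairφ (k : K) : PairAlgebra 𝒜 k →ₗ[ℂ] ℂ :=
  pairDistribution 𝒜 (R.space k).φState k (R.hom k)

/-- The second component of the pair-distribution of the pair `(ℓ_k, r_k)` in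
`(L(X_k), φ_{ξ_k}, ψ_{ξ_k})`. -/
def pairψ (k : K) : PairAlgebra 𝒜 k →ₗ[ℂ] ℂ :=
  pairDistribution 𝒜 (R.space k).ψState k (R.hom k)

end Rep

/-- The joint pair-distribution of the family `𝒜` in `(A, φ, ψ)` equals the joint
pair-distribution that the choice `R` gives on the c-free product. -/
def Computes (φ ψ : A →ₗ[ℂ] ℂ) (R : Rep.{u, v, w} 𝒜) : Prop :=
  jointDistribution 𝒜 φ (fun k s => (𝒜 k s).val) = R.jointφ ∧
    jointDistribution 𝒜 ψ (fun k s => (𝒜 k s).val) = R.jointψ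

/-- For every single `k`, the pair-distribution of `(A_{k,ℓ}, A_{k,r})` in `(A, φ, ψ)` equals
that of `(ℓ_k, r_k)` in `(L(X_k), φ_{ξ_k}, ψ_{ξ_k})`. -/
def Realizes (φ ψ : A →ₗ[ℂ] ℂ) (R : Rep.{u, v, w} 𝒜) : Prop :=
  ∀ k, pairDistribution 𝒜 φ k (fun s => (𝒜 k s).val) = R.pairφ k ∧
    pairDistribution 𝒜 ψ k (fun s => (𝒜 k s).val) = R.pairψ k

/-- Conditional bi-free independence of the family `{(A_{k,ℓ}, A_{k,r})}` in `(A, φ, ψ)`. -/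
def IsCBiFree (φ ψ : A →ₗ[ℂ] ℂ) : Prop :=
  ∃ R : Rep.{u, v, u} 𝒜, Computes 𝒜 φ ψ R

end Independence

/-! ### Bi-non-crossing partitions -/

section Combinatorics

variable {n : ℕ}

/-- Partitions of the set of nodes. The nodes `1, …, n` are the elements of `Fin n`. -/
abbrev Part (n : ℕ) : Type := Finpartition (Finset.univ : Finset (Fin n))

/-- The order `≺_χ`: first the left nodes, increasing, then the right nodes, decreasing. -/
def ChiLT (χ : Fin n → Side) (i j : Fin n) : Prop :=
  match χ i, χ j with
  | Side.left, Side.left => i < j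
  | Side.left, Side.right => True
  | Side.right, Side.left => False
  | Side.right, Side.right => j < i

/-- `π` is bi-non-crossing: it is non-crossing for the order `≺_χ`. -/
def IsBNC (χ : Fin n → Side) (π : Part n) : Prop :=
  ∀ V ∈ π.parts, ∀ W ∈ π.parts, ∀ a ∈ V, ∀ b ∈ W, ∀ c ∈ V, ∀ d ∈ W,
    ChiLT χ a b → ChiLT χ b c → ChiLT χ c d → V = W

/-- The set `BNC(χ)`, ordered by refinement. -/
abbrev BNC (χ : Fin n → Side) : Type := {π : Part n // IsBNC χ π}

instance (χ : Fin n → Side) : LocallyFiniteOrder (BNC χ) := Fintype.toLocallyFiniteOrder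

/-- The Möbius function of the finite partially ordered set `BNC(χ)`. -/
def muBNC (χ : Fin n → Side) (π σ : BNC χ) : ℤ := IncidenceAlgebra.mu ℤ π σ

/-- Every block of `π` has one colour, that is, `π ≤ ω`. -/
def Monochrome {K : Type*} (ω : Fin n → K) (π : Part n) : Prop :=
  ∀ V ∈ π.parts, ∀ i ∈ V, ∀ j ∈ V, ω i = ω j

/-- The product of the `a i`, `i ∈ V`, in increasing order of `i`. -/
def blockProd {A : Type*} [Monoid A] (a : Fin n → A) (V : Finset (Fin n)) : A :=
  ((V.sort (· ≤ ·)).map a).prod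

/-- The moment `ψ_π (a_1, …, a_n)`. -/
def partMoment {A : Type*} [Ring A] [Algebra ℂ A] (ψ : A →ₗ[ℂ] ℂ) (π : Part n)
    (a : Fin n → A) : ℂ :=
  ∏ V ∈ π.parts, ψ (blockProd a V)

/-! ### Shaded diagrams -/

/-- A diagram while it is being built from bottom to top: `closed` holds the blocks whose spine
does not reach the top (isolated nodes included), and `spines` lists, from left to right, the
spines that reach the top, each with its shade and the set of nodes attached to it. -/
@[ext]
structure Picture (K : Type*) (n : ℕ) where
  closed : Finset (Finset (Fin n))
  spines : List (K × Finset (Fin n))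

/-- The mirror image of the order of the spines. -/
def Picture.mirror {K : Type*} (P : Picture K n) : Picture K n :=
  ⟨P.closed, P.spines.reverse⟩

/-- The nodes of a diagram on `n` nodes become the nodes `2, …, n + 1`. -/
def Picture.shift {K : Type*} (P : Picture K n) : Picture K (n + 1) :=
  ⟨P.closed.image fun V => V.map (Fin.succEmb n),
    P.spines.map fun p => (p.1, p.2.map (Fin.succEmb n))⟩

/-- The two ways of adding a left node of shade `c`, the node `0`, on top of `P`. If the nearest
spine, which is the first one, has shade `c`, then the node is connected to it and the spine is
extended to the top or not. Otherwise the node is isolated, or it starts a new spine. -/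
def Picture.addLeft {K : Type*} (c : K) (P : Picture K (n + 1)) : List (Picture K (n + 1)) :=
  match P.spines with
  | [] => [⟨insert {0} P.closed, []⟩, ⟨P.closed, [(c, {0})]⟩]
  | (k, V) :: rest =>
    if k = c then
      [⟨P.closed, (k, insert 0 V) :: rest⟩, ⟨insert (insert 0 V) P.closed, rest⟩]
    else
      [⟨insert {0} P.closed, (k, V) :: rest⟩, ⟨P.closed, (c, {0}) :: (k, V) :: rest⟩]

/-- The two ways of adding a node of shade `c` on the side `s` on top of a diagram. -/
def Picture.add {K : Type*} (s : Side) (c : K) (P : Picture K n) : List (Picture K (n + 1)) :=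
  match s with
  | Side.left => P.shift.addLeft c
  | Side.right => (P.shift.mirror.addLeft c).map Picture.mirror

/-- The shaded diagrams for `χ` and `ω`, constructed by adding the nodes `n, …, 2, 1` one after
the other to the top of the empty diagram. -/
def pictures {K : Type*} : ∀ {n : ℕ}, (Fin n → Side) → (Fin n → K) → List (Picture K n)
  | 0, _, _ => [⟨∅, []⟩]
  | _ + 1, χ, ω =>
    (pictures (fun i => χ i.succ) (fun i => ω i.succ)).flatMap (Picture.add (χ 0) (ω 0))

/-- A diagram: a partition of the nodes, and the set of those blocks whose spine reaches the
top. -/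
@[ext]
structure Diagram (n : ℕ) where
  part : Part n
  top : Finset (Finset (Fin n))
  top_subset : top ⊆ part.parts

instance : Fintype (Diagram n) :=
  Fintype.ofInjective (fun D : Diagram n => (D.part, D.top)) fun _ _ h =>
    Diagram.ext (congrArg Prod.fst h) (congrArg Prod.snd h)

/-- `|D|`: the number of blocks plus the number of spines that reach the top. -/
def Diagram.size (D : Diagram n) : ℕ := D.part.parts.card + D.top.card

/-- The set `LR(χ, ω)` of shaded diagrams. -/
def LR {K : Type*} (χ : Fin n → Side) (ω : Fin n → K) : Finset (Diagram n) :=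
  {D | ∃ P ∈ pictures χ ω, D.top = (P.spines.map Prod.snd).toFinset ∧
    D.part.parts = P.closed ∪ D.top}

/-- `E` is a lateral refinement of `D`: spines are cut between ribs. A spine of `D` is thereby
cut into pieces that hold consecutive nodes of the block, and the piece of a spine of `D` that
reaches the top is the one with the uppermost node of the block. -/
def LatRefines (D E : Diagram n) : Prop :=
  E.part ≤ D.part ∧
  (∀ U ∈ E.part.parts, ∀ V ∈ D.part.parts, U ⊆ V →
    ∀ i ∈ U, ∀ j ∈ U, ∀ m ∈ V, i ≤ m → m ≤ j → m ∈ U) ∧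
  (∀ U ∈ E.part.parts, U ∈ E.top ↔ ∃ V ∈ D.top, U ⊆ V ∧ ∃ i ∈ U, ∀ m ∈ V, i ≤ m)

/-- `E` is a capping of `D`: some spines that reach the top in `D` no longer do so in `E`. -/
def Caps (D E : Diagram n) : Prop := E.part = D.part ∧ E.top ⊆ D.top

/-- `D` laterally caps to `E`: `E` is a capping of a lateral refinement of `D`. -/
def LatCaps (D E : Diagram n) : Prop := ∃ F : Diagram n, LatRefines D F ∧ Caps F E

/-- The set of all cappings of lateral refinements of diagrams in `LR(χ, ω)`. -/
def LRLatCap {K : Type*} (χ : Fin n → Side) (ω : Fin n → K) : Finset (Diagram n) :=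
  {E | ∃ D ∈ LR χ ω, LatCaps D E}

/-- `φ_D (a_1, …, a_n)`: blocks whose spine reaches the top contribute `φ`-moments, the other
blocks contribute `ψ`-moments. -/
def diagramMoment {A : Type*} [Ring A] [Algebra ℂ A] (φ ψ : A →ₗ[ℂ] ℂ) (D : Diagram n)
    (a : Fin n → A) : ℂ :=
  (∏ V ∈ D.part.parts \ D.top, ψ (blockProd a V)) * ∏ V ∈ D.top, φ (blockProd a V)

end Combinatorics

/-! ### The two moment formulas -/

section Formulas

variable {K A : Type*} [Ring A] [Algebra ℂ A] {n : ℕ}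

/-- The formula
`ψ (a_1 ⋯ a_n) = ∑_{π ∈ BNC(χ)} [∑_{σ ∈ BNC(χ), π ≤ σ ≤ ω} μ (π, σ)] ψ_π (a_1, …, a_n)`. -/
def PsiFormula (ψ : A →ₗ[ℂ] ℂ) (χ : Fin n → Side) (ω : Fin n → K) (a : Fin n → A) : Prop :=
  ψ (List.ofFn a).prod =
    ∑ π : BNC χ,
      ((∑ σ : BNC χ with π ≤ σ ∧ Monochrome ω σ.1, muBNC χ π σ : ℤ) : ℂ) * partMoment ψ π.1 a

/-- The formula
`φ (a_1 ⋯ a_n) = ∑_{D ∈ LR^latcap} [∑_{E ∈ LR, E ≥_latcap D} (-1)^(|D| - |E|)] φ_D (a_1, …, a_n)`.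
-/
def PhiFormula (φ ψ : A →ₗ[ℂ] ℂ) (χ : Fin n → Side) (ω : Fin n → K) (a : Fin n → A) : Prop :=
  φ (List.ofFn a).prod =
    ∑ D ∈ LRLatCap χ ω,
      (∑ E ∈ LR χ ω with LatCaps E D, (-1 : ℂ) ^ ((D.size : ℤ) - (E.size : ℤ))) *
        diagramMoment φ ψ D a

end Formulas

end CBiFree

end

/-! The vector `T_1 ⋯ T_n ξ` in the c-free product can be computed by letting the operators act one
after the other, starting with `T_n`. An operator of colour `k` acts on the outermost leg on its
side if that leg has colour `k`, and otherwise on `ξ_k`. In both cases the result `v` splits as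
`ψ_k(v) ξ_k + (1 - p) v`. The first term gives a scalar and closes a block; the second leaves a leg,
that is, a spine that reaches the top. These are exactly the two choices in the construction of
`LR(χ, ω)`. So the vector is a sum over pictures, where a block `V` contributes the vector `v_V =
T_{i_1} (1 - p) T_{i_2} ⋯ (1 - p) T_{i_m} ξ`: through `ψ(v_V)` if it is closed, and through the leg
`(1 - p) v_V` if it reaches the top (`prod_sideRep_one_eq_sum_pictures`).

Both states on the product are multiplicative on tensors. For such a functional, built from `f = φ`
or `f = ψ`, a spine that reaches the top contributes `f(v_V) - ψ(v_V)`. Expanding every inner `1 -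
p` turns `f(v_V)` into an alternating sum over the ways to cut `V` between consecutive nodes
(`apply_blockVec_eq_sum`); the piece with the smallest node carries an `f`-moment and the other
pieces carry `ψ`-moments. The cuts are lateral refinements, and choosing `-ψ(v_V)` instead of
`f(v_V)` is a capping. Multiplying out over the blocks and exchanging the sums over `D'` and `D`
gives the moment formula `tensorsFunctional_prod_eq_sum_LRLatCap`. With `f = φ` it is the formula
for `φ`.

With `f = ψ` the moment depends only on the partition, and grouping the diagrams by partition gives
coefficients `c(π)`. By Möbius inversion on `BNC(χ)` it suffices that the sum of `c(π)` over `π ≥ ρ`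
is `1` if `ρ ≤ ω` and `0` otherwise. For monochrome `ρ` this is obtained without further
combinatorics, by evaluating the moment formula on a test family: translations on a product of
cyclic groups, one factor `ℤ/|V|` for each block `V` of `ρ`. There the moment of `π` is `1` or `0`
according as `ρ ≤ π` or not, while the joint moment is `1`: the operators commute within each
colour, so the right ones can be replaced by left ones in the order `≺_χ`, and since `ρ` is
non-crossing the blocks cancel from the inside outwards (`sum_latCapCoeff_of_monochrome`,
`partCoeff_eq_sum_mu`).

The formulas involve only the pair-distributions of the single colours, and words span the free
product of algebras; hence the joint pair-distribution of a representation is determined by these.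
Left multiplication on `A` with the vector `1` realizes the pair-distributions of the family, and
any representation that computes the joint pair-distribution also realizes the single ones. So
c-bi-freeness is equivalent to the two formulas. -/

noncomputable section

namespace CBiFree

/-! ### Two-state spaces given by a vector and two functionals -/

namespace TwoStateSpace

variable {X : Type*} [AddCommGroup X] [Module ℂ X]

/-- The two-state vector space with `X° = ker g`. -/
def ofFunctionals (ξ : X) (f g : X →ₗ[ℂ] ℂ) (hf : f ξ = 1) (hg : g ξ = 1) : TwoStateSpace X where
  circ := LinearMap.ker g
  ξ := ξ
  ξ_ne_zero := fun h => by simp [h] at hg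
  isCompl := by
    constructor
    · rw [Submodule.disjoint_def]
      intro z hz hz2
      obtain ⟨c, rfl⟩ := Submodule.mem_span_singleton.1 hz
      have : c = 0 := by simpa [hg] using hz2
      rw [this, zero_smul]
    · rw [codisjoint_iff, eq_top_iff]
      intro z _
      refine Submodule.mem_sup.2 ⟨g z • ξ,
        Submodule.smul_mem _ _ (Submodule.mem_span_singleton_self _), z - g z • ξ, ?_, by abel⟩
      simp [hg]
  φ := f
  φ_ξ := hf

/-- `ψ` is the only functional with `ψ ξ = 1` that vanishes on `X°`. -/
theorem ψ_unique (S : TwoStateSpace X) (g : X →ₗ[ℂ] ℂ) (h1 : g S.ξ = 1)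
    (h0 : ∀ x ∈ S.circ, g x = 0) : S.ψ = g := by
  ext x
  conv_rhs => rw [← S.ψ_smul_add_toCirc x]
  rw [map_add, map_smul, h1, h0 _ (S.toCirc x).2]
  simp

theorem ψ_ofFunctionals (ξ : X) (f g : X →ₗ[ℂ] ℂ) (hf : f ξ = 1) (hg : g ξ = 1) :
    (ofFunctionals ξ f g hf hg).ψ = g :=
  ψ_unique _ _ hg fun _ hx => hx

theorem toCirc_eq (S : TwoStateSpace X) (x : X) : (S.toCirc x : X) = x - S.ψ x • S.ξ := by
  rw [eq_sub_iff_add_eq, add_comm, ψ_smul_add_toCirc]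

end TwoStateSpace

/-! ### The action of the left and right representations -/

section Action

variable {K : Type*} {X : K → Type*} [∀ k, AddCommGroup (X k)] [∀ k, Module ℂ (X k)]
  (S : ∀ k, TwoStateSpace (X k))

theorem leftRep_apply_mul (k : K) (T : Module.End ℂ (X k)) (x : X k) (y : Tensors S)
    (hy : y ∈ freeSpaceLeft S k) :
    (leftRep S k T ⟨embed S k x * y, embed_mul_mem S x hy⟩ : Tensors S) = embed S k (T x) * y := by
  have h : (⟨embed S k x * y, embed_mul_mem S x hy⟩ : freeSpace S) =
    leftEquiv S k (x ⊗ₜ ⟨y, hy⟩) := rfl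
  rw [h]
  change (leftEquiv S k ((Module.End.rTensorAlgHom ℂ (X k) (freeSpaceLeft S k)) T
    ((leftEquiv S k).symm (leftEquiv S k (x ⊗ₜ ⟨y, hy⟩)))) : Tensors S) = _
  rw [LinearEquiv.symm_apply_apply]
  rfl

theorem rightRep_apply_mul (k : K) (T : Module.End ℂ (X k)) (x : X k) (y : Tensors S)
    (hy : y ∈ freeSpaceRight S k) :
    (rightRep S k T ⟨y * embed S k x, mul_embed_mem S x hy⟩ : Tensors S) = y * embed S k (T x) := by
  have h : (⟨y * embed S k x, mul_embed_mem S x hy⟩ : freeSpace S) =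
    rightEquiv S k (⟨y, hy⟩ ⊗ₜ x) := rfl
  rw [h]
  change (rightEquiv S k ((Module.End.lTensorAlgHom ℂ (X k) (freeSpaceRight S k)) T
    ((rightEquiv S k).symm (rightEquiv S k (⟨y, hy⟩ ⊗ₜ x)))) : Tensors S) = _
  rw [LinearEquiv.symm_apply_apply]
  rfl

/-- Any factorisation of `z` in the tensor algebra may be used, whatever the proof that `z` lies in
the free product. -/
theorem leftRep_eq {k : K} {T : Module.End ℂ (X k)} {x : X k} {y : Tensors S} {z : freeSpace S}
    (hy : y ∈ freeSpaceLeft S k) (hz : (z : Tensors S) = embed S k x * y) :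
    (leftRep S k T z : Tensors S) = embed S k (T x) * y := by
  have : z = ⟨embed S k x * y, embed_mul_mem S x hy⟩ := Subtype.ext hz
  rw [this, leftRep_apply_mul S k T x y hy]

theorem rightRep_eq {k : K} {T : Module.End ℂ (X k)} {x : X k} {y : Tensors S} {z : freeSpace S}
    (hy : y ∈ freeSpaceRight S k) (hz : (z : Tensors S) = y * embed S k x) :
    (rightRep S k T z : Tensors S) = y * embed S k (T x) := by
  have : z = ⟨y * embed S k x, mul_embed_mem S x hy⟩ := Subtype.ext hz
  rw [this, rightRep_apply_mul S k T x y hy]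

theorem wordSpace_le_left {k : K} {w : List K} (h : Alternating w) (hk : w.head? ≠ some k) :
    wordSpace S w ≤ freeSpaceLeft S k :=
  le_iSup (fun w : {w : List K // Alternating w ∧ w.head? ≠ some k} => wordSpace S w.1) ⟨w, h, hk⟩

theorem wordSpace_le_right {k : K} {w : List K} (h : Alternating w) (hk : w.getLast? ≠ some k) :
    wordSpace S w ≤ freeSpaceRight S k :=
  le_iSup (fun w : {w : List K // Alternating w ∧ w.getLast? ≠ some k} => wordSpace S w.1)
    ⟨w, h, hk⟩

theorem one_mem_wordSpace_nil : (1 : Tensors S) ∈ wordSpace S [] := by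
  rw [wordSpace_nil]; exact Submodule.one_le.1 le_rfl

theorem one_mem_left (k : K) : (1 : Tensors S) ∈ freeSpaceLeft S k :=
  wordSpace_le_left S (w := []) (by simp [Alternating]) (by simp) (one_mem_wordSpace_nil S)

theorem one_mem_right (k : K) : (1 : Tensors S) ∈ freeSpaceRight S k :=
  wordSpace_le_right S (w := []) (by simp [Alternating]) (by simp) (one_mem_wordSpace_nil S)

/-- `λ_k (T)` or `ρ_k (T)`, according to the side. -/
def sideRep : Side → ∀ k, Module.End ℂ (X k) →ₐ[ℂ] Module.End ℂ (freeSpace S)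
  | Side.left => leftRep S
  | Side.right => rightRep S

/-- On the copy of `X_k` in the free product the left and the right representation agree, since the
other tensor factor is `1`. -/
theorem sideRep_embed (s : Side) {k : K} (T : Module.End ℂ (X k)) {x : X k} {z : freeSpace S}
    (hz : (z : Tensors S) = embed S k x) : (sideRep S s k T z : Tensors S) = embed S k (T x) := by
  cases s
  · simpa [sideRep] using leftRep_eq S (T := T) (one_mem_left S k) (hz.trans (mul_one _).symm)
  · simpa [sideRep] using rightRep_eq S (T := T) (one_mem_right S k) (hz.trans (one_mul _).symm)

/-- Operators of a single colour act on the copy of `X_k` in the free product as they act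
on `X_k`. -/
theorem sideRep_prod_embed {ι : Type*} (s : ι → Side) {k : K} (T : ι → Module.End ℂ (X k))
    (l : List ι) {x : X k} {z : freeSpace S} (hz : (z : Tensors S) = embed S k x) :
    ((l.map fun i => sideRep S (s i) k (T i)).prod z : Tensors S) =
      embed S k ((l.map T).prod x) := by
  induction l with
  | nil => simpa using hz
  | cons i l ih => simpa using sideRep_embed S (s i) (T i) ih

/-- `λ_k (T)` and `ρ_j (T')` commute, unless `k = j` and `T`, `T'` do not commute. -/
theorem leftRep_rightRep_commute (k j : K) (T : Module.End ℂ (X k)) (T' : Module.End ℂ (X j))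
    (h : ∀ e : j = k, Commute T (e ▸ T')) :
    Commute (leftRep S k T) (rightRep S j T') := by
  -- The vectors on which the two composites agree; all alternating words are shown to lie in it.
  set C : Submodule ℂ (Tensors S) := (LinearMap.eqLocus (leftRep S k T * rightRep S j T')
    (rightRep S j T' * leftRep S k T)).map (freeSpace S).subtype with hC
  -- The last condition excludes the case of no word between two legs of one colour, the only one
  -- where the operators meet on the same leg.
  have key : ∀ (x : X k) (x' : X j) (m : List K) (y : Tensors S), y ∈ wordSpace S m →
      Alternating m → m.head? ≠ some k → m.getLast? ≠ some j → (m ≠ [] ∨ k ≠ j) →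
      embed S k x * y * embed S j x' ∈ C := by
    intro x x' m y hy hm h1 h2 h3
    have hl : ∀ x', y * embed S j x' ∈ freeSpaceLeft S k := by
      intro x'
      rw [embed_apply, mul_add, mul_smul_comm, mul_one]
      refine add_mem (Submodule.smul_mem _ _ (wordSpace_le_left S hm h1 hy))
        (wordSpace_le_left S (alternating_concat hm h2) ?_ ?_)
      · cases m with
        | nil =>
          have := h3.resolve_left (by simp)
          simpa using this.symm
        | cons a m => simpa using h1
      · rw [wordSpace_concat]
        exact Submodule.mul_mem_mul hy ⟨_, rfl⟩
    have hr : ∀ x, embed S k x * y ∈ freeSpaceRight S j := by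
      intro x
      rw [embed_apply, add_mul, smul_mul_assoc, one_mul]
      refine add_mem (Submodule.smul_mem _ _ (wordSpace_le_right S hm h2 hy))
        (wordSpace_le_right S (alternating_cons hm h1) ?_ ?_)
      · rcases List.eq_nil_or_concat' m with rfl | ⟨m, a, rfl⟩
        · have := h3.resolve_left (by simp)
          simpa using this
        · rw [← List.cons_append, List.getLast?_concat]
          rw [List.getLast?_concat] at h2
          exact h2
      · rw [wordSpace_cons]
        exact Submodule.mul_mem_mul ⟨_, rfl⟩ hy
    refine ⟨⟨embed S k x * y * embed S j x', mul_embed_mem S x' (hr x)⟩, Subtype.ext ?_, rfl⟩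
    have e1 := rightRep_apply_mul S j T' x' _ (hr x)
    have e2 := leftRep_eq S (T := T) (z := ⟨embed S k x * y * embed S j x',
      mul_embed_mem S x' (hr x)⟩) (hl x') (mul_assoc _ _ _)
    refine (leftRep_eq S (T := T) (hl _) (e1.trans (mul_assoc _ _ _))).trans ?_
    rw [← mul_assoc]
    exact (rightRep_eq S (T := T') (hr _) (e2.trans (mul_assoc _ _ _).symm)).symm
  -- Here both operators act on one copy of `X_k`, and the hypothesis `h` is needed.
  have single : k = j → ∀ x : X k, embed S k x ∈ C := by
    rintro rfl x
    have hz : embed S k x ∈ freeSpace S := by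
      simpa using embed_mul_mem S x (one_mem_left S k)
    refine ⟨⟨embed S k x, hz⟩, Subtype.ext ?_, rfl⟩
    have e1 := sideRep_embed S Side.right T' (z := ⟨embed S k x, hz⟩) rfl
    have e2 := sideRep_embed S Side.left T (z := ⟨embed S k x, hz⟩) rfl
    refine (sideRep_embed S Side.left T e1).trans ?_
    refine Eq.trans ?_ (sideRep_embed S Side.right T' e2).symm
    exact congrArg _ (LinearMap.congr_fun (h rfl) x)
  have right : ∀ (x : X k) (w : List K), Alternating w → w.head? ≠ some k →
      ∀ t ∈ wordSpace S w, embed S k x * t ∈ C := by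
    intro x w hw hk
    by_cases hj : w.getLast? = some j
    · obtain ⟨v, rfl⟩ : ∃ v, w = v ++ [j] := by
        rcases List.eq_nil_or_concat' w with rfl | ⟨v, i, rfl⟩
        · simp at hj
        · exact ⟨v, by simp at hj; rw [hj]⟩
      have hv := hw
      rw [Alternating, List.isChain_append] at hv
      have hv2 : v.getLast? ≠ some j := fun e => hv.2.2 j e j (by simp) rfl
      have hv3 : v.head? ≠ some k := by
        intro e
        apply hk
        cases v with
        | nil => simp at e
        | cons a v => simpa using e
      have hv4 : v ≠ [] ∨ k ≠ j := by
        by_contra! hc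
        obtain ⟨rfl, rfl⟩ := hc
        exact hk (by simp)
      change wordSpace S (v ++ [j]) ≤ C.comap (LinearMap.mulLeft ℂ (embed S k x))
      rw [wordSpace_concat, Submodule.mul_le]
      rintro y hy _ ⟨x', rfl⟩
      simpa [mul_assoc, embed_coe] using key x x' v y hy hv.1 hv3 hv2 hv4
    · intro t ht
      by_cases hn : w ≠ [] ∨ k ≠ j
      · simpa [embed_ξ] using key x (S j).ξ w t ht hw hk hj hn
      · push Not at hn
        obtain ⟨rfl, hkj⟩ := hn
        rw [wordSpace_nil, Submodule.mem_one] at ht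
        obtain ⟨c, rfl⟩ := ht
        have := single hkj (c • x)
        rwa [map_smul, ← mul_one (embed S k x), ← mul_smul_comm,
          ← Algebra.algebraMap_eq_smul_one] at this
  have main : freeSpace S ≤ C := by
    refine iSup_le ?_
    rintro ⟨w, hw⟩
    change wordSpace S w ≤ C
    by_cases hk : w.head? = some k
    · obtain ⟨w, rfl⟩ : ∃ v, w = k :: v := by
        cases w with
        | nil => simp at hk
        | cons a v => exact ⟨v, by simp at hk; rw [hk]⟩
      rw [Alternating, List.isChain_cons] at hw
      rw [wordSpace_cons, Submodule.mul_le]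
      rintro _ ⟨x, rfl⟩ t ht
      simpa [embed_coe] using right x w hw.2 (fun e => hw.1 k e rfl) t ht
    · intro t ht
      simpa [embed_ξ] using right (S k).ξ w hw hk t ht
  refine LinearMap.ext fun z => ?_
  obtain ⟨z', hz', e⟩ := main z.2
  have : z' = z := Subtype.ext e
  exact this ▸ hz'

/-! ### Functionals on the free product -/

/-- The multiplicative extension of functionals on the spaces `X_k`. -/
def tensorsFunctional (f : ∀ k, X k →ₗ[ℂ] ℂ) : Tensors S →ₐ[ℂ] ℂ :=
  TensorAlgebra.lift ℂ (DirectSum.toModule ℂ K ℂ fun k => f k ∘ₗ (S k).circ.subtype)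

theorem tensorsFunctional_leg (f : ∀ k, X k →ₗ[ℂ] ℂ) (k : K) (x : (S k).circ) :
    tensorsFunctional S f (leg S k x) = f k x := by
  simp [tensorsFunctional, leg]

theorem tensorsFunctional_embed (f : ∀ k, X k →ₗ[ℂ] ℂ) (hf : ∀ k, f k (S k).ξ = 1) (k : K)
    (x : X k) : tensorsFunctional S f (embed S k x) = f k x := by
  rw [embed_apply, map_add, map_smul, map_one, tensorsFunctional_leg]
  conv_rhs => rw [← (S k).ψ_smul_add_toCirc x]
  rw [map_add, map_smul, hf]

theorem freeProduct_φ_apply (z : freeSpace S) :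
    (freeProduct S).φ z = tensorsFunctional S (fun k => (S k).φ) z := rfl

/-- Each `ψ_k` vanishes on `X°_k`, so its multiplicative extension kills all words of positive
length. Thus both states of the free product have the same form and can be treated at once. -/
theorem freeProduct_ψ_apply (z : freeSpace S) :
    (freeProduct S).ψ z = tensorsFunctional S (fun k => (S k).ψ) z := by
  have : (freeProduct S).ψ =
      (tensorsFunctional S fun k => (S k).ψ).toLinearMap ∘ₗ (freeSpace S).subtype := by
    refine (freeProduct S).ψ_unique _ (by simp [freeProduct]) ?_
    intro x hx
    have h := freeSpaceCirc_le_ker S hx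
    rw [LinearMap.mem_ker] at h
    have e : tensorsFunctional S (fun k => (S k).ψ) =
        TensorAlgebra.algebraMapInv (R := ℂ) (M := ⨁ k, (S k).circ) := by
      refine TensorAlgebra.hom_ext (DirectSum.linearMap_ext _ fun k => LinearMap.ext fun x => ?_)
      simp [tensorsFunctional, TensorAlgebra.algebraMapInv, TwoStateSpace.ψ_coe]
    simp only [LinearMap.comp_apply, AlgHom.toLinearMap_apply, e]
    exact h
  rw [this]
  rfl

end Action

/-! ### Non-crossing families of blocks -/

section Pictures

variable {K : Type*} {n : ℕ}

/-- The family `B` of blocks is a monochrome partition of `I`, non-crossing for `r`. -/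
structure NCFamily (r : Fin n → Fin n → Prop) (I : Set (Fin n)) (ω : Fin n → K)
    (B : Finset (Fin n) → Prop) : Prop where
  nonempty : ∀ V, B V → V.Nonempty
  subset : ∀ V, B V → ∀ i ∈ V, i ∈ I
  cover : ∀ i ∈ I, ∃ V, B V ∧ i ∈ V
  eq_of_mem : ∀ V W, B V → B W → ∀ i, i ∈ V → i ∈ W → V = W
  mono : ∀ V, B V → ∀ i ∈ V, ∀ j ∈ V, ω i = ω j
  nc : ∀ V W, B V → B W → ∀ a ∈ V, ∀ b ∈ W, ∀ c ∈ V, ∀ d ∈ W, r a b → r b c → r c d → V = W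

/-- The block `U` is not covered by another block of the family `B`. -/
def Exposed (r : Fin n → Fin n → Prop) (B : Finset (Fin n) → Prop) (U : Finset (Fin n)) : Prop :=
  ∀ V, B V → ∀ a ∈ V, ∀ b ∈ U, ∀ c ∈ V, r a b → r b c → V = U

/-- A crossing would need `0` as one of its two middle points, but nothing precedes `0`. -/
theorem NCFamily.singleton {r : Fin (n + 1) → Fin (n + 1) → Prop} {ω : Fin (n + 1) → K}
    {B B' : Finset (Fin (n + 1)) → Prop} (h : NCFamily r {i | i ≠ 0} ω B)
    (hr : ∀ j, ¬ r j 0) (hB : ∀ V, B' V ↔ V = {0} ∨ B V) : NCFamily r Set.univ ω B' := by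
  have h0 : ∀ V, B V → 0 ∉ V := fun V hV h0 => h.subset V hV 0 h0 rfl
  refine ⟨?_, by simp, ?_, ?_, ?_, ?_⟩
  · intro V hV
    rcases (hB V).1 hV with rfl | hV
    · simp
    · exact h.nonempty V hV
  · intro i _
    by_cases hi : i = 0
    · exact ⟨{0}, (hB _).2 (Or.inl rfl), by simp [hi]⟩
    · obtain ⟨V, hV, hiV⟩ := h.cover i hi
      exact ⟨V, (hB _).2 (Or.inr hV), hiV⟩
  · intro V W hV hW i hi hi'
    rcases (hB V).1 hV with rfl | hV <;> rcases (hB W).1 hW with rfl | hW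
    · rfl
    · rw [Finset.mem_singleton] at hi
      exact absurd (hi ▸ hi') (h0 W hW)
    · rw [Finset.mem_singleton] at hi'
      exact absurd (hi' ▸ hi) (h0 V hV)
    · exact h.eq_of_mem V W hV hW i hi hi'
  · intro V hV i hi j hj
    rcases (hB V).1 hV with rfl | hV
    · rw [Finset.mem_singleton] at hi hj
      rw [hi, hj]
    · exact h.mono V hV i hi j hj
  · intro V W hV hW a ha b hb c hc d hd h1 h2 h3
    rcases (hB V).1 hV with rfl | hV
    · rw [Finset.mem_singleton] at hc
      exact absurd (hc ▸ h2) (hr _)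
    · rcases (hB W).1 hW with rfl | hW
      · rw [Finset.mem_singleton] at hb
        exact absurd (hb ▸ h1) (hr _)
      · exact h.nc V W hV hW a ha b hb c hc d hd h1 h2 h3

/-- The new node can only be the first point of a crossing; the three remaining points then show
another block covering `U`, which is exposed. -/
theorem NCFamily.join {r : Fin (n + 1) → Fin (n + 1) → Prop} {ω : Fin (n + 1) → K}
    {B B' : Finset (Fin (n + 1)) → Prop} (h : NCFamily r {i | i ≠ 0} ω B)
    (hr : ∀ j, ¬ r j 0) {U : Finset (Fin (n + 1))} (hU : B U) (hω : ∀ i ∈ U, ω i = ω 0)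
    (he : Exposed r B U) (hB : ∀ V, B' V ↔ V = insert 0 U ∨ V ≠ U ∧ B V) :
    NCFamily r Set.univ ω B' := by
  have h0 : ∀ V, B V → 0 ∉ V := fun V hV h0 => h.subset V hV 0 h0 rfl
  have hne : ∀ V, B V → V ≠ U → ∀ i ∈ V, i ∉ insert 0 U := by
    intro V hV hne i hi hi'
    rcases Finset.mem_insert.1 hi' with rfl | hi'
    · exact h0 V hV hi
    · exact hne (h.eq_of_mem V U hV hU i hi hi')
  refine ⟨?_, by simp, ?_, ?_, ?_, ?_⟩
  · intro V hV
    rcases (hB V).1 hV with rfl | ⟨-, hV⟩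
    · simp
    · exact h.nonempty V hV
  · intro i _
    by_cases hi : i = 0
    · exact ⟨insert 0 U, (hB _).2 (Or.inl rfl), by simp [hi]⟩
    · obtain ⟨V, hV, hiV⟩ := h.cover i hi
      by_cases hVU : V = U
      · exact ⟨insert 0 U, (hB _).2 (Or.inl rfl), by simp [← hVU, hiV]⟩
      · exact ⟨V, (hB _).2 (Or.inr ⟨hVU, hV⟩), hiV⟩
  · intro V W hV hW i hi hi'
    rcases (hB V).1 hV with rfl | ⟨h1, hV⟩ <;> rcases (hB W).1 hW with rfl | ⟨h2, hW⟩
    · rfl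
    · exact absurd hi (hne W hW h2 i hi')
    · exact absurd hi' (hne V hV h1 i hi)
    · exact h.eq_of_mem V W hV hW i hi hi'
  · intro V hV
    rcases (hB V).1 hV with rfl | ⟨-, hV⟩
    · have : ∀ i ∈ insert 0 U, ω i = ω 0 := by simpa using hω
      intro i hi j hj
      rw [this i hi, this j hj]
    · exact h.mono V hV
  · intro V W hV hW a ha b hb c hc d hd h1 h2 h3
    rcases (hB V).1 hV with rfl | ⟨h1', hV⟩ <;> rcases (hB W).1 hW with rfl | ⟨h2', hW⟩
    · rfl
    · rcases Finset.mem_insert.1 hc with rfl | hc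
      · exact absurd h2 (hr _)
      · exact absurd (he W hW b hb c hc d hd h2 h3) h2'
    · rcases Finset.mem_insert.1 hb with rfl | hb
      · exact absurd h1 (hr _)
      · exact absurd (he V hV a ha b hb c hc h1 h2) h1'
    · exact h.nc V W hV hW a ha b hb c hc d hd h1 h2 h3

/-! ### Invariants of the pictures -/

namespace Picture

/-- `V` is a block of `P`: it is closed or it is the set of nodes of a spine. -/
def IsBlock (P : Picture K n) (V : Finset (Fin n)) : Prop :=
  V ∈ P.closed ∨ ∃ p ∈ P.spines, p.2 = V

/-- The invariants of the diagrams under construction: the blocks are monochrome, non-crossing for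
`r`, and partition the set `I` of nodes placed so far; neighbouring spines have different shades,
and every spine can be reached from above. -/
structure WF (r : Fin n → Fin n → Prop) (I : Set (Fin n)) (ω : Fin n → K) (P : Picture K n) :
    Prop where
  family : NCFamily r I ω P.IsBlock
  closed_ne : ∀ V ∈ P.closed, ∀ p ∈ P.spines, V ≠ p.2
  color : ∀ p ∈ P.spines, ∀ i ∈ p.2, ω i = p.1
  alt : Alternating (P.spines.map Prod.fst)
  sorted : P.spines.Pairwise fun p q => ∀ a ∈ p.2, ∀ b ∈ q.2, r a b
  exposed : ∀ p ∈ P.spines, Exposed r P.IsBlock p.2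

theorem isBlock_mirror (P : Picture K n) (V : Finset (Fin n)) :
    P.mirror.IsBlock V ↔ P.IsBlock V := by
  simp [IsBlock, mirror]

/-- Lets a right node be treated as a left node for the reversed order. -/
theorem WF.mirror {r : Fin n → Fin n → Prop} {I : Set (Fin n)} {ω : Fin n → K}
    {P : Picture K n} (h : P.WF r I ω) : P.mirror.WF (fun a b => r b a) I ω := by
  have hb : P.mirror.IsBlock = P.IsBlock := funext fun V => propext (P.isBlock_mirror V)
  refine ⟨?_, ?_, ?_, ?_, ?_, ?_⟩
  · rw [hb]
    refine ⟨h.family.nonempty, h.family.subset, h.family.cover, h.family.eq_of_mem,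
      h.family.mono, ?_⟩
    intro V W hV hW a ha b hb c hc d hd h1 h2 h3
    exact (h.family.nc W V hW hV d hd c hc b hb a ha h3 h2 h1).symm
  · simpa [Picture.mirror] using h.closed_ne
  · simpa [Picture.mirror] using h.color
  · have := h.alt
    simp only [Picture.mirror, Alternating, List.map_reverse, List.isChain_reverse] at this ⊢
    exact this.imp fun a b hab => hab.symm
  · have := h.sorted
    simp only [Picture.mirror, List.pairwise_reverse]
    exact this.imp fun hab a ha b hb => hab b hb a ha
  · rw [hb]
    intro p hp V hV a ha b hb' c hc h1 h2
    exact h.exposed p (by simpa [Picture.mirror] using hp) V hV c hc b hb' a ha h2 h1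

theorem isBlock_shift (P : Picture K n) (V : Finset (Fin (n + 1))) :
    P.shift.IsBlock V ↔ ∃ W, P.IsBlock W ∧ W.map (Fin.succEmb n) = V := by
  simp only [IsBlock, shift, Finset.mem_image, List.mem_map]
  constructor
  · rintro (⟨W, h, rfl⟩ | ⟨_, ⟨p, hp, rfl⟩, rfl⟩)
    · exact ⟨W, Or.inl h, rfl⟩
    · exact ⟨p.2, Or.inr ⟨p, hp, rfl⟩, rfl⟩
  · rintro ⟨W, h | ⟨p, hp, rfl⟩, rfl⟩
    · exact Or.inl ⟨W, h, rfl⟩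
    · exact Or.inr ⟨_, ⟨p, hp, rfl⟩, rfl⟩

theorem WF.shift {r : Fin (n + 1) → Fin (n + 1) → Prop} {ω : Fin (n + 1) → K}
    {P : Picture K n} (h : P.WF (fun a b => r a.succ b.succ) Set.univ fun i => ω i.succ) :
    P.shift.WF r {i | i ≠ 0} ω := by
  have mem : ∀ {V : Finset (Fin n)} {i : Fin (n + 1)}, i ∈ V.map (Fin.succEmb n) ↔
      ∃ j ∈ V, j.succ = i := by simp
  have inj := Finset.map_injective (Fin.succEmb n)
  refine ⟨⟨?_, ?_, ?_, ?_, ?_, ?_⟩, ?_, ?_, ?_, ?_, ?_⟩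
  · intro V hV
    obtain ⟨W, hW, rfl⟩ := (P.isBlock_shift V).1 hV
    simpa using h.family.nonempty W hW
  · intro V hV i hi
    obtain ⟨W, hW, rfl⟩ := (P.isBlock_shift V).1 hV
    obtain ⟨j, -, rfl⟩ := mem.1 hi
    exact Fin.succ_ne_zero j
  · intro i hi
    obtain ⟨j, rfl⟩ := Fin.exists_succ_eq.2 hi
    obtain ⟨V, hV, hj⟩ := h.family.cover j trivial
    exact ⟨_, (P.isBlock_shift _).2 ⟨V, hV, rfl⟩, mem.2 ⟨j, hj, rfl⟩⟩
  · intro V W hV hW i hi hi'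
    obtain ⟨V', hV', rfl⟩ := (P.isBlock_shift V).1 hV
    obtain ⟨W', hW', rfl⟩ := (P.isBlock_shift W).1 hW
    obtain ⟨j, hj, rfl⟩ := mem.1 hi
    rw [h.family.eq_of_mem V' W' hV' hW' j hj (by simpa using hi')]
  · intro V hV i hi j hj
    obtain ⟨V', hV', rfl⟩ := (P.isBlock_shift V).1 hV
    obtain ⟨i', hi', rfl⟩ := mem.1 hi
    obtain ⟨j', hj', rfl⟩ := mem.1 hj
    exact h.family.mono V' hV' i' hi' j' hj'
  · intro V W hV hW a ha b hb c hc d hd h1 h2 h3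
    obtain ⟨V', hV', rfl⟩ := (P.isBlock_shift V).1 hV
    obtain ⟨W', hW', rfl⟩ := (P.isBlock_shift W).1 hW
    obtain ⟨a', ha', rfl⟩ := mem.1 ha
    obtain ⟨b', hb', rfl⟩ := mem.1 hb
    obtain ⟨c', hc', rfl⟩ := mem.1 hc
    obtain ⟨d', hd', rfl⟩ := mem.1 hd
    rw [h.family.nc V' W' hV' hW' a' ha' b' hb' c' hc' d' hd' h1 h2 h3]
  · intro V hV p hp
    simp only [Picture.shift, Finset.mem_image, List.mem_map] at hV hp
    obtain ⟨V, hV, rfl⟩ := hV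
    obtain ⟨p, hp, rfl⟩ := hp
    exact fun e => h.closed_ne V hV p hp (inj e)
  · intro p hp i hi
    simp only [Picture.shift, List.mem_map] at hp
    obtain ⟨p, hp, rfl⟩ := hp
    obtain ⟨j, hj, rfl⟩ := mem.1 hi
    exact h.color p hp j hj
  · have := h.alt
    simpa [Picture.shift, Function.comp_def] using this
  · simp only [Picture.shift, List.pairwise_map]
    refine h.sorted.imp ?_
    intro p q hpq a ha b hb
    obtain ⟨a', ha', rfl⟩ := mem.1 ha
    obtain ⟨b', hb', rfl⟩ := mem.1 hb
    exact hpq a' ha' b' hb'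
  · intro p hp V hV a ha b hb c hc h1 h2
    simp only [Picture.shift, List.mem_map] at hp
    obtain ⟨p, hp, rfl⟩ := hp
    obtain ⟨V', hV', rfl⟩ := (P.isBlock_shift V).1 hV
    obtain ⟨a', ha', rfl⟩ := mem.1 ha
    obtain ⟨b', hb', rfl⟩ := mem.1 hb
    obtain ⟨c', hc', rfl⟩ := mem.1 hc
    exact congrArg _ (h.exposed p hp V' hV' a' ha' b' hb' c' hc' h1 h2)

/-- The conditions on `r` say that `0` comes first. They hold for `≺_χ` if the node `0` is a left
node and for the reversed order if it is a right node, so this covers both sides. -/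
theorem WF.of_addLeft {r : Fin (n + 1) → Fin (n + 1) → Prop} {ω : Fin (n + 1) → K}
    {P : Picture K (n + 1)} (h : P.WF r {i | i ≠ 0} ω) (hr : ∀ j, ¬ r j 0)
    (hr' : ∀ j, j ≠ 0 → r 0 j) (has : ∀ i j, r i j → ¬ r j i) {Q : Picture K (n + 1)}
    (hQ : Q ∈ P.addLeft (ω 0)) : Q.WF r Set.univ ω := by
  have h0 : ∀ V, P.IsBlock V → 0 ∉ V := fun V hV h0 => h.family.subset V hV 0 h0 rfl
  have hlt : ∀ V, P.IsBlock V → ∀ i ∈ V, r 0 i := fun V hV i hi =>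
    hr' i (h.family.subset V hV i hi)
  obtain ⟨C, L⟩ := P
  have hsp : ∀ p ∈ L, IsBlock ⟨C, L⟩ p.2 := fun p hp => Or.inr ⟨p, hp, rfl⟩
  have hcl : ∀ V ∈ C, IsBlock ⟨C, L⟩ V := fun V hV => Or.inl hV
  -- the two ways to add a separate node
  have isolated : (⟨insert {0} C, L⟩ : Picture K (n + 1)).WF r Set.univ ω := by
    have hB : ∀ V, IsBlock ⟨insert {0} C, L⟩ V ↔ V = {0} ∨ IsBlock ⟨C, L⟩ V := by
      intro V
      simp only [IsBlock, Finset.mem_insert, or_assoc]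
    refine ⟨h.family.singleton hr hB, ?_, h.color, h.alt, h.sorted, ?_⟩
    · intro V hV p hp
      rcases Finset.mem_insert.1 hV with rfl | hV
      · intro e
        exact h0 _ (hsp p hp) (by rw [← e]; simp)
      · exact h.closed_ne V hV p hp
    · intro p hp V hV a ha b hb c hc h1 h2
      rcases (hB V).1 hV with rfl | hV
      · rw [Finset.mem_singleton] at hc
        exact absurd (hc ▸ h2) (hr _)
      · exact h.exposed p hp V hV a ha b hb c hc h1 h2
  have new : (∀ p ∈ L.head?, ω 0 ≠ p.1) →
      (⟨C, (ω 0, {0}) :: L⟩ : Picture K (n + 1)).WF r Set.univ ω := by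
    intro hne
    have hB : ∀ V, IsBlock ⟨C, (ω 0, {0}) :: L⟩ V ↔ V = {0} ∨ IsBlock ⟨C, L⟩ V := by
      intro V
      simp only [IsBlock, List.mem_cons, exists_eq_or_imp]
      tauto
    refine ⟨h.family.singleton hr hB, ?_, ?_, ?_, ?_, ?_⟩
    · intro V hV p hp
      rcases List.mem_cons.1 hp with rfl | hp
      · rintro rfl
        exact h0 _ (hcl _ hV) (by simp)
      · exact h.closed_ne V hV p hp
    · intro p hp
      rcases List.mem_cons.1 hp with rfl | hp
      · simp
      · exact h.color p hp
    · have := h.alt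
      simp only [Alternating, List.map_cons, List.isChain_cons] at this ⊢
      refine ⟨?_, this⟩
      intro k hk
      simp only [List.head?_map, Option.mem_def, Option.map_eq_some_iff] at hk
      obtain ⟨p, hp, rfl⟩ := hk
      exact hne p hp
    · refine List.pairwise_cons.2 ⟨?_, h.sorted⟩
      intro q hq a ha b hb
      rw [Finset.mem_singleton.1 ha]
      exact hlt _ (hsp q hq) b hb
    · intro p hp V hV a ha b hb c hc h1 h2
      rcases List.mem_cons.1 hp with rfl | hp
      · rw [Finset.mem_singleton] at hb
        exact absurd (hb ▸ h1) (hr _)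
      · rcases (hB V).1 hV with rfl | hV
        · rw [Finset.mem_singleton] at hc
          exact absurd (hc ▸ h2) (hr _)
        · exact h.exposed p hp V hV a ha b hb c hc h1 h2
  cases L with
  | nil =>
    simp only [addLeft, List.mem_cons, List.not_mem_nil, or_false] at hQ
    rcases hQ with rfl | rfl
    · exact isolated
    · exact new (by simp)
  | cons p L =>
    obtain ⟨k, U⟩ := p
    by_cases hk : k = ω 0
    · subst hk
      simp only [addLeft, if_true, List.mem_cons, List.not_mem_nil, or_false] at hQ
      have hU := hsp _ List.mem_cons_self
      have hUω := h.color _ List.mem_cons_self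
      have hUe := h.exposed _ List.mem_cons_self
      have hs := List.pairwise_cons.1 h.sorted
      have hne : ∀ p ∈ L, p.2 ≠ U := by
        intro p hp e
        obtain ⟨i, hi⟩ := h.family.nonempty _ hU
        have := hs.1 p hp i hi i (by rw [e]; exact hi)
        exact has _ _ this this
      have hneC : ∀ V ∈ C, V ≠ U := fun V hV => h.closed_ne V hV _ List.mem_cons_self
      have hB : ∀ V, (V ∈ C ∨ (∃ p ∈ L, p.2 = V)) ↔
          V ≠ U ∧ IsBlock ⟨C, (ω 0, U) :: L⟩ V := by
        intro V
        constructor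
        · rintro (hV | ⟨p, hp, rfl⟩)
          · exact ⟨hneC V hV, Or.inl hV⟩
          · exact ⟨hne p hp, Or.inr ⟨p, List.mem_cons_of_mem _ hp, rfl⟩⟩
        · rintro ⟨hV, h | ⟨p, hp, rfl⟩⟩
          · exact Or.inl h
          · rcases List.mem_cons.1 hp with rfl | hp
            · exact absurd rfl hV
            · exact Or.inr ⟨p, hp, rfl⟩
      -- Enlarging the first spine by `0` covers no other spine: all its nodes precede those of the
      -- later spines.
      have hex : ∀ p ∈ L, ∀ V, (V = insert 0 U ∨ V ≠ U ∧ IsBlock ⟨C, (ω 0, U) :: L⟩ V) →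
          ∀ a ∈ V, ∀ b ∈ p.2, ∀ c ∈ V, r a b → r b c → V = p.2 := by
        intro p hp V hV a ha b hb c hc h1 h2
        rcases hV with rfl | ⟨-, hV⟩
        · rcases Finset.mem_insert.1 hc with rfl | hc
          · exact absurd h2 (hr _)
          · exact absurd h2 (has _ _ (hs.1 p hp c hc b hb))
        · exact h.exposed p (List.mem_cons_of_mem _ hp) V hV a ha b hb c hc h1 h2
      rcases hQ with rfl | rfl
      · have hB' : ∀ V, IsBlock ⟨C, (ω 0, insert 0 U) :: L⟩ V ↔
            V = insert 0 U ∨ V ≠ U ∧ IsBlock ⟨C, (ω 0, U) :: L⟩ V := by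
          intro V
          rw [← hB]
          simp only [IsBlock, List.mem_cons, exists_eq_or_imp]
          tauto
        refine ⟨h.family.join hr hU hUω hUe hB', ?_, ?_, h.alt, ?_, ?_⟩
        · intro V hV p hp
          rcases List.mem_cons.1 hp with rfl | hp
          · rintro rfl
            exact h0 _ (hcl _ hV) (by simp)
          · exact h.closed_ne V hV p (List.mem_cons_of_mem _ hp)
        · intro p hp
          rcases List.mem_cons.1 hp with rfl | hp
          · simpa using hUω
          · exact h.color p (List.mem_cons_of_mem _ hp)
        · refine List.pairwise_cons.2 ⟨?_, hs.2⟩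
          intro q hq a ha b hb
          rcases Finset.mem_insert.1 ha with rfl | ha
          · exact hlt _ (hsp q (List.mem_cons_of_mem _ hq)) b hb
          · exact hs.1 q hq a ha b hb
        · intro p hp V hV a ha b hb c hc h1 h2
          rcases List.mem_cons.1 hp with rfl | hp
          · rcases Finset.mem_insert.1 hb with rfl | hb
            · exact absurd h1 (hr _)
            · rcases (hB' V).1 hV with rfl | ⟨hne', hV⟩
              · rfl
              · exact absurd (hUe V hV a ha b hb c hc h1 h2) hne'
          · exact hex p hp V ((hB' V).1 hV) a ha b hb c hc h1 h2
      · have hB' : ∀ V, IsBlock ⟨insert (insert 0 U) C, L⟩ V ↔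
            V = insert 0 U ∨ V ≠ U ∧ IsBlock ⟨C, (ω 0, U) :: L⟩ V := by
          intro V
          rw [← hB]
          simp only [IsBlock, Finset.mem_insert, or_assoc]
        refine ⟨h.family.join hr hU hUω hUe hB', ?_, ?_, ?_, hs.2, ?_⟩
        · intro V hV p hp
          rcases Finset.mem_insert.1 hV with rfl | hV
          · intro e
            exact h0 _ (hsp p (List.mem_cons_of_mem _ hp)) (by rw [← e]; simp)
          · exact h.closed_ne V hV p (List.mem_cons_of_mem _ hp)
        · exact fun p hp => h.color p (List.mem_cons_of_mem _ hp)
        · exact (List.isChain_cons.1 h.alt).2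
        · intro p hp V hV
          exact hex p hp V ((hB' V).1 hV)
    · simp only [addLeft, hk, if_false, List.mem_cons, List.not_mem_nil, or_false] at hQ
      rcases hQ with rfl | rfl
      · exact isolated
      · exact new (by simpa using fun e => hk e.symm)

end Picture

/-! ### The order `≺_χ` and the invariants of all pictures -/

theorem chiLT_asymm (χ : Fin n → Side) (i j : Fin n) : ChiLT χ i j → ¬ ChiLT χ j i := by
  simp only [ChiLT]
  cases χ i <;> cases χ j <;> simp <;> exact le_of_lt

theorem chiLT_zero_left {χ : Fin (n + 1) → Side} (h : χ 0 = Side.left) (j : Fin (n + 1))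
    (hj : j ≠ 0) : ChiLT χ 0 j := by
  simp only [ChiLT, h]
  cases χ j <;> simp [Fin.pos_iff_ne_zero, hj]

theorem chiLT_zero_right {χ : Fin (n + 1) → Side} (h : χ 0 = Side.right) (j : Fin (n + 1))
    (hj : j ≠ 0) : ChiLT χ j 0 := by
  simp only [ChiLT, h]
  cases χ j <;> simp [Fin.pos_iff_ne_zero, hj]

theorem chiLT_irrefl (χ : Fin n → Side) (i : Fin n) : ¬ ChiLT χ i i :=
  fun h => chiLT_asymm χ i i h h

theorem chiLT_succ (χ : Fin (n + 1) → Side) :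
    (fun a b => ChiLT χ (Fin.succ a) (Fin.succ b)) = ChiLT fun i => χ i.succ := by
  funext a b
  simp only [ChiLT, Fin.succ_lt_succ_iff]

theorem Picture.WF.shift_chi {χ : Fin (n + 1) → Side} {ω : Fin (n + 1) → K} {P : Picture K n}
    (h : P.WF (ChiLT fun i => χ i.succ) Set.univ fun i => ω i.succ) :
    P.shift.WF (ChiLT χ) {i | i ≠ 0} ω := by
  rw [← chiLT_succ] at h
  exact h.shift

theorem Picture.WF.of_add {χ : Fin (n + 1) → Side} {ω : Fin (n + 1) → K} {P : Picture K n}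
    (h : P.WF (ChiLT fun i => χ i.succ) Set.univ fun i => ω i.succ) {Q : Picture K (n + 1)}
    (hQ : Q ∈ P.add (χ 0) (ω 0)) : Q.WF (ChiLT χ) Set.univ ω := by
  have h' := h.shift_chi
  have hne : ∀ j : Fin (n + 1), j = 0 ∨ j ≠ 0 := fun j => em _
  cases hχ : χ 0 with
  | left =>
    rw [hχ] at hQ
    refine h'.of_addLeft (fun j => ?_) (chiLT_zero_left hχ) (chiLT_asymm χ) hQ
    rcases hne j with rfl | hj
    · exact chiLT_irrefl χ 0
    · exact chiLT_asymm χ _ _ (chiLT_zero_left hχ j hj)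
  | right =>
    rw [hχ] at hQ
    simp only [Picture.add, List.mem_map] at hQ
    obtain ⟨Q, hQ, rfl⟩ := hQ
    refine (h'.mirror.of_addLeft (fun j => ?_) (chiLT_zero_right hχ)
      (fun i j => chiLT_asymm χ j i) hQ).mirror
    rcases hne j with rfl | hj
    · exact chiLT_irrefl χ 0
    · exact chiLT_asymm χ _ _ (chiLT_zero_right hχ j hj)

theorem pictures_wf : ∀ {n : ℕ} (χ : Fin n → Side) (ω : Fin n → K), ∀ P ∈ pictures χ ω,
    P.WF (ChiLT χ) Set.univ ω
  | 0, χ, ω, P, hP => by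
    simp only [pictures, List.mem_cons, List.not_mem_nil, or_false] at hP
    subst hP
    refine ⟨⟨?_, ?_, ?_, ?_, ?_, ?_⟩, ?_, ?_, ?_, ?_, ?_⟩ <;>
      simp [Picture.IsBlock, Alternating]
  | n + 1, χ, ω, P, hP => by
    simp only [pictures, List.mem_flatMap] at hP
    obtain ⟨Q, hQ, hP⟩ := hP
    exact (pictures_wf _ _ Q hQ).of_add hP

end Pictures

/-! ### Alternating products of operators and projections -/

section BlockVec

variable {X : Type*} [AddCommGroup X] [Module ℂ X] (S : TwoStateSpace X) {ι : Type*}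

/-- `T_{i_1} (1 - p) T_{i_2} (1 - p) ⋯ (1 - p) T_{i_m} ξ`. -/
def alternate (T : ι → Module.End ℂ X) : List ι → X
  | [] => S.ξ
  -- A separate case, because `1 - p` kills `ξ`: no projection follows the last operator.
  | [i] => T i S.ξ
  | i :: j :: l => T i (S.toCirc (alternate T (j :: l)))

theorem alternate_map {κ : Type*} (T : ι → Module.End ℂ X) (g : κ → ι) :
    ∀ l : List κ, alternate S T (l.map g) = alternate S (fun i => T (g i)) l
  | [] => rfl
  | [i] => rfl
  | i :: j :: l => by
    have := alternate_map T g (j :: l)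
    simp only [List.map_cons] at this
    simp only [List.map_cons, alternate, this]

variable [LinearOrder ι] (T : ι → Module.End ℂ X)

/-- The alternating product of the operators `T_i`, `i ∈ V`, and the projection `1 - p`, in
increasing order of `i`, applied to `ξ`. -/
def blockVec (V : Finset ι) : X := alternate S T (V.sort (· ≤ ·))

theorem blockVec_singleton (i : ι) : blockVec S T {i} = T i S.ξ := by
  simp [blockVec, alternate]

/-- The recursion that matches joining a node to a spine: the spine carries the leg `(1 - p) v_V`,
and the new operator acts on it. -/
theorem blockVec_insert {i : ι} {V : Finset ι} (hV : V.Nonempty) (h : ∀ j ∈ V, i < j) :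
    blockVec S T (insert i V) = T i (S.toCirc (blockVec S T V)) := by
  have hl : V.sort (· ≤ ·) ≠ [] := by
    intro e
    have := congrArg List.length e
    simp only [Finset.length_sort, List.length_nil, Finset.card_eq_zero] at this
    exact hV.ne_empty this
  rw [blockVec, Finset.sort_insert _ (fun j hj => (h j hj).le) fun hi => lt_irrefl _ (h i hi)]
  rw [blockVec]
  cases hs : V.sort (· ≤ ·) with
  | nil => exact absurd hs hl
  | cons j l => rfl

theorem sort_map_succ {n : ℕ} (V : Finset (Fin n)) :
    (V.map (Fin.succEmb n)).sort (· ≤ ·) = (V.sort (· ≤ ·)).map Fin.succ := by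
  exact ((Fin.strictMono_succ (n := n)).strictMonoOn (V : Set (Fin n))).map_finsetSort.symm

theorem blockVec_map_succ {n : ℕ} (T : Fin (n + 1) → Module.End ℂ X) (V : Finset (Fin n)) :
    blockVec S T (V.map (Fin.succEmb n)) = blockVec S (fun i => T i.succ) V := by
  rw [blockVec, sort_map_succ, alternate_map, blockVec]

end BlockVec

/-! ### Expansion over the pictures -/

section Expansion

variable {K : Type*} {X : K → Type*} [∀ k, AddCommGroup (X k)] [∀ k, Module ℂ (X k)]
  (S : ∀ k, TwoStateSpace (X k)) {n : ℕ}

/-- The tensor of the alternating products attached to a list of spines. -/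
def spineTensor (T : ∀ k, Fin n → Module.End ℂ (X k)) (L : List (K × Finset (Fin n))) :
    Tensors S :=
  (L.map fun p => leg S p.1 ((S p.1).toCirc (blockVec (S p.1) (T p.1) p.2))).prod

/-- The contribution of a picture: scalars `b V` for the closed blocks, a tensor for the
spines. -/
def Picture.eval (T : ∀ k, Fin n → Module.End ℂ (X k)) (b : Finset (Fin n) → ℂ)
    (P : Picture K n) : Tensors S :=
  (∏ V ∈ P.closed, b V) • spineTensor S T P.spines

theorem spineTensor_mem (T : ∀ k, Fin n → Module.End ℂ (X k)) (L : List (K × Finset (Fin n))) :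
    spineTensor S T L ∈ wordSpace S (L.map Prod.fst) := by
  induction L with
  | nil => exact one_mem_wordSpace_nil S
  | cons p L ih =>
    rw [List.map_cons, wordSpace_cons, spineTensor, List.map_cons, List.prod_cons]
    exact Submodule.mul_mem_mul ⟨_, rfl⟩ ih

theorem spineTensor_cons (T : ∀ k, Fin n → Module.End ℂ (X k)) (p : K × Finset (Fin n))
    (L : List (K × Finset (Fin n))) : spineTensor S T (p :: L) =
      leg S p.1 ((S p.1).toCirc (blockVec (S p.1) (T p.1) p.2)) * spineTensor S T L := by
  simp [spineTensor]

theorem spineTensor_concat (T : ∀ k, Fin n → Module.End ℂ (X k)) (p : K × Finset (Fin n))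
    (L : List (K × Finset (Fin n))) : spineTensor S T (L ++ [p]) =
      spineTensor S T L * leg S p.1 ((S p.1).toCirc (blockVec (S p.1) (T p.1) p.2)) := by
  simp [spineTensor]

/-- The scalars attached to the blocks are the values of `ψ` on the alternating products. -/
def IsBlockState (ω : Fin n → K) (T : ∀ k, Fin n → Module.End ℂ (X k))
    (f : ∀ k, X k →ₗ[ℂ] ℂ) (b : Finset (Fin n) → ℂ) : Prop :=
  ∀ k V, V.Nonempty → (∀ i ∈ V, ω i = k) → b V = f k (blockVec (S k) (T k) V)

variable {S} in
theorem IsBlockState.succ {ω : Fin (n + 1) → K} {T : ∀ k, Fin (n + 1) → Module.End ℂ (X k)}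
    {f : ∀ k, X k →ₗ[ℂ] ℂ} {b : Finset (Fin (n + 1)) → ℂ} (h : IsBlockState S ω T f b) :
    IsBlockState S (fun i => ω i.succ) (fun k i => T k i.succ) f
      fun V => b (V.map (Fin.succEmb n)) := by
  intro k V hV hk
  rw [← blockVec_map_succ]
  exact h k _ (by simpa using hV) (by simpa using hk)

theorem Picture.eval_shift (T : ∀ k, Fin (n + 1) → Module.End ℂ (X k))
    (b : Finset (Fin (n + 1)) → ℂ) (P : Picture K n) :
    P.shift.eval S T b =
      P.eval S (fun k i => T k i.succ) fun V => b (V.map (Fin.succEmb n)) := by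
  rw [Picture.eval, Picture.eval]
  congr 1
  · rw [Picture.shift, Finset.prod_image]
    intro V _ W _ h
    exact Finset.map_injective _ h
  · simp only [Picture.shift, spineTensor, List.map_map, Function.comp_def, blockVec_map_succ]

/-- If `v` is the vector produced by the operator, the two terms of `v = ψ(v) ξ + (1 - p) v` are the
two pictures in `addLeft`: the scalar closes the block of `0`, the leg is the spine that reaches the
top. -/
theorem Picture.leftRep_eval {ω : Fin (n + 1) → K} {T : ∀ k, Fin (n + 1) → Module.End ℂ (X k)}
    {b : Finset (Fin (n + 1)) → ℂ} (hb : IsBlockState S ω T (fun k => (S k).ψ) b)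
    {r : Fin (n + 1) → Fin (n + 1) → Prop} {P : Picture K (n + 1)} (h : P.WF r {i | i ≠ 0} ω)
    {z : freeSpace S} (hz : (z : Tensors S) = P.eval S T b) :
    (leftRep S (ω 0) (T (ω 0) 0) z : Tensors S) =
      ((P.addLeft (ω 0)).map (Picture.eval S T b)).sum := by
  have h0 : ∀ V, P.IsBlock V → 0 ∉ V := fun V hV h0 => h.family.subset V hV 0 h0 rfl
  have hpos : ∀ V, P.IsBlock V → ∀ j ∈ V, 0 < j := fun V hV j hj =>
    Fin.pos_iff_ne_zero.2 (h.family.subset V hV j hj)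
  have hb0 : b {0} = (S (ω 0)).ψ (T (ω 0) 0 (S (ω 0)).ξ) := by
    rw [hb (ω 0) {0} (by simp) (by simp), blockVec_singleton]
  obtain ⟨C, L⟩ := P
  have hC : ∀ V ∈ C, 0 ∉ V := fun V hV => h0 V (Or.inl hV)
  have hC' : ∀ V, insert 0 V ∉ C := fun V hV => hC _ hV (by simp)
  -- a node next to a spine of another shade
  have separate : (∀ p ∈ L.head?, p.1 ≠ ω 0) →
      (leftRep S (ω 0) (T (ω 0) 0) z : Tensors S) =
        Picture.eval S T b ⟨insert {0} C, L⟩ + Picture.eval S T b ⟨C, (ω 0, {0}) :: L⟩ := by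
    intro hne
    have hy : Picture.eval S T b ⟨C, L⟩ ∈ freeSpaceLeft S (ω 0) := by
      refine Submodule.smul_mem _ _ (wordSpace_le_left S h.alt ?_ (spineTensor_mem S T L))
      simp only [List.head?_map, ne_eq, Option.map_eq_some_iff, not_exists, not_and]
      exact fun p hp => hne p hp
    have e := leftRep_eq S (T := T (ω 0) 0) (x := (S (ω 0)).ξ) hy
      (by rw [hz, embed_ξ, one_mul])
    rw [e, embed_apply, add_mul, Picture.eval, Picture.eval, Picture.eval, spineTensor_cons,
      blockVec_singleton, Finset.prod_insert (fun h => hC' ∅ (by simpa using h)), hb0]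
    simp only [smul_mul_assoc, one_mul, mul_smul_comm, mul_smul]
    rw [smul_comm]
  cases L with
  | nil => simpa [Picture.addLeft] using separate (by simp)
  | cons p L =>
    obtain ⟨k, U⟩ := p
    by_cases hk : k = ω 0
    · subst hk
      have hU : Picture.IsBlock ⟨C, (ω 0, U) :: L⟩ U := Or.inr ⟨_, List.mem_cons_self, rfl⟩
      have hne := h.family.nonempty U hU
      have hy : (∏ V ∈ C, b V) • spineTensor S T L ∈ freeSpaceLeft S (ω 0) := by
        have := h.alt
        rw [Alternating, List.map_cons, List.isChain_cons] at this
        exact Submodule.smul_mem _ _ (wordSpace_le_left S this.2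
          (fun e => this.1 (ω 0) e rfl) (spineTensor_mem S T L))
      have e := leftRep_eq S (T := T (ω 0) 0)
        (x := (S (ω 0)).toCirc (blockVec (S (ω 0)) (T (ω 0)) U)) hy
        (by rw [hz, embed_coe, Picture.eval, spineTensor_cons, mul_smul_comm])
      have hbU : b (insert 0 U) = (S (ω 0)).ψ (blockVec (S (ω 0)) (T (ω 0)) (insert 0 U)) :=
        hb _ _ (by simp) (by simpa using h.color _ List.mem_cons_self)
      -- The operator acts on the leg of `U`, and the result is the alternating product of the
      -- enlarged block.
      have hv := blockVec_insert (S (ω 0)) (T (ω 0)) hne (hpos U hU)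
      rw [e, ← hv, embed_apply, add_mul, ← hbU]
      simp only [Picture.addLeft, if_true, List.map_cons, List.map_nil, List.sum_cons,
        List.sum_nil, add_zero]
      rw [Picture.eval, Picture.eval, spineTensor_cons,
        Finset.prod_insert (hC' U), add_comm]
      simp only [smul_mul_assoc, one_mul, mul_smul_comm, mul_smul]
      rw [smul_comm (b (insert 0 U))]
    · simpa [Picture.addLeft, hk] using separate (by simpa using hk)

/-- The same splitting at the last leg. Mirroring a picture reverses the order of its tensor
factors, so this is not an instance of `Picture.leftRep_eval`. -/
theorem Picture.rightRep_eval {ω : Fin (n + 1) → K} {T : ∀ k, Fin (n + 1) → Module.End ℂ (X k)}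
    {b : Finset (Fin (n + 1)) → ℂ} (hb : IsBlockState S ω T (fun k => (S k).ψ) b)
    {r : Fin (n + 1) → Fin (n + 1) → Prop} {P : Picture K (n + 1)} (h : P.WF r {i | i ≠ 0} ω)
    {z : freeSpace S} (hz : (z : Tensors S) = P.eval S T b) :
    (rightRep S (ω 0) (T (ω 0) 0) z : Tensors S) =
      (((P.mirror.addLeft (ω 0)).map Picture.mirror).map (Picture.eval S T b)).sum := by
  have h0 : ∀ V, P.IsBlock V → 0 ∉ V := fun V hV h0 => h.family.subset V hV 0 h0 rfl
  have hpos : ∀ V, P.IsBlock V → ∀ j ∈ V, 0 < j := fun V hV j hj =>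
    Fin.pos_iff_ne_zero.2 (h.family.subset V hV j hj)
  have hb0 : b {0} = (S (ω 0)).ψ (T (ω 0) 0 (S (ω 0)).ξ) := by
    rw [hb (ω 0) {0} (by simp) (by simp), blockVec_singleton]
  obtain ⟨C, L⟩ := P
  have hC : ∀ V ∈ C, 0 ∉ V := fun V hV => h0 V (Or.inl hV)
  have hC' : ∀ V, insert 0 V ∉ C := fun V hV => hC _ hV (by simp)
  have separate : (∀ p ∈ L.getLast?, p.1 ≠ ω 0) →
      (rightRep S (ω 0) (T (ω 0) 0) z : Tensors S) =
        Picture.eval S T b ⟨insert {0} C, L⟩ + Picture.eval S T b ⟨C, L ++ [(ω 0, {0})]⟩ := by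
    intro hne
    have hy : Picture.eval S T b ⟨C, L⟩ ∈ freeSpaceRight S (ω 0) := by
      refine Submodule.smul_mem _ _ (wordSpace_le_right S h.alt ?_ (spineTensor_mem S T L))
      simp only [List.getLast?_map, ne_eq, Option.map_eq_some_iff, not_exists, not_and]
      exact fun p hp => hne p hp
    have e := rightRep_eq S (T := T (ω 0) 0) (x := (S (ω 0)).ξ) hy
      (by rw [hz, embed_ξ, mul_one])
    rw [e, embed_apply, mul_add, Picture.eval, Picture.eval, Picture.eval, spineTensor_concat,
      blockVec_singleton, Finset.prod_insert (fun h => hC' ∅ (by simpa using h)), hb0]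
    simp only [mul_one, mul_smul_comm, mul_smul, smul_mul_assoc]
  rcases List.eq_nil_or_concat' L with rfl | ⟨L, ⟨k, U⟩, rfl⟩
  · simpa [Picture.addLeft, Picture.mirror] using separate (by simp)
  · by_cases hk : k = ω 0
    · subst hk
      have hmem : (ω 0, U) ∈ L ++ [(ω 0, U)] := by simp
      have hU : Picture.IsBlock ⟨C, L ++ [(ω 0, U)]⟩ U := Or.inr ⟨_, hmem, rfl⟩
      have hne := h.family.nonempty U hU
      have hy : (∏ V ∈ C, b V) • spineTensor S T L ∈ freeSpaceRight S (ω 0) := by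
        have := h.alt
        simp only [Alternating, List.map_append, List.map_cons, List.map_nil,
          List.isChain_append] at this
        exact Submodule.smul_mem _ _ (wordSpace_le_right S this.1
          (fun e => this.2.2 (ω 0) e (ω 0) (by simp) rfl) (spineTensor_mem S T L))
      have e := rightRep_eq S (T := T (ω 0) 0)
        (x := (S (ω 0)).toCirc (blockVec (S (ω 0)) (T (ω 0)) U)) hy
        (by rw [hz, embed_coe, Picture.eval, spineTensor_concat, smul_mul_assoc])
      have hbU : b (insert 0 U) = (S (ω 0)).ψ (blockVec (S (ω 0)) (T (ω 0)) (insert 0 U)) :=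
        hb _ _ (by simp) (by simpa using h.color _ hmem)
      have hv := blockVec_insert (S (ω 0)) (T (ω 0)) hne (hpos U hU)
      rw [e, ← hv, embed_apply, mul_add, ← hbU]
      simp only [Picture.addLeft, Picture.mirror, List.reverse_append, List.reverse_cons,
        List.reverse_nil, List.nil_append, List.cons_append, List.reverse_reverse, if_true,
        List.map_cons, List.map_nil, List.sum_cons, List.sum_nil, add_zero]
      rw [Picture.eval, Picture.eval, spineTensor_concat,
        Finset.prod_insert (hC' U), add_comm]
      simp only [smul_mul_assoc, mul_one, mul_smul_comm, mul_smul]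
    · simpa [Picture.addLeft, Picture.mirror, hk] using separate (by simpa using hk)

/-- The vector `T_1 ⋯ T_n ξ` in the free product, as a sum over the pictures. -/
theorem prod_sideRep_one_eq_sum_pictures : ∀ {n : ℕ} (χ : Fin n → Side) (ω : Fin n → K)
    (T : ∀ k, Fin n → Module.End ℂ (X k)) (b : Finset (Fin n) → ℂ),
    IsBlockState S ω T (fun k => (S k).ψ) b →
    ((List.ofFn fun i => sideRep S (χ i) (ω i) (T (ω i) i)).prod (freeProduct S).ξ : Tensors S) =
      ((pictures χ ω).map (Picture.eval S T b)).sum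
  | 0, χ, ω, T, b, _ => by
    simp [pictures, Picture.eval, spineTensor, freeProduct]
  | n + 1, χ, ω, T, b, hb => by
    have ih := prod_sideRep_one_eq_sum_pictures (fun i => χ i.succ) (fun i => ω i.succ)
      (fun k i => T k i.succ) _ hb.succ
    rw [List.ofFn_succ, List.prod_cons, Module.End.mul_apply]
    set z := (List.ofFn fun i : Fin n => sideRep S (χ i.succ) (ω i.succ)
      (T (ω i.succ) i.succ)).prod (freeProduct S).ξ with hz
    -- Neighbouring spines differ in colour, so each summand lies in the free product space and the
    -- operator can be applied to it separately.
    have hmem : ∀ P ∈ pictures (fun i => χ i.succ) (fun i => ω i.succ),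
        P.shift.eval S T b ∈ freeSpace S := fun P hP =>
      Submodule.smul_mem _ _ (wordSpace_le S (pictures_wf _ _ P hP).shift_chi.alt
        (spineTensor_mem S T _))
    have step : ∀ P ∈ pictures (fun i => χ i.succ) (fun i => ω i.succ), ∀ y : freeSpace S,
        (y : Tensors S) = P.shift.eval S T b →
        (sideRep S (χ 0) (ω 0) (T (ω 0) 0) y : Tensors S) =
          ((P.add (χ 0) (ω 0)).map (Picture.eval S T b)).sum := by
      intro P hP y hy
      have h := (pictures_wf _ _ P hP).shift_chi
      cases hχ : χ 0 with
      | left => exact Picture.leftRep_eval S hb h hy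
      | right => exact Picture.rightRep_eval S hb h hy
    -- Linearity, by induction on the list of summands.
    have main : ∀ L : List (Picture K n), L ⊆ pictures (fun i => χ i.succ) (fun i => ω i.succ) →
        ∀ y : freeSpace S, (y : Tensors S) = (L.map fun P => P.shift.eval S T b).sum →
        (sideRep S (χ 0) (ω 0) (T (ω 0) 0) y : Tensors S) =
          ((L.flatMap (Picture.add (χ 0) (ω 0))).map (Picture.eval S T b)).sum := by
      intro L
      induction L with
      | nil =>
        intro _ y hy
        have : y = 0 := Subtype.ext (by simpa using hy)
        simp [this]
      | cons P L ihL =>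
        intro hL y hy
        obtain ⟨hP, hL⟩ := List.cons_subset.1 hL
        set y1 : freeSpace S := ⟨_, hmem P hP⟩ with hy1
        have hy2 : y = y1 + (y - y1) := by abel
        rw [hy2, map_add, Submodule.coe_add, step P hP y1 rfl, ihL hL (y - y1)]
        · simp
        · rw [Submodule.coe_sub, hy, List.map_cons, List.sum_cons, hy1]
          simp
    rw [pictures]
    refine main _ (List.Subset.refl _) z ?_
    rw [ih]
    simp only [Picture.eval_shift]

end Expansion

/-! ### Pictures and the diagrams they draw -/

section Draws

variable {K : Type*} {n : ℕ}

namespace Picture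

/-- The closed blocks of a picture and the node sets of its spines. -/
def key (P : Picture K n) : Finset (Finset (Fin n)) × Finset (Finset (Fin n)) :=
  (P.closed, (P.spines.map Prod.snd).toFinset)

/-- Removes the node `0` from the key of a picture. -/
def unadd (q : Finset (Finset (Fin (n + 1))) × Finset (Finset (Fin (n + 1)))) :
    Finset (Finset (Fin (n + 1))) × Finset (Finset (Fin (n + 1))) :=
  (q.1.filter (0 ∉ ·),
    q.2.filter (0 ∉ ·) ∪ (((q.1 ∪ q.2).filter (0 ∈ ·)).image (Finset.erase · 0)).erase ∅)

theorem key_mirror (P : Picture K n) : P.mirror.key = P.key := by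
  simp [key, mirror]

theorem key_shift (P : Picture K n) :
    P.shift.key = (P.key.1.image fun V => V.map (Fin.succEmb n),
      P.key.2.image fun V => V.map (Fin.succEmb n)) := by
  simp only [key, shift, List.map_map, Prod.mk.injEq, true_and]
  ext V
  simp only [List.mem_toFinset, List.mem_map, Finset.mem_image, Function.comp_apply]
  exact ⟨fun ⟨p, hp, e⟩ => ⟨_, ⟨p, hp, rfl⟩, e⟩, fun ⟨_, ⟨p, hp, e⟩, e'⟩ => ⟨p, hp, e ▸ e'⟩⟩

theorem key_shift_injective {P P' : Picture K n} (h : P.shift.key = P'.shift.key) :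
    P.key = P'.key := by
  rw [key_shift, key_shift, Prod.mk.injEq] at h
  have inj := Finset.image_injective (Finset.map_injective (Fin.succEmb n))
  exact Prod.ext (inj h.1) (inj h.2)

/-- The last step can be undone from the finished diagram: the block of `0` loses `0`, and what
remains, if nonempty, was a spine that reached the top, since a node can only be joined to such a
spine. A node that was isolated or started a spine leaves `∅`, which is discarded. -/
theorem unadd_key {P : Picture K (n + 1)} (h0 : ∀ V, P.IsBlock V → 0 ∉ V)
    (hne : ∀ V, P.IsBlock V → V.Nonempty) {c : K} {Q : Picture K (n + 1)}
    (hQ : Q ∈ P.addLeft c) : unadd Q.key = P.key := by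
  obtain ⟨C, L⟩ := P
  have hC : ∀ V ∈ C, 0 ∉ V := fun V hV => h0 V (Or.inl hV)
  have hL : ∀ p ∈ L, 0 ∉ p.2 := fun p hp => h0 _ (Or.inr ⟨p, hp, rfl⟩)
  have hL' : ∀ p ∈ L, p.2.Nonempty := fun p hp => hne _ (Or.inr ⟨p, hp, rfl⟩)
  have fC : C.filter (0 ∉ ·) = C := Finset.filter_true_of_mem hC
  have fC' : C.filter (0 ∈ ·) = ∅ := Finset.filter_false_of_mem hC
  have fL : ∀ L' : List (K × Finset (Fin (n + 1))), L' ⊆ L →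
      (L'.map Prod.snd).toFinset.filter (0 ∉ ·) = (L'.map Prod.snd).toFinset := by
    intro L' hs
    refine Finset.filter_true_of_mem fun V hV => ?_
    simp only [List.mem_toFinset, List.mem_map] at hV
    obtain ⟨p, hp, rfl⟩ := hV
    exact hL p (hs hp)
  have fL' : ∀ L' : List (K × Finset (Fin (n + 1))), L' ⊆ L →
      (L'.map Prod.snd).toFinset.filter (0 ∈ ·) = ∅ := by
    intro L' hs
    refine Finset.filter_false_of_mem fun V hV => ?_
    simp only [List.mem_toFinset, List.mem_map] at hV
    obtain ⟨p, hp, rfl⟩ := hV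
    exact hL p (hs hp)
  have isolated : unadd (key (⟨insert {0} C, L⟩ : Picture K (n + 1))) = (C, (L.map Prod.snd).toFinset) := by
    simp [unadd, key, Finset.filter_union, Finset.filter_insert, fC, fC',
      fL L (List.Subset.refl _), fL' L (List.Subset.refl _)]
  have new : unadd (key (⟨C, (c, {0}) :: L⟩ : Picture K (n + 1))) =
      (C, (L.map Prod.snd).toFinset) := by
    simp [unadd, key, Finset.filter_union, Finset.filter_insert, fC, fC',
      fL L (List.Subset.refl _), fL' L (List.Subset.refl _)]
  cases L with
  | nil =>
    simp only [addLeft, List.mem_cons, List.not_mem_nil, or_false] at hQ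
    rcases hQ with rfl | rfl
    · exact isolated
    · exact new
  | cons p L =>
    obtain ⟨k, U⟩ := p
    have hs : L ⊆ (k, U) :: L := List.subset_cons_self _ _
    have hU : 0 ∉ U := hL _ List.mem_cons_self
    have hU' : U ≠ ∅ := (hL' _ List.mem_cons_self).ne_empty
    by_cases hk : k = c
    · subst hk
      simp only [addLeft, if_true, List.mem_cons, List.not_mem_nil, or_false] at hQ
      rcases hQ with rfl | rfl
      · simp [unadd, key, Finset.filter_union, Finset.filter_insert, fC, fC', fL L hs, fL' L hs,
          Finset.erase_insert hU, Finset.erase_eq_of_notMem, hU'.symm, Finset.union_comm]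
      · simp [unadd, key, Finset.filter_union, Finset.filter_insert, fC, fC', fL L hs, fL' L hs,
          Finset.erase_insert hU, Finset.erase_eq_of_notMem, hU'.symm, Finset.union_comm]
    · simp only [addLeft, hk, if_false, List.mem_cons, List.not_mem_nil, or_false] at hQ
      rcases hQ with rfl | rfl
      · exact isolated
      · exact new

/-- Of the two pictures exactly one has the block of `0` among its closed blocks. -/
theorem nodup_key_addLeft {P : Picture K (n + 1)} (h0 : ∀ V, P.IsBlock V → 0 ∉ V) (c : K) :
    ((P.addLeft c).map key).Nodup := by
  obtain ⟨C, L⟩ := P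
  have hC : ∀ V, insert 0 V ∉ C := fun V hV => h0 _ (Or.inl hV) (by simp)
  have hC0 : {0} ∉ C := fun h => hC ∅ (by simpa using h)
  have ne : ∀ V, V ∉ C → ¬ insert V C = C := fun V hV e => hV (by rw [← e]; simp)
  cases L with
  | nil => simp [addLeft, key, ne _ hC0]
  | cons p L =>
    obtain ⟨k, U⟩ := p
    by_cases hk : k = c
    · simp [addLeft, key, hk, hC, @eq_comm _ C]
    · simp [addLeft, key, hk, ne _ hC0]

end Picture

theorem pictures_add_spec {χ : Fin (n + 1) → Side} {ω : Fin (n + 1) → K} {P : Picture K n}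
    (hP : P ∈ pictures (fun i => χ i.succ) fun i => ω i.succ) :
    ((P.add (χ 0) (ω 0)).map Picture.key).Nodup ∧
      ∀ Q ∈ P.add (χ 0) (ω 0), Picture.unadd Q.key = P.shift.key := by
  have h := (pictures_wf _ _ P hP).shift_chi
  have h0 : ∀ V, P.shift.IsBlock V → 0 ∉ V := fun V hV h0 => h.family.subset V hV 0 h0 rfl
  have hm : ∀ V, P.shift.mirror.IsBlock V ↔ P.shift.IsBlock V := P.shift.isBlock_mirror
  cases hχ : χ 0 with
  | left =>
    exact ⟨Picture.nodup_key_addLeft h0 _, fun Q hQ => Picture.unadd_key h0 h.family.nonempty hQ⟩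
  | right =>
    have h0' : ∀ V, P.shift.mirror.IsBlock V → 0 ∉ V := fun V hV => h0 V ((hm V).1 hV)
    constructor
    · simp only [Picture.add, List.map_map, Function.comp_def, Picture.key_mirror]
      exact Picture.nodup_key_addLeft h0' _
    · intro Q hQ
      simp only [Picture.add, List.mem_map] at hQ
      obtain ⟨Q, hQ, rfl⟩ := hQ
      rw [Picture.key_mirror, ← Picture.key_mirror P.shift]
      exact Picture.unadd_key h0' (fun V hV => h.family.nonempty V ((hm V).1 hV)) hQ

/-- Forgetting the shades and the order of the spines loses nothing: the parent picture is recovered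
by `unadd`, and the two children of one parent have different keys. -/
theorem nodup_key_pictures : ∀ {n : ℕ} (χ : Fin n → Side) (ω : Fin n → K),
    ((pictures χ ω).map Picture.key).Nodup
  | 0, _, _ => by simp [pictures]
  | n + 1, χ, ω => by
    have ih := nodup_key_pictures (fun i => χ i.succ) fun i => ω i.succ
    rw [pictures, List.map_flatMap, List.nodup_flatMap]
    refine ⟨fun P hP => (pictures_add_spec hP).1, ?_⟩
    rw [List.Nodup, List.pairwise_map] at ih
    refine ih.imp_of_mem ?_
    intro P P' hP hP' hne q hq hq'
    obtain ⟨Q, hQ, rfl⟩ := List.mem_map.1 hq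
    obtain ⟨Q', hQ', e⟩ := List.mem_map.1 hq'
    refine hne (Picture.key_shift_injective ?_)
    rw [← (pictures_add_spec hP).2 Q hQ, ← (pictures_add_spec hP').2 Q' hQ', e]

/-- The diagram `D` is drawn by the picture `P`. -/
def Draws (P : Picture K n) (D : Diagram n) : Prop :=
  D.top = (P.spines.map Prod.snd).toFinset ∧ D.part.parts = P.closed ∪ D.top

theorem Draws.isBlock {P : Picture K n} {D : Diagram n} (h : Draws P D) (V : Finset (Fin n)) :
    P.IsBlock V ↔ V ∈ D.part.parts := by
  rw [h.2, h.1, Finset.mem_union, List.mem_toFinset, List.mem_map]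
  rfl

theorem Draws.closed_eq {P : Picture K n} {D : Diagram n} (h : Draws P D)
    (hne : ∀ V ∈ P.closed, ∀ p ∈ P.spines, V ≠ p.2) : P.closed = D.part.parts \ D.top := by
  rw [h.2, Finset.union_sdiff_right, eq_comm, Finset.sdiff_eq_self_iff_disjoint,
    Finset.disjoint_left]
  intro V hV hV'
  rw [h.1, List.mem_toFinset, List.mem_map] at hV'
  obtain ⟨p, hp, rfl⟩ := hV'
  exact hne _ hV p hp rfl

theorem Picture.WF.exists_draws {r : Fin n → Fin n → Prop} {ω : Fin n → K} {P : Picture K n}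
    (h : P.WF r Set.univ ω) : ∃ D, Draws P D := by
  have hB : ∀ V, V ∈ P.closed ∪ (P.spines.map Prod.snd).toFinset ↔ P.IsBlock V := by
    intro V
    rw [Finset.mem_union, List.mem_toFinset, List.mem_map]
    rfl
  refine ⟨⟨⟨P.closed ∪ (P.spines.map Prod.snd).toFinset, ?_, ?_, ?_⟩,
    (P.spines.map Prod.snd).toFinset, Finset.subset_union_right⟩, rfl, rfl⟩
  · rw [Finset.supIndep_iff_pairwiseDisjoint]
    intro V hV W hW hne
    rw [Function.onFun, id, id, Finset.disjoint_left]
    intro i hi hi'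
    exact hne (h.family.eq_of_mem V W ((hB V).1 hV) ((hB W).1 hW) i hi hi')
  · refine Finset.eq_univ_of_forall fun i => ?_
    obtain ⟨V, hV, hi⟩ := h.family.cover i trivial
    exact Finset.mem_sup.2 ⟨V, (hB V).2 hV, hi⟩
  · intro hV
    exact (h.family.nonempty _ ((hB _).1 hV)).ne_empty rfl

theorem Draws.unique {P : Picture K n} {D D' : Diagram n} (h : Draws P D) (h' : Draws P D') :
    D = D' := by
  have ht : D.top = D'.top := h.1.trans h'.1.symm
  exact Diagram.ext (Finpartition.ext (by rw [h.2, h'.2, ht])) ht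

theorem Draws.key_eq {P : Picture K n} {D : Diagram n} (h : Draws P D)
    (hne : ∀ V ∈ P.closed, ∀ p ∈ P.spines, V ≠ p.2) :
    P.key = (D.part.parts \ D.top, D.top) := by
  rw [Picture.key, h.closed_eq hne, h.1]

theorem mem_LR {χ : Fin n → Side} {ω : Fin n → K} {D : Diagram n} :
    D ∈ LR χ ω ↔ ∃ P ∈ pictures χ ω, Draws P D := by
  simp only [LR, Finset.mem_filter, Finset.mem_univ, true_and, Draws]

/-- Every picture draws exactly one diagram and different pictures draw different ones, so a sum
over the list has no multiplicities as a sum over `LR(χ, ω)`. -/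
theorem sum_pictures_eq_sum_LR (χ : Fin n → Side) (ω : Fin n → K) (G : Picture K n → ℂ)
    (F : Diagram n → ℂ) (h : ∀ P ∈ pictures χ ω, ∀ D, Draws P D → G P = F D) :
    ((pictures χ ω).map G).sum = ∑ D ∈ LR χ ω, F D := by
  have hnd := nodup_key_pictures χ ω
  rw [← List.sum_toFinset _ hnd.of_map]
  have hw : ∀ P ∈ (pictures χ ω).toFinset, P.WF (ChiLT χ) Set.univ ω := fun P hP =>
    pictures_wf χ ω P (List.mem_toFinset.1 hP)
  refine Finset.sum_bij (fun P hP => (hw P hP).exists_draws.choose) ?_ ?_ ?_ ?_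
  · intro P hP
    exact mem_LR.2 ⟨P, List.mem_toFinset.1 hP, (hw P hP).exists_draws.choose_spec⟩
  · intro P hP P' hP' e
    have h1 := (hw P hP).exists_draws.choose_spec
    have h2 := (hw P' hP').exists_draws.choose_spec
    refine List.inj_on_of_nodup_map hnd (List.mem_toFinset.1 hP) (List.mem_toFinset.1 hP') ?_
    rw [h1.key_eq (hw P hP).closed_ne, h2.key_eq (hw P' hP').closed_ne, e]
  · intro D hD
    obtain ⟨P, hP, hPD⟩ := mem_LR.1 hD
    have hP' := List.mem_toFinset.2 hP
    exact ⟨P, hP', (hw P hP').exists_draws.choose_spec.unique hPD⟩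
  · intro P hP
    exact h P (List.mem_toFinset.1 hP) _ (hw P hP).exists_draws.choose_spec

theorem NCFamily.of_mem_LR {χ : Fin n → Side} {ω : Fin n → K} {D : Diagram n}
    (hD : D ∈ LR χ ω) : NCFamily (ChiLT χ) Set.univ ω (· ∈ D.part.parts) := by
  obtain ⟨P, hP, h⟩ := mem_LR.1 hD
  have : P.IsBlock = (· ∈ D.part.parts) := funext fun V => propext (h.isBlock V)
  exact this ▸ (pictures_wf χ ω P hP).family

end Draws

/-! ### Values of multiplicative functionals -/

section Functional

variable {K : Type*} {X : K → Type*} [∀ k, AddCommGroup (X k)] [∀ k, Module ℂ (X k)]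
  (S : ∀ k, TwoStateSpace (X k)) {n : ℕ}

/-- The value of a multiplicative functional on `T_1 ⋯ T_n ξ`, as a sum over `LR(χ, ω)`. -/
theorem tensorsFunctional_prod_eq_sum_LR (χ : Fin n → Side) (ω : Fin n → K)
    (T : ∀ k, Fin n → Module.End ℂ (X k)) (f : ∀ k, X k →ₗ[ℂ] ℂ) (hf : ∀ k, f k (S k).ξ = 1)
    (b c : Finset (Fin n) → ℂ) (hb : IsBlockState S ω T (fun k => (S k).ψ) b)
    (hc : IsBlockState S ω T f c) :
    tensorsFunctional S f
        ((List.ofFn fun i => sideRep S (χ i) (ω i) (T (ω i) i)).prod (freeProduct S).ξ) =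
      ∑ D ∈ LR χ ω, (∏ V ∈ D.part.parts \ D.top, b V) * ∏ V ∈ D.top, (c V - b V) := by
  rw [prod_sideRep_one_eq_sum_pictures S χ ω T b hb, map_list_sum, List.map_map]
  refine sum_pictures_eq_sum_LR χ ω _ _ ?_
  intro P hP D hD
  have h := pictures_wf χ ω P hP
  rw [Function.comp_apply, Picture.eval, map_smul, smul_eq_mul, hD.closed_eq h.closed_ne, hD.1]
  congr 1
  -- Two spines with the same nodes would put a node before itself in `≺_χ`.
  have hnd : (P.spines.map Prod.snd).Nodup := by
    rw [List.Nodup, List.pairwise_map]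
    refine h.sorted.imp_of_mem ?_
    intro p q hp hq hpq e
    obtain ⟨i, hi⟩ := h.family.nonempty p.2 (Or.inr ⟨p, hp, rfl⟩)
    exact chiLT_irrefl χ i (hpq i hi i (e ▸ hi))
  rw [List.prod_toFinset _ hnd, spineTensor, map_list_prod, List.map_map, List.map_map]
  congr 1
  refine List.map_congr_left fun p hp => ?_
  have hne := h.family.nonempty p.2 (Or.inr ⟨p, hp, rfl⟩)
  have hcol := h.color p hp
  -- `f ((1 - p) v) = f v - ψ v`, because `f ξ = 1`.
  rw [Function.comp_apply, Function.comp_apply, tensorsFunctional_leg,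
    TwoStateSpace.toCirc_eq, map_sub, map_smul, hf, hb p.1 p.2 hne hcol, hc p.1 p.2 hne hcol,
    smul_eq_mul, mul_one]

end Functional

/-! ### Cutting a block between consecutive nodes -/

section Segments

variable {n : ℕ}

/-- The piece `U` contains the smallest element of `V`. -/
def HoldsMin (V U : Finset (Fin n)) : Prop := ∃ i ∈ U, ∀ m ∈ V, i ≤ m

/-- `Q` is a partition of `V` into sets of consecutive elements of `V`. -/
structure IsSegmentation (V : Finset (Fin n)) (Q : Finset (Finset (Fin n))) : Prop where
  nonempty : ∀ U ∈ Q, U.Nonempty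
  subset : ∀ U ∈ Q, U ⊆ V
  cover : ∀ i ∈ V, ∃ U ∈ Q, i ∈ U
  eq_of_mem : ∀ U ∈ Q, ∀ W ∈ Q, ∀ i, i ∈ U → i ∈ W → U = W
  convex : ∀ U ∈ Q, ∀ i ∈ U, ∀ j ∈ U, ∀ m ∈ V, i ≤ m → m ≤ j → m ∈ U

theorem isSegmentation_iff {V : Finset (Fin n)} {Q : Finset (Finset (Fin n))} :
    IsSegmentation V Q ↔ (∀ U ∈ Q, U.Nonempty) ∧ (∀ U ∈ Q, U ⊆ V) ∧ (∀ i ∈ V, ∃ U ∈ Q, i ∈ U) ∧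
      (∀ U ∈ Q, ∀ W ∈ Q, ∀ i, i ∈ U → i ∈ W → U = W) ∧
      ∀ U ∈ Q, ∀ i ∈ U, ∀ j ∈ U, ∀ m ∈ V, i ≤ m → m ≤ j → m ∈ U :=
  ⟨fun ⟨h1, h2, h3, h4, h5⟩ => ⟨h1, h2, h3, h4, h5⟩,
    fun ⟨h1, h2, h3, h4, h5⟩ => ⟨h1, h2, h3, h4, h5⟩⟩

/-- The partitions of `V` into sets of consecutive elements of `V`. -/
def segmentations (V : Finset (Fin n)) : Finset (Finset (Finset (Fin n))) :=
  {Q | IsSegmentation V Q}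

theorem mem_segmentations {V : Finset (Fin n)} {Q : Finset (Finset (Fin n))} :
    Q ∈ segmentations V ↔ IsSegmentation V Q := by
  simp [segmentations]

theorem segmentations_singleton (a : Fin n) : segmentations {a} = {{{a}}} := by
  ext Q
  rw [mem_segmentations, Finset.mem_singleton]
  constructor
  · intro h
    have hU : ∀ U ∈ Q, U = {a} := fun U hU =>
      (Finset.subset_singleton_iff.1 (h.subset U hU)).resolve_left (h.nonempty U hU).ne_empty
    obtain ⟨U, hUQ, -⟩ := h.cover a (by simp)
    ext W
    rw [Finset.mem_singleton]
    exact ⟨hU W, fun e => by rwa [e, ← hU U hUQ]⟩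
  · rintro rfl
    refine ⟨?_, ?_, ?_, ?_, ?_⟩ <;> simp

/-- Adds the node `a` to the piece that contains `m`. -/
def joinAt (a m : Fin n) (U : Finset (Fin n)) : Finset (Fin n) := if m ∈ U then insert a U else U

theorem mem_joinAt {a m i : Fin n} {U : Finset (Fin n)} :
    i ∈ joinAt a m U ↔ i ∈ U ∨ i = a ∧ m ∈ U := by
  unfold joinAt
  split_ifs with h
  · simp [h, or_comm]
  · simp [h]

section Insert

variable {a m : Fin n} {V : Finset (Fin n)} (ha : ∀ j ∈ V, a < j) (hm : m ∈ V)
  (hmin : ∀ j ∈ V, m ≤ j)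
include ha

theorem IsSegmentation.insert_singleton {Q : Finset (Finset (Fin n))} (h : IsSegmentation V Q) :
    IsSegmentation (insert a V) (insert {a} Q) := by
  have haV : a ∉ V := fun h => lt_irrefl a (ha a h)
  refine ⟨?_, ?_, ?_, ?_, ?_⟩
  · simpa using h.nonempty
  · intro U hU
    rcases Finset.mem_insert.1 hU with rfl | hU
    · simp
    · exact (h.subset U hU).trans (Finset.subset_insert a V)
  · intro i hi
    rcases Finset.mem_insert.1 hi with rfl | hi
    · exact ⟨{i}, by simp, by simp⟩
    · obtain ⟨U, hU, hi⟩ := h.cover i hi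
      exact ⟨U, Finset.mem_insert_of_mem hU, hi⟩
  · intro U hU W hW i hi hi'
    rcases Finset.mem_insert.1 hU with rfl | hU <;> rcases Finset.mem_insert.1 hW with rfl | hW
    · rfl
    · rw [Finset.mem_singleton] at hi
      exact absurd (h.subset W hW (hi ▸ hi')) haV
    · rw [Finset.mem_singleton] at hi'
      exact absurd (h.subset U hU (hi' ▸ hi)) haV
    · exact h.eq_of_mem U hU W hW i hi hi'
  · intro U hU i hi j hj k hk h1 h2
    rcases Finset.mem_insert.1 hU with rfl | hU
    · rw [Finset.mem_singleton] at hi hj ⊢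
      subst hi
      exact le_antisymm (hj ▸ h2) h1
    · rcases Finset.mem_insert.1 hk with e | hk
      · exact absurd (ha i (h.subset U hU hi)) (e ▸ h1).not_gt
      · exact h.convex U hU i hi j hj k hk h1 h2

theorem IsSegmentation.erase_singleton {Q : Finset (Finset (Fin n))}
    (h : IsSegmentation (insert a V) Q) (hQ : {a} ∈ Q) : IsSegmentation V (Q.erase {a}) := by
  have haV : a ∉ V := fun h => lt_irrefl a (ha a h)
  have haU : ∀ U ∈ Q.erase {a}, a ∉ U := fun U hU haU => by
    rw [Finset.mem_erase] at hU
    exact hU.1 (h.eq_of_mem U hU.2 _ hQ a haU (by simp))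
  refine ⟨fun U hU => h.nonempty U (Finset.mem_of_mem_erase hU), ?_, ?_, ?_, ?_⟩
  · intro U hU i hi
    rcases Finset.mem_insert.1 (h.subset U (Finset.mem_of_mem_erase hU) hi) with rfl | hi'
    · exact absurd hi (haU U hU)
    · exact hi'
  · intro i hi
    obtain ⟨U, hU, hiU⟩ := h.cover i (Finset.mem_insert_of_mem hi)
    refine ⟨U, Finset.mem_erase.2 ⟨?_, hU⟩, hiU⟩
    rintro rfl
    rw [Finset.mem_singleton] at hiU
    exact haV (hiU ▸ hi)
  · exact fun U hU W hW => h.eq_of_mem U (Finset.mem_of_mem_erase hU) W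
      (Finset.mem_of_mem_erase hW)
  · exact fun U hU i hi j hj k hk => h.convex U (Finset.mem_of_mem_erase hU) i hi j hj k
      (Finset.mem_insert_of_mem hk)

include hm hmin

/-- As `a` comes immediately before the minimum `m` of `V`, the piece of `m` stays consecutive when
`a` is added. -/
theorem IsSegmentation.join {Q : Finset (Finset (Fin n))} (h : IsSegmentation V Q) :
    IsSegmentation (insert a V) (Q.image (joinAt a m)) := by
  have haV : a ∉ V := fun h => lt_irrefl a (ha a h)
  have haU : ∀ U ∈ Q, a ∉ U := fun U hU haU => haV (h.subset U hU haU)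
  simp only [isSegmentation_iff, Finset.forall_mem_image, Finset.exists_mem_image]
  refine ⟨?_, ?_, ?_, ?_, ?_⟩
  · intro U hU
    obtain ⟨i, hi⟩ := h.nonempty U hU
    exact ⟨i, mem_joinAt.2 (Or.inl hi)⟩
  · intro U hU i hi
    rcases mem_joinAt.1 hi with hi | ⟨rfl, -⟩
    · exact Finset.mem_insert_of_mem (h.subset U hU hi)
    · simp
  · intro i hi
    rcases Finset.mem_insert.1 hi with rfl | hi
    · obtain ⟨U, hU, hmU⟩ := h.cover m hm
      exact ⟨_, hU, mem_joinAt.2 (Or.inr ⟨rfl, hmU⟩)⟩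
    · obtain ⟨U, hU, hiU⟩ := h.cover i hi
      exact ⟨_, hU, mem_joinAt.2 (Or.inl hiU)⟩
  · intro U hU W hW i hi hi'
    rcases mem_joinAt.1 hi with hiU | ⟨e, hmU⟩ <;> rcases mem_joinAt.1 hi' with hiW | ⟨e', hmW⟩
    · rw [h.eq_of_mem U hU W hW i hiU hiW]
    · exact absurd (e' ▸ hiU) (haU U hU)
    · exact absurd (e ▸ hiW) (haU W hW)
    · rw [h.eq_of_mem U hU W hW m hmU hmW]
  · intro U hU i hi j hj k hk h1 h2
    rcases Finset.mem_insert.1 hk with e | hkV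
    · rcases mem_joinAt.1 hi with hiU | ⟨-, hmU⟩
      · exact absurd (ha i (h.subset U hU hiU)) (e ▸ h1).not_gt
      · exact mem_joinAt.2 (Or.inr ⟨e, hmU⟩)
    · rcases mem_joinAt.1 hj with hjU | ⟨e, -⟩
      · refine mem_joinAt.2 (Or.inl ?_)
        rcases mem_joinAt.1 hi with hiU | ⟨-, hmU⟩
        · exact h.convex U hU i hiU j hjU k hkV h1 h2
        · exact h.convex U hU m hmU j hjU k hkV (hmin k hkV) h2
      · exact absurd (ha k hkV) (e ▸ h2).not_gt

/-- If `a` is not alone, its piece has an element of `V`, and by convexity it contains the minimum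
`m`, which lies in between. -/
theorem IsSegmentation.min_mem_iff {Q : Finset (Finset (Fin n))}
    (h : IsSegmentation (insert a V) Q) (hQ : {a} ∉ Q) {U : Finset (Fin n)} (hU : U ∈ Q) :
    m ∈ U ↔ a ∈ U := by
  have key : ∀ U ∈ Q, a ∈ U → m ∈ U := by
    intro U hU haU
    obtain ⟨j, hj, hja⟩ : ∃ j ∈ U, j ≠ a := by
      by_contra! hc
      refine hQ ?_
      rwa [← Finset.eq_singleton_iff_unique_mem.2 ⟨haU, hc⟩]
    have hjV := (Finset.mem_insert.1 (h.subset U hU hj)).resolve_left hja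
    exact h.convex U hU a haU j hj m (Finset.mem_insert_of_mem hm) (ha m hm).le (hmin j hjV)
  refine ⟨fun hmU => ?_, key U hU⟩
  obtain ⟨W, hW, haW⟩ := h.cover a (by simp)
  rwa [h.eq_of_mem U hU W hW m hmU (key W hW haW)]

theorem IsSegmentation.image_erase {Q : Finset (Finset (Fin n))}
    (h : IsSegmentation (insert a V) Q) (hQ : {a} ∉ Q) :
    IsSegmentation V (Q.image (Finset.erase · a)) := by
  have haV : a ∉ V := fun h => lt_irrefl a (ha a h)
  have hma : m ≠ a := (ha m hm).ne'
  simp only [isSegmentation_iff, Finset.forall_mem_image, Finset.exists_mem_image]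
  refine ⟨?_, ?_, ?_, ?_, ?_⟩
  · intro U hU
    by_cases hmU : m ∈ U
    · exact ⟨m, Finset.mem_erase.2 ⟨hma, hmU⟩⟩
    · rw [Finset.erase_eq_of_notMem fun haU =>
        hmU ((h.min_mem_iff ha hm hmin hQ hU).2 haU)]
      exact h.nonempty U hU
  · intro U hU i hi
    rw [Finset.mem_erase] at hi
    exact (Finset.mem_insert.1 (h.subset U hU hi.2)).resolve_left hi.1
  · intro i hi
    obtain ⟨U, hU, hiU⟩ := h.cover i (Finset.mem_insert_of_mem hi)
    exact ⟨_, hU, Finset.mem_erase.2 ⟨fun e => haV (e ▸ hi), hiU⟩⟩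
  · intro U hU W hW i hi hi'
    rw [h.eq_of_mem U hU W hW i (Finset.mem_of_mem_erase hi) (Finset.mem_of_mem_erase hi')]
  · intro U hU i hi j hj k hk h1 h2
    exact Finset.mem_erase.2 ⟨fun e => haV (e ▸ hk), h.convex U hU i (Finset.mem_of_mem_erase hi)
      j (Finset.mem_of_mem_erase hj) k (Finset.mem_insert_of_mem hk) h1 h2⟩

/-- Either `V` is cut off right behind `a`, or `a` belongs to the piece of `m`; in both cases the
rest is a segmentation of `V`. -/
theorem sum_segmentations_insert (G : Finset (Finset (Fin n)) → ℂ) :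
    ∑ Q ∈ segmentations (insert a V), G Q =
      ∑ Q ∈ segmentations V, G (insert {a} Q) +
        ∑ Q ∈ segmentations V, G (Q.image (joinAt a m)) := by
  have haV : a ∉ V := fun h => lt_irrefl a (ha a h)
  have hma : m ≠ a := (ha m hm).ne'
  have haQ : ∀ Q ∈ segmentations V, ∀ U ∈ Q, a ∉ U := fun Q hQ U hU haU =>
    haV ((mem_segmentations.1 hQ).subset U hU haU)
  rw [← Finset.sum_filter_add_sum_filter_not _ (fun Q => {a} ∈ Q)]
  congr 1
  · symm
    refine Finset.sum_bij' (fun Q _ => insert {a} Q) (fun Q _ => Q.erase {a}) ?_ ?_ ?_ ?_ ?_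
    · intro Q hQ
      rw [Finset.mem_filter, mem_segmentations]
      exact ⟨(mem_segmentations.1 hQ).insert_singleton ha, by simp⟩
    · intro Q hQ
      rw [Finset.mem_filter, mem_segmentations] at hQ
      exact mem_segmentations.2 (hQ.1.erase_singleton ha hQ.2)
    · intro Q hQ
      exact Finset.erase_insert fun h => haQ Q hQ _ h (by simp)
    · intro Q hQ
      exact Finset.insert_erase (Finset.mem_filter.1 hQ).2
    · intro Q _
      rfl
  · symm
    refine Finset.sum_bij' (fun Q _ => Q.image (joinAt a m))
      (fun Q _ => Q.image (Finset.erase · a)) ?_ ?_ ?_ ?_ ?_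
    · intro Q hQ
      rw [Finset.mem_filter, mem_segmentations]
      refine ⟨(mem_segmentations.1 hQ).join ha hm hmin, ?_⟩
      intro h
      obtain ⟨U, hU, e⟩ := Finset.mem_image.1 h
      obtain ⟨i, hi⟩ := (mem_segmentations.1 hQ).nonempty U hU
      have : i ∈ joinAt a m U := mem_joinAt.2 (Or.inl hi)
      rw [e, Finset.mem_singleton] at this
      exact haQ Q hQ U hU (this ▸ hi)
    · intro Q hQ
      rw [Finset.mem_filter, mem_segmentations] at hQ
      exact mem_segmentations.2 (hQ.1.image_erase ha hm hmin hQ.2)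
    · intro Q hQ
      rw [Finset.image_image]
      conv_rhs => rw [← Finset.image_id (s := Q)]
      refine Finset.image_congr fun U hU => ?_
      ext i
      simp only [Function.comp_apply, Finset.mem_erase, mem_joinAt, id]
      constructor
      · rintro ⟨h1, h2 | h2⟩
        · exact h2
        · exact absurd h2.1 h1
      · exact fun hi => ⟨fun e => haQ Q hQ U hU (e ▸ hi), Or.inl hi⟩
    · intro Q hQ
      rw [Finset.mem_filter, mem_segmentations] at hQ
      rw [Finset.image_image]
      conv_rhs => rw [← Finset.image_id (s := Q)]
      refine Finset.image_congr fun U hU => ?_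
      have := hQ.1.min_mem_iff ha hm hmin hQ.2 hU
      ext i
      simp only [Function.comp_apply, Finset.mem_erase, mem_joinAt, id]
      by_cases hi : i = a
      · subst hi
        simp [this, hma]
      · simp [hi]
    · intro Q _
      rfl

end Insert

end Segments

/-! ### Alternating products in terms of moments -/

section BlockMoments

variable {X : Type*} [AddCommGroup X] [Module ℂ X] (S : TwoStateSpace X) {n : ℕ}
  (T : Fin n → Module.End ℂ X)

/-- The product of the operators `T_i`, `i ∈ V`, in increasing order, applied to `ξ`. -/
def momentVec (V : Finset (Fin n)) : X := blockProd T V S.ξ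

theorem momentVec_singleton (i : Fin n) : momentVec S T {i} = T i S.ξ := by
  simp [momentVec, blockProd]

theorem blockProd_insert {A : Type*} [Monoid A] (a : Fin n → A) {i : Fin n} {V : Finset (Fin n)}
    (h : ∀ j ∈ V, i < j) : blockProd a (insert i V) = a i * blockProd a V := by
  rw [blockProd, Finset.sort_insert _ (fun j hj => (h j hj).le) fun hi => lt_irrefl _ (h i hi)]
  simp [blockProd]

theorem momentVec_insert {i : Fin n} {V : Finset (Fin n)} (h : ∀ j ∈ V, i < j) :
    momentVec S T (insert i V) = T i (momentVec S T V) := by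
  rw [momentVec, blockProd_insert T h]
  rfl

/-- In each gap between consecutive nodes, `1 - p` contributes `1` (no cut) or `-p` (a cut). A cut
splits off the factor `ψ` of everything behind it, so only the first piece is seen by `h`; the sign
is `(-1)` to the number of cuts, which is the number of pieces minus one. -/
theorem apply_blockVec_eq_sum (V : Finset (Fin n)) (hV : V.Nonempty) (h : X →ₗ[ℂ] ℂ) :
    h (blockVec S T V) = ∑ Q ∈ segmentations V, (-1 : ℂ) ^ (Q.card + 1) *
      ∏ U ∈ Q, if HoldsMin V U then h (momentVec S T U) else S.ψ (momentVec S T U) := by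
  induction V using Finset.induction_on_min generalizing h with
  | empty => simp at hV
  | insert a V ha ih =>
    by_cases hV : V.Nonempty
    · have haV : a ∉ V := fun h => lt_irrefl a (ha a h)
      set m := V.min' hV with hm_def
      have hm : m ∈ V := V.min'_mem hV
      have hmin : ∀ j ∈ V, m ≤ j := fun j hj => V.min'_le j hj
      have htop : ∀ U ⊆ V, (HoldsMin V U ↔ m ∈ U) := by
        intro U hU
        constructor
        · rintro ⟨i, hi, hi'⟩
          rwa [← le_antisymm (hi' m hm) (hmin i (hU hi))]
        · exact fun h => ⟨m, h, hmin⟩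
      have htop' : ∀ U ⊆ insert a V, (HoldsMin (insert a V) U ↔ a ∈ U) := by
        intro U hU
        constructor
        · rintro ⟨i, hi, hi'⟩
          have h1 := hi' a (by simp)
          rcases Finset.mem_insert.1 (hU hi) with rfl | h2
          · exact hi
          · exact absurd (ha i h2) h1.not_gt
        · intro h
          exact ⟨a, h, by simpa using fun j hj => (ha j hj).le⟩
      rw [sum_segmentations_insert ha hm hmin, blockVec_insert S T hV ha,
        TwoStateSpace.toCirc_eq, map_sub, map_sub, map_smul, map_smul]
      -- The term without a cut behind `a` is the induction hypothesis for `h ∘ T_a`; the term with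
      -- a cut is the one for `ψ`, times `h (T_a ξ)`.
      have h1 := ih hV (h ∘ₗ T a)
      have h2 := ih hV S.ψ
      simp only [ite_self] at h2
      rw [LinearMap.comp_apply] at h1
      rw [h1, h2, sub_eq_add_neg, add_comm, smul_eq_mul, Finset.sum_mul, ← Finset.sum_neg_distrib]
      congr 1
      · refine Finset.sum_congr rfl fun Q hQ => ?_
        have hQ' := mem_segmentations.1 hQ
        have haQ : ∀ U ∈ Q, a ∉ U := fun U hU haU => haV (hQ'.subset U hU haU)
        have hnot : {a} ∉ Q := fun h => haQ _ h (by simp)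
        rw [Finset.card_insert_of_notMem hnot, Finset.prod_insert hnot,
          if_pos ((htop' _ (by simp)).2 (by simp)), momentVec_singleton]
        have : ∀ U ∈ Q, (if HoldsMin (insert a V) U then h (momentVec S T U)
            else S.ψ (momentVec S T U)) = S.ψ (momentVec S T U) := fun U hU =>
          if_neg fun hc => haQ U hU
            ((htop' U ((hQ'.subset U hU).trans (Finset.subset_insert a V))).1 hc)
        rw [Finset.prod_congr rfl this]
        ring
      · refine Finset.sum_congr rfl fun Q hQ => ?_
        have hQ' := mem_segmentations.1 hQ
        have haQ : ∀ U ∈ Q, a ∉ U := fun U hU haU => haV (hQ'.subset U hU haU)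
        have hinj : Set.InjOn (joinAt a m) Q := by
          intro U hU W hW e
          obtain ⟨i, hi⟩ := hQ'.nonempty U hU
          have : i ∈ joinAt a m W := e ▸ mem_joinAt.2 (Or.inl hi)
          rcases mem_joinAt.1 this with hi' | ⟨rfl, -⟩
          · exact hQ'.eq_of_mem U hU W hW i hi hi'
          · exact absurd hi (haQ U hU)
        rw [Finset.card_image_of_injOn hinj, Finset.prod_image hinj]
        congr 1
        refine Finset.prod_congr rfl fun U hU => ?_
        have hUV := hQ'.subset U hU
        have hsub : joinAt a m U ⊆ insert a V := by
          intro i hi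
          rcases mem_joinAt.1 hi with hi | ⟨rfl, -⟩
          · exact Finset.mem_insert_of_mem (hUV hi)
          · simp
        have e : HoldsMin (insert a V) (joinAt a m U) ↔ m ∈ U := by
          rw [htop' _ hsub, mem_joinAt]
          simp [haQ U hU]
        by_cases hmU : m ∈ U
        · rw [if_pos ((htop U hUV).2 hmU), if_pos (e.2 hmU), joinAt, if_pos hmU,
            momentVec_insert S T fun j hj => ha j (hUV hj)]
          rfl
        · rw [if_neg fun hc => hmU ((htop U hUV).1 hc), if_neg fun hc => hmU (e.1 hc), joinAt,
            if_neg hmU]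
    · rw [Finset.not_nonempty_iff_eq_empty] at hV
      subst hV
      have : HoldsMin ({a} : Finset (Fin n)) {a} := ⟨a, by simp, by simp⟩
      simp [segmentations_singleton, this, blockVec_singleton, momentVec_singleton]

end BlockMoments

/-! ### Summation over the diagrams below a given one -/

section LatCap

variable {n : ℕ}

/-- Removes the intermediate diagram: the lateral refinement is determined by the partition of `E`,
and capping allows any subset of the spines that still reach the top. -/
theorem latCaps_iff {D E : Diagram n} : LatCaps D E ↔ E.part ≤ D.part ∧
    (∀ U ∈ E.part.parts, ∀ V ∈ D.part.parts, U ⊆ V →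
      ∀ i ∈ U, ∀ j ∈ U, ∀ m ∈ V, i ≤ m → m ≤ j → m ∈ U) ∧
    ∀ U ∈ E.top, ∃ V ∈ D.top, U ⊆ V ∧ HoldsMin V U := by
  constructor
  · rintro ⟨F, ⟨h1, h2, h3⟩, h4, h5⟩
    rw [h4]
    exact ⟨h1, h2, fun U hU => (h3 U (F.top_subset (h5 hU))).1 (h5 hU)⟩
  · rintro ⟨h1, h2, h3⟩
    refine ⟨⟨E.part, E.part.parts.filter fun U => ∃ V ∈ D.top, U ⊆ V ∧ HoldsMin V U,
      Finset.filter_subset _ _⟩, ⟨h1, h2, ?_⟩, rfl, ?_⟩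
    · intro U hU
      exact ⟨fun h => (Finset.mem_filter.1 h).2, fun h => Finset.mem_filter.2 ⟨hU, h⟩⟩
    · exact fun U hU => Finset.mem_filter.2 ⟨E.top_subset hU, h3 U hU⟩

/-- The product of `f V` over the blocks that reach the top and of `g V` over the others. -/
def diagramValue (f g : Finset (Fin n) → ℂ) (D : Diagram n) : ℂ :=
  (∏ V ∈ D.part.parts \ D.top, g V) * ∏ V ∈ D.top, f V

theorem diagramValue_eq (f g : Finset (Fin n) → ℂ) (D : Diagram n) :
    diagramValue f g D = ∏ V ∈ D.part.parts, if V ∈ D.top then f V else g V := by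
  rw [diagramValue, ← Finset.prod_sdiff D.top_subset]
  congr 1
  · exact Finset.prod_congr rfl fun V hV => (if_neg (Finset.mem_sdiff.1 hV).2).symm
  · exact Finset.prod_congr rfl fun V hV => (if_pos hV).symm

theorem neg_one_zpow_sub (a b : ℕ) : (-1 : ℂ) ^ ((a : ℤ) - (b : ℤ)) = (-1) ^ (a + b) := by
  rw [zpow_sub₀ (by norm_num), zpow_natCast, zpow_natCast, pow_add, div_eq_mul_inv, ← inv_pow]
  norm_num

/-- The pieces of the block `V` of `D` in the diagram `E`, and whether one of them reaches the
top. -/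
def pieces (D E : Diagram n) (V : Finset (Fin n)) : Finset (Finset (Fin n)) × Bool :=
  if V ∈ D.part.parts then (E.part.parts.filter (· ⊆ V), decide (∃ U ∈ E.top, U ⊆ V))
  -- A default outside the blocks of `D`, with a single choice and value `1` there, makes the
  -- products run over all finite sets, as expanding a product of sums into a sum over choice
  -- functions requires.
  else (∅, false)

/-- The possible values of `pieces D E V`. -/
def pieceChoices (D : Diagram n) (V : Finset (Fin n)) : Finset (Finset (Finset (Fin n)) × Bool) :=
  if V ∈ D.part.parts then segmentations V ×ˢ (if V ∈ D.top then Finset.univ else {false})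
  else {(∅, false)}

/-- The contribution of a choice of pieces of the block `V` of `D`. -/
def pieceValue (f g : Finset (Fin n) → ℂ) (D : Diagram n) (V : Finset (Fin n))
    (q : Finset (Finset (Fin n)) × Bool) : ℂ :=
  if V ∈ D.part.parts then
    (-1) ^ (q.1.card + (if q.2 then 1 else 0) + (1 + if V ∈ D.top then 1 else 0)) *
      ∏ U ∈ q.1, if q.2 = true ∧ HoldsMin V U then f U else g U
  else 1

theorem Finpartition.eq_of_subset_of_subset {P : Part n} {U V W : Finset (Fin n)}
    (hV : V ∈ P.parts) (hW : W ∈ P.parts) (hU : U.Nonempty) (h1 : U ⊆ V) (h2 : U ⊆ W) : V = W := by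
  obtain ⟨i, hi⟩ := hU
  exact P.eq_of_mem_parts hV hW (h1 hi) (h2 hi)

/-- Only the piece with the smallest node of `V` can reach the top. So one bit for each block of `D`
determines the spines of `E` that reach the top. -/
theorem LatCaps.mem_top_iff {D E : Diagram n} (h : LatCaps D E) {U V : Finset (Fin n)}
    (hU : U ∈ E.part.parts) (hV : V ∈ D.part.parts) (hUV : U ⊆ V) :
    U ∈ E.top ↔ (∃ U ∈ E.top, U ⊆ V) ∧ HoldsMin V U := by
  obtain ⟨-, -, h3⟩ := latCaps_iff.1 h
  have key : ∀ U' ∈ E.top, U' ⊆ V → HoldsMin V U' := by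
    intro U' hU' hUV'
    obtain ⟨V', hV', hs, hm⟩ := h3 U' hU'
    rwa [Finpartition.eq_of_subset_of_subset hV (D.top_subset hV')
      (E.part.nonempty_of_mem_parts (E.top_subset hU')) hUV' hs]
  constructor
  · exact fun hUt => ⟨⟨U, hUt, hUV⟩, key U hUt hUV⟩
  · rintro ⟨⟨U', hU', hUV'⟩, i, hi, hi'⟩
    obtain ⟨j, hj, hj'⟩ := key U' hU' hUV'
    have e : i = j := le_antisymm (hi' j (hUV' hj)) (hj' i (hUV hi))
    rwa [E.part.eq_of_mem_parts hU (E.top_subset hU') hi (e ▸ hj)]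

theorem LatCaps.pieces_mem {D E : Diagram n} (h : LatCaps D E) (V : Finset (Fin n)) :
    pieces D E V ∈ pieceChoices D V := by
  obtain ⟨h1, h2, h3⟩ := latCaps_iff.1 h
  unfold pieces pieceChoices
  split_ifs with hV hVt
  · rw [Finset.mem_product]
    refine ⟨mem_segmentations.2 ⟨?_, ?_, ?_, ?_, ?_⟩, Finset.mem_univ _⟩
    · exact fun U hU => E.part.nonempty_of_mem_parts (Finset.mem_filter.1 hU).1
    · exact fun U hU => (Finset.mem_filter.1 hU).2
    · intro i hi
      obtain ⟨U, hU, hiU⟩ := E.part.exists_mem (Finset.mem_univ i)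
      obtain ⟨V', hV', hUV⟩ := h1 hU
      have : V' = V := D.part.eq_of_mem_parts hV' hV (hUV hiU) hi
      exact ⟨U, Finset.mem_filter.2 ⟨hU, this ▸ hUV⟩, hiU⟩
    · exact fun U hU W hW i => E.part.eq_of_mem_parts (Finset.mem_filter.1 hU).1
        (Finset.mem_filter.1 hW).1
    · exact fun U hU => h2 U (Finset.mem_filter.1 hU).1 V hV (Finset.mem_filter.1 hU).2
  · rw [Finset.mem_product]
    refine ⟨mem_segmentations.2 ⟨?_, ?_, ?_, ?_, ?_⟩, ?_⟩
    · exact fun U hU => E.part.nonempty_of_mem_parts (Finset.mem_filter.1 hU).1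
    · exact fun U hU => (Finset.mem_filter.1 hU).2
    · intro i hi
      obtain ⟨U, hU, hiU⟩ := E.part.exists_mem (Finset.mem_univ i)
      obtain ⟨V', hV', hUV⟩ := h1 hU
      have : V' = V := D.part.eq_of_mem_parts hV' hV (hUV hiU) hi
      exact ⟨U, Finset.mem_filter.2 ⟨hU, this ▸ hUV⟩, hiU⟩
    · exact fun U hU W hW i => E.part.eq_of_mem_parts (Finset.mem_filter.1 hU).1
        (Finset.mem_filter.1 hW).1
    · exact fun U hU => h2 U (Finset.mem_filter.1 hU).1 V hV (Finset.mem_filter.1 hU).2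
    · rw [Finset.mem_singleton, decide_eq_false_iff_not]
      rintro ⟨U, hU, hUV⟩
      obtain ⟨V', hV', hs, -⟩ := h3 U hU
      exact hVt (Finpartition.eq_of_subset_of_subset hV (D.top_subset hV')
        (E.part.nonempty_of_mem_parts (E.top_subset hU)) hUV hs ▸ hV')
  · simp

/-- Together with `exists_latCaps_of_pieces`: the diagrams below `D` correspond to independent
choices, for each block, of a segmentation and of whether its first piece reaches the top. -/
theorem LatCaps.pieces_injective {D E E' : Diagram n} (h : LatCaps D E) (h' : LatCaps D E')
    (e : pieces D E = pieces D E') : E = E' := by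
  have key : ∀ {E E' : Diagram n}, LatCaps D E → LatCaps D E' → pieces D E = pieces D E' →
      E.part.parts ⊆ E'.part.parts ∧ E.top ⊆ E'.top := by
    intro E E' h h' e
    have hp : E.part.parts ⊆ E'.part.parts := by
      intro U hU
      obtain ⟨V, hV, hUV⟩ := (latCaps_iff.1 h).1 hU
      have eV := congrArg Prod.fst (congrFun e V)
      simp only [pieces, hV, if_true] at eV
      have : U ∈ E.part.parts.filter (· ⊆ V) := Finset.mem_filter.2 ⟨hU, hUV⟩
      rw [eV] at this
      exact (Finset.mem_filter.1 this).1
    refine ⟨hp, ?_⟩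
    intro U hU
    obtain ⟨V, hV, hUV⟩ := (latCaps_iff.1 h).1 (E.top_subset hU)
    have eV := congrArg Prod.snd (congrFun e V)
    simp only [pieces, hV, if_true, decide_eq_decide] at eV
    obtain ⟨h1, h2⟩ := (h.mem_top_iff (E.top_subset hU) hV hUV).1 hU
    exact (h'.mem_top_iff (hp (E.top_subset hU)) hV hUV).2 ⟨eV.1 h1, h2⟩
  have h1 := key h h' e
  have h2 := key h' h e.symm
  exact Diagram.ext (Finpartition.ext (h1.1.antisymm h2.1)) (h1.2.antisymm h2.2)

theorem exists_latCaps_of_pieces {D : Diagram n}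
    {p : Finset (Fin n) → Finset (Finset (Fin n)) × Bool} (hp : ∀ V, p V ∈ pieceChoices D V) :
    ∃ E, LatCaps D E ∧ pieces D E = p := by
  have hseg : ∀ V ∈ D.part.parts, IsSegmentation V (p V).1 := by
    intro V hV
    have := hp V
    simp only [pieceChoices, hV, if_true, Finset.mem_product] at this
    exact mem_segmentations.1 this.1
  have htop : ∀ V ∈ D.part.parts, (p V).2 = true → V ∈ D.top := by
    intro V hV h
    have := hp V
    simp only [pieceChoices, hV, if_true, Finset.mem_product] at this
    by_contra hVt
    rw [if_neg hVt, Finset.mem_singleton, h] at this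
    simp at this
  let parts : Finset (Finset (Fin n)) := D.part.parts.biUnion fun V => (p V).1
  have mem_parts : ∀ U, U ∈ parts ↔ ∃ V ∈ D.part.parts, U ∈ (p V).1 := fun U =>
    Finset.mem_biUnion
  have hmem : ∀ U, U ∈ parts → ∀ V ∈ D.part.parts, U ⊆ V → U ∈ (p V).1 := by
    intro U hU V hV hUV
    obtain ⟨V', hV', hU'⟩ := (mem_parts U).1 hU
    rwa [Finpartition.eq_of_subset_of_subset hV hV' ((hseg V' hV').nonempty U hU') hUV
      ((hseg V' hV').subset U hU')]
  let part : Part n := ⟨parts, by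
      rw [Finset.supIndep_iff_pairwiseDisjoint]
      intro U hU W hW hne
      rw [Function.onFun, id, id, Finset.disjoint_left]
      intro i hi hi'
      obtain ⟨V, hV, hUV⟩ := (mem_parts U).1 hU
      obtain ⟨V', hV', hWV⟩ := (mem_parts W).1 hW
      have e : V = V' := D.part.eq_of_mem_parts hV hV' ((hseg V hV).subset U hUV hi)
        ((hseg V' hV').subset W hWV hi')
      subst e
      exact hne ((hseg V hV).eq_of_mem U hUV W hWV i hi hi'), by
      refine Finset.eq_univ_of_forall fun i => ?_
      obtain ⟨V, hV, hi⟩ := D.part.exists_mem (Finset.mem_univ i)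
      obtain ⟨U, hU, hiU⟩ := (hseg V hV).cover i hi
      exact Finset.mem_sup.2 ⟨U, (mem_parts U).2 ⟨V, hV, hU⟩, hiU⟩, by
      intro h
      obtain ⟨V, hV, hU⟩ := (mem_parts _).1 h
      exact ((hseg V hV).nonempty _ hU).ne_empty rfl⟩
  let E : Diagram n := ⟨part, parts.filter fun U =>
    ∃ V ∈ D.part.parts, U ⊆ V ∧ (p V).2 = true ∧ HoldsMin V U, Finset.filter_subset _ _⟩
  have hE : LatCaps D E := by
    refine latCaps_iff.2 ⟨?_, ?_, ?_⟩
    · intro U hU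
      obtain ⟨V, hV, hUV⟩ := (mem_parts U).1 hU
      exact ⟨V, hV, (hseg V hV).subset U hUV⟩
    · intro U hU V hV hUV
      exact (hseg V hV).convex U (hmem U hU V hV hUV)
    · intro U hU
      obtain ⟨-, V, hV, hUV, ht, hm⟩ := Finset.mem_filter.1 hU
      exact ⟨V, htop V hV ht, hUV, hm⟩
  refine ⟨E, hE, funext fun V => ?_⟩
  by_cases hV : V ∈ D.part.parts
  · simp only [pieces, hV, if_true]
    refine Prod.ext ?_ ?_
    · ext U
      rw [Finset.mem_filter]
      exact ⟨fun ⟨hU, hUV⟩ => hmem U hU V hV hUV,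
        fun hU => ⟨(mem_parts U).2 ⟨V, hV, hU⟩, (hseg V hV).subset U hU⟩⟩
    · rw [Bool.eq_iff_iff, decide_eq_true_iff]
      constructor
      · rintro ⟨U, hU, hUV⟩
        obtain ⟨hU', V', hV', hUV', ht, -⟩ := Finset.mem_filter.1 hU
        rwa [Finpartition.eq_of_subset_of_subset hV hV' (part.nonempty_of_mem_parts hU') hUV hUV']
      · intro ht
        have hne := D.part.nonempty_of_mem_parts hV
        obtain ⟨U, hU, hmU⟩ := (hseg V hV).cover _ (V.min'_mem hne)
        have hUV := (hseg V hV).subset U hU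
        exact ⟨U, Finset.mem_filter.2 ⟨(mem_parts U).2 ⟨V, hV, hU⟩, V, hV, hUV, ht,
          _, hmU, fun m hm => V.min'_le m hm⟩, hUV⟩
  · have := hp V
    simp only [pieceChoices, hV, if_false, Finset.mem_singleton] at this
    simp only [pieces, hV, if_false, this]

theorem LatCaps.parts_eq_biUnion {D E : Diagram n} (h : LatCaps D E) :
    E.part.parts = D.part.parts.biUnion fun V => E.part.parts.filter (· ⊆ V) := by
  ext U
  rw [Finset.mem_biUnion]
  constructor
  · intro hU
    obtain ⟨V, hV, hUV⟩ := (latCaps_iff.1 h).1 hU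
    exact ⟨V, hV, Finset.mem_filter.2 ⟨hU, hUV⟩⟩
  · rintro ⟨V, -, hU⟩
    exact (Finset.mem_filter.1 hU).1

theorem LatCaps.pairwiseDisjoint {D E : Diagram n} :
    (D.part.parts : Set (Finset (Fin n))).PairwiseDisjoint
      fun V => E.part.parts.filter (· ⊆ V) := by
  intro V hV W hW hne
  rw [Function.onFun, Finset.disjoint_left]
  intro U hU hU'
  rw [Finset.mem_filter] at hU hU'
  exact hne (Finpartition.eq_of_subset_of_subset hV hW (E.part.nonempty_of_mem_parts hU.1)
    hU.2 hU'.2)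

theorem LatCaps.card_top {D E : Diagram n} (h : LatCaps D E) :
    E.top.card = ∑ V ∈ D.part.parts, if ∃ U ∈ E.top, U ⊆ V then 1 else 0 := by
  have e : E.top = D.part.parts.biUnion fun V => E.top.filter (· ⊆ V) := by
    ext U
    rw [Finset.mem_biUnion]
    constructor
    · intro hU
      obtain ⟨V, hV, hUV⟩ := (latCaps_iff.1 h).1 (E.top_subset hU)
      exact ⟨V, hV, Finset.mem_filter.2 ⟨hU, hUV⟩⟩
    · rintro ⟨V, -, hU⟩
      exact (Finset.mem_filter.1 hU).1
  rw [e, Finset.card_biUnion, ← e]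
  · refine Finset.sum_congr rfl fun V hV => ?_
    split_ifs with hex
    · obtain ⟨U, hU, hUV⟩ := hex
      rw [Finset.card_eq_one]
      refine ⟨U, Finset.eq_singleton_iff_unique_mem.2 ⟨Finset.mem_filter.2 ⟨hU, hUV⟩, ?_⟩⟩
      intro W hW
      obtain ⟨hW, hWV⟩ := Finset.mem_filter.1 hW
      obtain ⟨-, i, hi, hi'⟩ := (h.mem_top_iff (E.top_subset hU) hV hUV).1 hU
      obtain ⟨-, j, hj, hj'⟩ := (h.mem_top_iff (E.top_subset hW) hV hWV).1 hW
      have : i = j := le_antisymm (hi' j (hWV hj)) (hj' i (hUV hi))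
      exact E.part.eq_of_mem_parts (E.top_subset hW) (E.top_subset hU) hj (this ▸ hi)
    · rw [Finset.card_eq_zero, Finset.filter_eq_empty_iff]
      exact fun U hU hUV => hex ⟨U, hU, hUV⟩
  · intro V hV W hW hne
    rw [Function.onFun, Finset.disjoint_left]
    intro U hU hU'
    rw [Finset.mem_filter] at hU hU'
    exact hne (Finpartition.eq_of_subset_of_subset hV hW
      (E.part.nonempty_of_mem_parts (E.top_subset hU.1)) hU.2 hU'.2)

/-- Blocks and spines are both counted block by block of `D`: a block `V` contributes its number of
pieces and its bit to `|E|`, and `1` plus its own bit to `|D|`. Since signs are their own inverses,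
the difference may be replaced by a sum. -/
theorem LatCaps.value_eq_prod {D E : Diagram n} (h : LatCaps D E) (f g : Finset (Fin n) → ℂ) :
    (-1 : ℂ) ^ ((E.size : ℤ) - (D.size : ℤ)) * diagramValue f g E =
      ∏ V, pieceValue f g D V (pieces D E V) := by
  have e1 : ∏ V, pieceValue f g D V (pieces D E V) =
      ∏ V ∈ D.part.parts, pieceValue f g D V (pieces D E V) := by
    symm
    refine Finset.prod_subset (Finset.subset_univ _) fun V _ hV => ?_
    rw [pieceValue, if_neg hV]
  have e2 : ∀ V ∈ D.part.parts, pieceValue f g D V (pieces D E V) =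
      (-1) ^ ((E.part.parts.filter (· ⊆ V)).card + (if ∃ U ∈ E.top, U ⊆ V then 1 else 0) +
        (1 + if V ∈ D.top then 1 else 0)) *
      ∏ U ∈ E.part.parts.filter (· ⊆ V), if U ∈ E.top then f U else g U := by
    intro V hV
    simp only [pieceValue, pieces, hV, if_true, decide_eq_true_eq]
    congr 1
    refine Finset.prod_congr rfl fun U hU => ?_
    rw [Finset.mem_filter] at hU
    simp only [h.mem_top_iff hU.1 hV hU.2]
  rw [e1, Finset.prod_congr rfl e2, Finset.prod_mul_distrib, neg_one_zpow_sub,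
    Finset.prod_pow_eq_pow_sum, diagramValue_eq,
    ← Finset.prod_biUnion LatCaps.pairwiseDisjoint, ← h.parts_eq_biUnion]
  congr 2
  simp only [Finset.sum_add_distrib]
  rw [← h.card_top, ← Finset.card_biUnion LatCaps.pairwiseDisjoint, ← h.parts_eq_biUnion,
    Finset.sum_ite_mem, Finset.inter_eq_right.2 D.top_subset]
  simp [Diagram.size]

/-- The product over the blocks of `D` of the alternating sums over the ways to cut and cap them,
as a sum over the diagrams below `D`. -/
theorem diagramValue_segmentations (f g : Finset (Fin n) → ℂ) (D : Diagram n)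
    (b c : Finset (Fin n) → ℂ)
    (hb : ∀ V ∈ D.part.parts, b V = ∑ Q ∈ segmentations V, (-1) ^ (Q.card + 1) * ∏ U ∈ Q, g U)
    (hc : ∀ V ∈ D.part.parts, c V = ∑ Q ∈ segmentations V, (-1) ^ (Q.card + 1) *
      ∏ U ∈ Q, if HoldsMin V U then f U else g U) :
    diagramValue (fun V => c V - b V) b D =
      ∑ E : Diagram n with LatCaps D E,
        (-1 : ℂ) ^ ((E.size : ℤ) - (D.size : ℤ)) * diagramValue f g E := by
  have e1 : diagramValue (fun V => c V - b V) b D =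
      ∏ V, ∑ q ∈ pieceChoices D V, pieceValue f g D V q := by
    rw [diagramValue_eq, ← Finset.prod_subset (Finset.subset_univ D.part.parts)]
    · refine Finset.prod_congr rfl fun V hV => ?_
      simp only [pieceChoices, hV, if_true, Finset.sum_product, pieceValue]
      split_ifs with hVt
      -- For a block that reaches the top, the bit `true` gives the summand of `c V` and the bit
      -- `false` the summand of `-b V`.
      · rw [hb V hV, hc V hV, ← Finset.sum_sub_distrib]
        refine Finset.sum_congr rfl fun Q _ => ?_
        simp [pow_add]
      · rw [hb V hV]
        simp
    · intro V _ hV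
      simp [pieceChoices, pieceValue, hV]
  rw [e1, Finset.prod_univ_sum]
  symm
  refine Finset.sum_bij (fun E _ => pieces D E) ?_ ?_ ?_ ?_
  · intro E hE
    exact Fintype.mem_piFinset.2 (Finset.mem_filter.1 hE).2.pieces_mem
  · intro E hE E' hE' e
    exact (Finset.mem_filter.1 hE).2.pieces_injective (Finset.mem_filter.1 hE').2 e
  · intro p hp
    obtain ⟨E, hE, e⟩ := exists_latCaps_of_pieces (Fintype.mem_piFinset.1 hp)
    exact ⟨E, Finset.mem_filter.2 ⟨Finset.mem_univ _, hE⟩, e⟩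
  · intro E hE
    exact (Finset.mem_filter.1 hE).2.value_eq_prod f g

end LatCap

/-! ### The moment formula in the free product -/

section MomentFormula

variable {K : Type*} {n : ℕ}

/-- The coefficient of the moment `φ_E` in the moment formula. -/
def latCapCoeff (χ : Fin n → Side) (ω : Fin n → K) (E : Diagram n) : ℂ :=
  ∑ D ∈ LR χ ω with LatCaps D E, (-1 : ℂ) ^ ((E.size : ℤ) - (D.size : ℤ))

variable {X : K → Type*} [∀ k, AddCommGroup (X k)] [∀ k, Module ℂ (X k)]
  (S : ∀ k, TwoStateSpace (X k))

/-- The numbers `m V`, for monochrome blocks `V`, are the moments with respect to `f`. -/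
def IsMomentFamily (ω : Fin n → K) (T : ∀ k, Fin n → Module.End ℂ (X k))
    (f : ∀ k, X k →ₗ[ℂ] ℂ) (m : Finset (Fin n) → ℂ) : Prop :=
  ∀ k V, V.Nonempty → (∀ i ∈ V, ω i = k) → m V = f k (momentVec (S k) (T k) V)

/-- The source of both moment formulas: `f = φ` gives the one for `φ`, and `f = ψ` with `m = m'` the
one for `ψ`. -/
theorem tensorsFunctional_prod_eq_sum_LRLatCap (χ : Fin n → Side) (ω : Fin n → K)
    (T : ∀ k, Fin n → Module.End ℂ (X k)) (f : ∀ k, X k →ₗ[ℂ] ℂ) (hf : ∀ k, f k (S k).ξ = 1)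
    (m m' : Finset (Fin n) → ℂ) (hm : IsMomentFamily S ω T f m)
    (hm' : IsMomentFamily S ω T (fun k => (S k).ψ) m') :
    tensorsFunctional S f
        ((List.ofFn fun i => sideRep S (χ i) (ω i) (T (ω i) i)).prod (freeProduct S).ξ) =
      ∑ E ∈ LRLatCap χ ω, latCapCoeff χ ω E * diagramValue m m' E := by
  -- The colour of a nonempty monochrome block is read off an arbitrary node; the values on other
  -- sets play no role.
  have hexists : ∀ g : ∀ k, X k →ₗ[ℂ] ℂ, ∃ b, IsBlockState S ω T g b := by
    intro g
    refine ⟨fun V => if h : V.Nonempty then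
      g (ω h.choose) (blockVec (S (ω h.choose)) (T (ω h.choose)) V) else 0, ?_⟩
    intro k V hV hk
    have := hk _ hV.choose_spec
    simp only [hV, dif_pos]
    rw [this]
  obtain ⟨b, hb⟩ := hexists fun k => (S k).ψ
  obtain ⟨c, hc⟩ := hexists f
  rw [tensorsFunctional_prod_eq_sum_LR S χ ω T f hf b c hb hc]
  have step : ∀ D ∈ LR χ ω, (∏ V ∈ D.part.parts \ D.top, b V) * ∏ V ∈ D.top, (c V - b V) =
      ∑ E ∈ LRLatCap χ ω with LatCaps D E,
        (-1 : ℂ) ^ ((E.size : ℤ) - (D.size : ℤ)) * diagramValue m m' E := by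
    intro D hD
    have hnc := NCFamily.of_mem_LR hD
    -- Every diagram below `D` belongs to `LR^latcap`, so the restricted sum is the full one.
    have e : Finset.filter (LatCaps D) (LRLatCap χ ω) = Finset.univ.filter (LatCaps D) := by
      ext E
      simp only [Finset.mem_filter, LRLatCap, Finset.mem_univ, true_and, and_iff_right_iff_imp]
      exact fun h => ⟨D, hD, h⟩
    rw [e]
    refine diagramValue_segmentations m m' D b c ?_ ?_
    · intro V hV
      have hne := hnc.nonempty V hV
      obtain ⟨i, hi⟩ := hne
      rw [hb (ω i) V ⟨i, hi⟩ fun j hj => hnc.mono V hV j hj i hi,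
        apply_blockVec_eq_sum _ _ V ⟨i, hi⟩]
      refine Finset.sum_congr rfl fun Q hQ => ?_
      congr 1
      refine Finset.prod_congr rfl fun U hU => ?_
      have hQ' := mem_segmentations.1 hQ
      rw [ite_self, hm' (ω i) U (hQ'.nonempty U hU)
        fun j hj => hnc.mono V hV j (hQ'.subset U hU hj) i hi]
    · intro V hV
      have hne := hnc.nonempty V hV
      obtain ⟨i, hi⟩ := hne
      rw [hc (ω i) V ⟨i, hi⟩ fun j hj => hnc.mono V hV j hj i hi,
        apply_blockVec_eq_sum _ _ V ⟨i, hi⟩]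
      refine Finset.sum_congr rfl fun Q hQ => ?_
      congr 1
      refine Finset.prod_congr rfl fun U hU => ?_
      have hQ' := mem_segmentations.1 hQ
      have hcol : ∀ j ∈ U, ω j = ω i := fun j hj =>
        hnc.mono V hV j (hQ'.subset U hU hj) i hi
      rw [hm' (ω i) U (hQ'.nonempty U hU) hcol, hm (ω i) U (hQ'.nonempty U hU) hcol]
  rw [Finset.sum_congr rfl step]
  simp only [latCapCoeff, Finset.sum_filter, Finset.sum_mul, ite_mul, zero_mul]
  rw [Finset.sum_comm]

end MomentFormula

/-! ### Non-crossing products -/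

section NonCrossing

variable {ι κ M : Type*} [Monoid M]

/-- Labels on a list do not cross. -/
def NoCrossing (p : ι → κ) (l : List ι) : Prop :=
  ∀ a b c d, [a, b, c, d].Sublist l → p a = p c → p b = p d → p a = p b

theorem NoCrossing.sublist {p : ι → κ} {l l' : List ι} (h : NoCrossing p l)
    (hl : l'.Sublist l) : NoCrossing p l' :=
  fun a b c d hs => h a b c d (hs.trans hl)

theorem filter_ne_nil_of_mem {p : ι → κ} {u : κ} {l : List ι} (h : l.filter (p · = u) ≠ []) :
    ∃ i ∈ l, p i = u := by
  obtain ⟨i, hi⟩ := List.exists_mem_of_ne_nil _ h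
  exact ⟨i, by simpa using hi⟩

/-- If the label `v` is not covered by another one and all the other labels have trivial
products, then only the letters labelled `v` contribute to a product without crossings. -/
theorem prod_eq_prod_filter_of_noCrossing (h : ι → M) (p : ι → κ) (v : κ) (l : List ι)
    (hnc : NoCrossing p l)
    (hv : ∀ b c d, [b, c, d].Sublist l → p b = p d → p c = v → p b = v)
    (h1 : ∀ u, u ≠ v → ((l.filter (p · = u)).map h).prod = 1) :
    (l.map h).prod = ((l.filter (p · = v)).map h).prod := by
  match l with
  | [] => simp
  | b :: l =>
    by_cases hb : p b = v
    · have ih := prod_eq_prod_filter_of_noCrossing h p v l (hnc.sublist (List.sublist_cons_self _ _))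
        (fun b c d hs => hv b c d (hs.trans (List.sublist_cons_self _ _))) (fun u hu => by
          have := h1 u hu
          rwa [List.filter_cons_of_neg (by simpa [hb] using hu.symm)] at this)
      rw [List.filter_cons_of_pos (by simpa using hb), List.map_cons, List.map_cons,
        List.prod_cons, List.prod_cons, ih]
    · -- split behind the last letter with the label of `b`
      obtain ⟨l1, l2, rfl, hl1, hl2⟩ : ∃ l1 l2, l = l1 ++ l2 ∧
          (l1 = [] ∨ ∃ l3 e, l1 = l3 ++ [e] ∧ p e = p b) ∧ ∀ i ∈ l2, p i ≠ p b := by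
        clear hnc hv h1
        induction l using List.reverseRecOn with
        | nil => exact ⟨[], [], rfl, Or.inl rfl, by simp⟩
        | append_singleton l e ih =>
          by_cases he : p e = p b
          · exact ⟨l ++ [e], [], by simp, Or.inr ⟨l, e, rfl, he⟩, by simp⟩
          · obtain ⟨l1, l2, rfl, h1, h2⟩ := ih
            refine ⟨l1, l2 ++ [e], by simp, h1, ?_⟩
            intro i hi
            rcases List.mem_append.1 hi with hi | hi
            · exact h2 i hi
            · rw [List.mem_singleton.1 hi]
              exact he
      have hsub1 : (b :: l1).Sublist (b :: (l1 ++ l2)) := by simp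
      have hsub2 : l2.Sublist (b :: (l1 ++ l2)) :=
        (List.sublist_append_right _ _).trans (List.sublist_cons_self _ _)
      -- no label occurs both in `l1` and in `l2`
      have hsep : ∀ x ∈ l1, ∀ y ∈ l2, p x ≠ p y := by
        intro x hx y hy e
        rcases hl1 with rfl | ⟨l3, z, rfl, hz⟩
        · simp at hx
        · rcases List.mem_append.1 hx with hx | hx
          · have hs : [b, x, z, y].Sublist (b :: ((l3 ++ [z]) ++ l2)) := by
              refine List.Sublist.cons_cons b ?_
              have : [x, z, y] = ([x] ++ [z]) ++ [y] := rfl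
              rw [this]
              exact ((List.singleton_sublist.2 hx).append (List.Sublist.refl _)).append
                (List.singleton_sublist.2 hy)
            exact hl2 y hy (by rw [← e, ← hnc b x z y hs hz.symm e])
          · rw [List.mem_singleton.1 hx, hz] at e
            exact hl2 y hy e.symm
      -- A letter labelled `v` in `l1` would lie between two letters with the label of `b`, which
      -- would then cover `v`.
      have hv1 : ∀ x ∈ l1, p x ≠ v := by
        intro x hx e
        rcases hl1 with rfl | ⟨l3, z, rfl, hz⟩
        · simp at hx
        · rcases List.mem_append.1 hx with hx | hx
          · have hs : [b, x, z].Sublist (b :: ((l3 ++ [z]) ++ l2)) := by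
              refine List.Sublist.cons_cons b ?_
              have : [x, z] = [x] ++ [z] := rfl
              rw [this]
              exact ((List.singleton_sublist.2 hx).append (List.Sublist.refl _)).trans
                (List.sublist_append_left _ _)
            exact hb (hv b x z hs hz.symm e)
          · rw [List.mem_singleton.1 hx, hz] at e
            exact hb e
      have hfilter2 : ∀ u, u ≠ v → ((l2.filter (p · = u)).map h).prod = 1 := by
        intro u hu
        by_cases hex : l2.filter (p · = u) = []
        · simp [hex]
        · obtain ⟨y, hy, rfl⟩ := filter_ne_nil_of_mem hex
          have := h1 (p y) hu
          rw [List.filter_cons_of_neg (by simpa using (hl2 y hy).symm), List.filter_append,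
            (List.filter_eq_nil_iff (l := l1)).2 (fun x hx => by simpa using hsep x hx y hy),
            List.nil_append] at this
          exact this
      have hfilter1 : ∀ u, u ≠ p b → ((l1.filter (p · = u)).map h).prod = 1 := by
        intro u hu
        by_cases hex : l1.filter (p · = u) = []
        · simp [hex]
        · obtain ⟨x, hx, rfl⟩ := filter_ne_nil_of_mem hex
          have := h1 (p x) (hv1 x hx)
          rwa [List.filter_cons_of_neg (by simpa using hu.symm), List.filter_append,
            (List.filter_eq_nil_iff (l := l2)).2 (fun y hy => by simpa using (hsep x hx y hy).symm),
            List.append_nil] at this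
      -- Within `l1` the label of `b` is not covered, because the leading `b` would produce a
      -- crossing. So `l1` reduces to the letters labelled like `b`; with `b` in front these
      -- multiply to `1`, and only `l2` remains.
      have ih1 := prod_eq_prod_filter_of_noCrossing h p (p b) l1
        ((hnc.sublist hsub1).sublist (List.sublist_cons_self _ _))
        (fun x y z hs e e' => (hnc b x y z ((List.Sublist.cons_cons b hs).trans hsub1)
          e'.symm e).symm) hfilter1
      have ih2 := prod_eq_prod_filter_of_noCrossing h p v l2 (hnc.sublist hsub2)
        (fun x y z hs => hv x y z (hs.trans hsub2)) hfilter2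
      have hbb := h1 (p b) hb
      rw [List.filter_cons_of_pos (by simp), List.filter_append,
        (List.filter_eq_nil_iff (l := l2)).2 (fun y hy => by simpa using hl2 y hy), List.append_nil,
        List.map_cons, List.prod_cons, ← ih1] at hbb
      rw [List.map_cons, List.prod_cons, List.map_append, List.prod_append, ← mul_assoc, hbb,
        one_mul, ih2, List.filter_cons_of_neg (by simpa using hb), List.filter_append,
        (List.filter_eq_nil_iff (l := l1)).2 (fun x hx => by simpa using hv1 x hx), List.nil_append]
  termination_by l.length

/-- The label of the first letter cannot be covered in the rest of the list without a crossing, so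
the rest reduces to the letters with that label. -/
theorem prod_eq_one_of_noCrossing (h : ι → M) (p : ι → κ) (l : List ι) (hnc : NoCrossing p l)
    (h1 : ∀ u, ((l.filter (p · = u)).map h).prod = 1) : (l.map h).prod = 1 := by
  cases l with
  | nil => simp
  | cons a l =>
    have e := prod_eq_prod_filter_of_noCrossing h p (p a) l
      (hnc.sublist (List.sublist_cons_self _ _))
      (fun b c d hs e e' => (hnc a b c d (List.Sublist.cons_cons a hs) e'.symm e).symm)
      (fun u hu => by
        have := h1 u
        rwa [List.filter_cons_of_neg (by simpa using hu.symm)] at this)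
    have ha := h1 (p a)
    rw [List.filter_cons_of_pos (by simp), List.map_cons, List.prod_cons, ← e] at ha
    rw [List.map_cons, List.prod_cons, ha]

end NonCrossing

/-! ### The nodes in the order `≺_χ` -/

section ChiList

/-- The nodes in the order `≺_χ`. -/
def chiList : ∀ {n : ℕ}, (Fin n → Side) → List (Fin n)
  | 0, _ => []
  | _ + 1, χ => match χ 0 with
    | Side.left => 0 :: (chiList fun i => χ i.succ).map Fin.succ
    | Side.right => (chiList fun i => χ i.succ).map Fin.succ ++ [0]

theorem mem_chiList : ∀ {n : ℕ} (χ : Fin n → Side) (i : Fin n), i ∈ chiList χ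
  | n + 1, χ, i => by
    have ih := mem_chiList fun i => χ i.succ
    rw [chiList]
    cases i using Fin.cases with
    | zero => cases χ 0 <;> simp
    | succ j => cases χ 0 <;> simp [ih j]

theorem pairwise_chiList : ∀ {n : ℕ} (χ : Fin n → Side), (chiList χ).Pairwise (ChiLT χ)
  | 0, _ => List.Pairwise.nil
  | n + 1, χ => by
    have ih := pairwise_chiList fun i => χ i.succ
    rw [← chiLT_succ] at ih
    rw [chiList]
    cases hχ : χ 0 with
    | left =>
      refine List.pairwise_cons.2 ⟨?_, List.pairwise_map.2 ih⟩
      intro j hj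
      obtain ⟨i, -, rfl⟩ := List.mem_map.1 hj
      exact chiLT_zero_left hχ _ (Fin.succ_ne_zero i)
    | right =>
      refine List.pairwise_append.2 ⟨List.pairwise_map.2 ih, by simp, ?_⟩
      intro j hj k hk
      obtain ⟨i, -, rfl⟩ := List.mem_map.1 hj
      rw [List.mem_singleton.1 hk]
      exact chiLT_zero_right hχ _ (Fin.succ_ne_zero i)

theorem nodup_chiList {n : ℕ} (χ : Fin n → Side) : (chiList χ).Nodup := by
  refine (pairwise_chiList χ).imp ?_
  rintro a b h rfl
  exact chiLT_irrefl χ a h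

theorem noCrossing_chiList {n : ℕ} {χ : Fin n → Side} {ρ : Part n} (hρ : IsBNC χ ρ) :
    NoCrossing ρ.part (chiList χ) := by
  intro a b c d hs hac hbd
  have hp := (pairwise_chiList χ).sublist hs
  simp only [List.pairwise_cons, List.mem_cons, List.not_mem_nil, or_false, forall_eq_or_imp,
    forall_eq] at hp
  have hmem : ∀ i, i ∈ ρ.part i := fun i => ρ.mem_part_self.2 (Finset.mem_univ i)
  have hpart : ∀ i, ρ.part i ∈ ρ.parts := fun i => ρ.part_mem.2 (Finset.mem_univ i)
  exact hρ _ (hpart a) _ (hpart b) a (hmem a) b (hmem b) c (hac ▸ hmem c) d (hbd ▸ hmem d)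
    hp.1.1 hp.2.1.1 hp.2.2.1

variable {K : Type*} {X : K → Type*} [∀ k, AddCommGroup (X k)] [∀ k, Module ℂ (X k)]
  (S : ∀ k, TwoStateSpace (X k))

/-- For commuting operators, the right operators can be replaced by left ones, in the order
`≺_χ`. -/
theorem prod_sideRep_eq_prod_leftRep : ∀ {n : ℕ} (χ : Fin n → Side) (ω : Fin n → K)
    (T : ∀ k, Fin n → Module.End ℂ (X k)), (∀ k i j, Commute (T k i) (T k j)) →
    (List.ofFn fun i => sideRep S (χ i) (ω i) (T (ω i) i)).prod (freeProduct S).ξ =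
      ((chiList χ).map fun i => leftRep S (ω i) (T (ω i) i)).prod (freeProduct S).ξ
  | 0, _, _, _, _ => by simp [chiList]
  | n + 1, χ, ω, T, hT => by
    have ih := prod_sideRep_eq_prod_leftRep (fun i => χ i.succ) (fun i => ω i.succ)
      (fun k i => T k i.succ) fun k i j => hT k _ _
    rw [List.ofFn_succ, List.prod_cons, Module.End.mul_apply, ih, chiList]
    cases χ 0 with
    | left =>
      simp only [List.map_cons, List.prod_cons, List.map_map, Function.comp_def]
      rfl
    | right =>
      simp only [List.map_append, List.map_cons, List.map_nil, List.prod_append,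
        List.prod_singleton, List.map_map, Function.comp_def]
      rw [Module.End.mul_apply]
      -- At `ξ` the left and right copies of one operator agree, so a right operator that has been
      -- moved next to `ξ` becomes a left one.
      have hξ : rightRep S (ω 0) (T (ω 0) 0) (freeProduct S).ξ =
          leftRep S (ω 0) (T (ω 0) 0) (freeProduct S).ξ := by
        have e : ((freeProduct S).ξ : Tensors S) = embed S (ω 0) (S (ω 0)).ξ :=
          (embed_ξ S (ω 0)).symm
        exact Subtype.ext ((sideRep_embed S Side.right _ e).trans
          (sideRep_embed S Side.left _ e).symm)
      -- The outermost right operator passes all left operators and acts first; this is why right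
      -- nodes come last in `≺_χ`, in decreasing order.
      have hc : Commute (rightRep S (ω 0) (T (ω 0) 0)) ((chiList fun i => χ i.succ).map fun i =>
          leftRep S (ω i.succ) (T (ω i.succ) i.succ)).prod := by
        refine Commute.list_prod_right _ _ fun y hy => ?_
        obtain ⟨i, -, rfl⟩ := List.mem_map.1 hy
        refine (leftRep_rightRep_commute S _ _ _ _ fun e => ?_).symm
        have : ∀ k, ∀ e : ω 0 = k, e ▸ T (ω 0) 0 = T k 0 := by
          rintro _ rfl
          rfl
        rw [this]
        exact hT _ _ _
      change rightRep S (ω 0) (T (ω 0) 0) _ = _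
      rw [← hξ]
      exact LinearMap.congr_fun hc.eq _

end ChiList

/-! ### Translation operators on a group algebra -/

section Translations

variable {G : Type*} [AddCommGroup G]

/-- Translation by `g` on the finitely supported functions on `G`. -/
def translation : Multiplicative G →* Module.End ℂ (G →₀ ℂ) where
  toFun g := Finsupp.lmapDomain ℂ ℂ fun x => g.toAdd + x
  map_one' := by
    ext x
    simp
  map_mul' g h := by
    refine Finsupp.lhom_ext fun x c => ?_
    simp [Finsupp.mapDomain_single, add_assoc]

theorem translation_single (g : Multiplicative G) (x : G) (c : ℂ) :
    translation g (Finsupp.single x c) = Finsupp.single (g.toAdd + x) c := by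
  simp [translation, Finsupp.mapDomain_single]

/-- The finitely supported functions on `G`, with the evaluation at `0` as both functionals. -/
def groupSpace (G : Type*) [AddCommGroup G] : TwoStateSpace (G →₀ ℂ) :=
  TwoStateSpace.ofFunctionals (Finsupp.single 0 1) (Finsupp.lapply 0) (Finsupp.lapply 0)
    (by simp) (by simp)

/-- A product of translations is the translation by the sum, and the state tests whether `0` is sent
to `0`. -/
theorem groupSpace_ψ_momentVec {n : ℕ} (g : Fin n → G) (V : Finset (Fin n)) :
    (groupSpace G).ψ (momentVec (groupSpace G)
      (fun i => translation (Multiplicative.ofAdd (g i))) V) = if ∑ i ∈ V, g i = 0 then 1 else 0 := by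
  have h1 : (groupSpace G).ψ = Finsupp.lapply 0 := TwoStateSpace.ψ_ofFunctionals _ _ _ _ _
  have h2 : blockProd (fun i => translation (Multiplicative.ofAdd (g i))) V =
      translation (Multiplicative.ofAdd (∑ i ∈ V, g i)) := by
    rw [ofAdd_sum, ← V.sort_toFinset (· ≤ ·), List.prod_toFinset _ (V.sort_nodup _), blockProd,
      map_list_prod, List.map_map, V.sort_toFinset]
    rfl
  have h3 : (groupSpace G).ξ = Finsupp.single 0 1 := rfl
  rw [momentVec, h1, h2, h3, translation_single]
  simp [Finsupp.single_apply]

end Translations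

/-! ### Diagrams below shaded diagrams are bi-non-crossing -/

section BiNonCrossing

variable {K : Type*} {n : ℕ}

/-- Along `≺_χ` the index first rises through the left nodes and then falls through the right ones,
so no inner node is smaller than both its neighbours. -/
theorem le_or_le_of_chiLT {χ : Fin n → Side} {x y z : Fin n} (h1 : ChiLT χ x y)
    (h2 : ChiLT χ y z) : x ≤ y ∨ z ≤ y := by
  simp only [ChiLT] at h1 h2
  cases hx : χ x <;> cases hy : χ y <;> cases hz : χ z <;> simp [hx, hy, hz] at h1 h2 <;> omega

/-- Blocks are cut along the usual order, yet stay non-crossing for `≺_χ`. Crossing pieces lie in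
one block of `D`. As the index rises and then falls along `≺_χ`, for a crossing `a, b, c, d` either
`a ≤ b ≤ c` or `d ≤ c ≤ b`; so the middle term lies in the piece of the outer two, as pieces are
consecutive. -/
theorem isBNC_of_latCaps {χ : Fin n → Side} {ω : Fin n → K} {D E : Diagram n}
    (hD : D ∈ LR χ ω) (h : LatCaps D E) : IsBNC χ E.part := by
  obtain ⟨h1, h2, -⟩ := latCaps_iff.1 h
  have hnc := NCFamily.of_mem_LR hD
  intro V hV W hW a ha b hb c hc d hd hab hbc hcd
  obtain ⟨V', hV', hVV'⟩ := h1 hV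
  obtain ⟨W', hW', hWW'⟩ := h1 hW
  have e := hnc.nc V' W' hV' hW' a (hVV' ha) b (hWW' hb) c (hVV' hc) d (hWW' hd) hab hbc hcd
  subst e
  rcases le_total b c with hle | hle
  · have hab' : a ≤ b := by
      rcases le_or_le_of_chiLT hab hbc with h | h
      · exact h
      · have : b = c := le_antisymm hle h
        exact absurd (this ▸ hbc) (chiLT_irrefl χ _)
    exact E.part.eq_of_mem_parts hV hW (h2 V hV V' hV' hVV' a ha c hc b (hWW' hb) hab' hle) hb
  · have hdc : d ≤ c := by
      rcases le_or_le_of_chiLT hbc hcd with h | h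
      · have : b = c := le_antisymm h hle
        exact absurd (this ▸ hbc) (chiLT_irrefl χ _)
      · exact h
    exact E.part.eq_of_mem_parts hV hW hc (h2 W hW V' hV' hWW' d hd b hb c (hVV' hc) hdc hle)

theorem monochrome_of_latCaps {χ : Fin n → Side} {ω : Fin n → K} {D E : Diagram n}
    (hD : D ∈ LR χ ω) (h : LatCaps D E) : Monochrome ω E.part := by
  intro V hV i hi j hj
  obtain ⟨V', hV', hVV'⟩ := (latCaps_iff.1 h).1 hV
  exact (NCFamily.of_mem_LR hD).mono V' hV' i (hVV' hi) j (hVV' hj)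

theorem mem_LRLatCap {χ : Fin n → Side} {ω : Fin n → K} {E : Diagram n} :
    E ∈ LRLatCap χ ω ↔ ∃ D ∈ LR χ ω, LatCaps D E := by
  simp [LRLatCap]

theorem isBNC_of_mem_LRLatCap {χ : Fin n → Side} {ω : Fin n → K} {E : Diagram n}
    (hE : E ∈ LRLatCap χ ω) : IsBNC χ E.part := by
  obtain ⟨D, hD, h⟩ := mem_LRLatCap.1 hE
  exact isBNC_of_latCaps hD h

theorem monochrome_of_mem_LRLatCap {χ : Fin n → Side} {ω : Fin n → K} {E : Diagram n}
    (hE : E ∈ LRLatCap χ ω) : Monochrome ω E.part := by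
  obtain ⟨D, hD, h⟩ := mem_LRLatCap.1 hE
  exact monochrome_of_latCaps hD h

end BiNonCrossing

/-! ### The coefficients of the moment formula -/

section Coefficients

variable {K : Type*} {n : ℕ}

theorem diagramValue_self (m : Finset (Fin n) → ℂ) (E : Diagram n) :
    diagramValue m m E = ∏ V ∈ E.part.parts, m V := by
  simp [diagramValue_eq]

/-- The products of cyclic groups whose factors are given by the blocks of `ρ`. -/
abbrev BlockGroup (ρ : Part n) : Type := ∀ V : ρ.parts, ZMod V.1.card

/-- The element with component `1` at the block of `i`. -/
def blockGen (ρ : Part n) (i : Fin n) : BlockGroup ρ := fun V => if i ∈ V.1 then 1 else 0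

theorem sum_blockGen_apply (ρ : Part n) (U : Finset (Fin n)) (V : ρ.parts) :
    (∑ i ∈ U, blockGen ρ i) V = ((U.filter (· ∈ V.1)).card : ZMod V.1.card) := by
  simp [blockGen, Finset.sum_apply, Finset.filter_mem_eq_inter]

theorem sum_blockGen_block (ρ : Part n) {V : Finset (Fin n)} (hV : V ∈ ρ.parts) :
    ∑ i ∈ V, blockGen ρ i = 0 := by
  funext W
  rw [sum_blockGen_apply, Pi.zero_apply, ZMod.natCast_eq_zero_iff]
  by_cases h : V = W.1
  · rw [← h, Finset.filter_true_of_mem fun i hi => hi]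
  · rw [Finset.filter_false_of_mem fun i hi hi' => h (ρ.eq_of_mem_parts hV W.2 hi hi')]
    simp

/-- The component of the sum over `U` at `V` is `|U ∩ V|` modulo `|V|`, which vanishes only if `V ⊆
U` or `V` and `U` are disjoint. -/
theorem forall_sum_blockGen_eq_zero_iff (ρ π : Part n) :
    (∀ U ∈ π.parts, ∑ i ∈ U, blockGen ρ i = 0) ↔ ρ ≤ π := by
  constructor
  · intro h V hV
    obtain ⟨i, hi⟩ := ρ.nonempty_of_mem_parts hV
    obtain ⟨U, hU, hiU⟩ := π.exists_mem (Finset.mem_univ i)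
    refine ⟨U, hU, ?_⟩
    have := congrFun (h U hU) ⟨V, hV⟩
    rw [sum_blockGen_apply, Pi.zero_apply, ZMod.natCast_eq_zero_iff] at this
    have hle := Nat.le_of_dvd (Finset.card_pos.2 ⟨i, Finset.mem_filter.2 ⟨hiU, hi⟩⟩) this
    have hsub : U.filter (· ∈ V) ⊆ V := fun j hj => (Finset.mem_filter.1 hj).2
    have e := Finset.eq_of_subset_of_card_le hsub hle
    intro j hj
    rw [← e] at hj
    exact (Finset.mem_filter.1 hj).1
  · intro h U hU
    funext W
    rw [sum_blockGen_apply, Pi.zero_apply, ZMod.natCast_eq_zero_iff]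
    obtain ⟨U', hU', hWU'⟩ := h W.2
    by_cases e : U = U'
    · subst e
      have : U.filter (· ∈ W.1) = W.1 := by
        ext j
        rw [Finset.mem_filter]
        exact ⟨fun h => h.2, fun h => ⟨hWU' h, h⟩⟩
      rw [this]
    · rw [Finset.filter_false_of_mem fun i hi hi' => e (π.eq_of_mem_parts hU hU' hi (hWU' hi'))]
      simp

/-- The moment formula evaluated on translations of `BlockGroup ρ`, with the same space for every
colour: the left side is `1`, and on the right the moment of `E` is the indicator of `ρ ≤ E.part`.
-/
theorem sum_latCapCoeff_of_monochrome {χ : Fin n → Side} {ω : Fin n → K} {ρ : Part n}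
    (hρ : IsBNC χ ρ) (hω : Monochrome ω ρ) :
    ∑ E ∈ LRLatCap χ ω with ρ ≤ E.part, latCapCoeff χ ω E = 1 := by
  let S : K → TwoStateSpace (BlockGroup ρ →₀ ℂ) := fun _ => groupSpace (BlockGroup ρ)
  let T : K → Fin n → Module.End ℂ (BlockGroup ρ →₀ ℂ) := fun _ i =>
    translation (Multiplicative.ofAdd (blockGen ρ i))
  let m : Finset (Fin n) → ℂ := fun V => if ∑ i ∈ V, blockGen ρ i = 0 then 1 else 0
  have hm : IsMomentFamily S ω T (fun k => (S k).ψ) m := by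
    intro k V _ _
    simp only [m]
    convert (groupSpace_ψ_momentVec (blockGen ρ) V).symm
  have key := tensorsFunctional_prod_eq_sum_LRLatCap S χ ω T (fun k => (S k).ψ)
    (fun k => (S k).ψ_ξ) m m hm hm
  have hmem : ∀ i, i ∈ ρ.part i := fun i => ρ.mem_part_self.2 (Finset.mem_univ i)
  have hpart : ∀ i, ρ.part i ∈ ρ.parts := fun i => ρ.part_mem.2 (Finset.mem_univ i)
  -- In the order `≺_χ` the blocks of `ρ` do not cross, and the translations of each block add up to
  -- `0`.
  have hprod : ((chiList χ).map fun i => leftRep S (ω i) (T (ω i) i)).prod = 1 := by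
    refine prod_eq_one_of_noCrossing _ ρ.part _ (noCrossing_chiList hρ) fun V => ?_
    by_cases hV : V ∈ ρ.parts
    · have hmemV : ∀ i, i ∈ (chiList χ).filter (ρ.part · = V) ↔ i ∈ V := by
        intro i
        rw [List.mem_filter, decide_eq_true_iff]
        exact ⟨fun h => h.2 ▸ hmem i, fun h => ⟨mem_chiList χ i, ρ.part_eq_of_mem hV h⟩⟩
      obtain ⟨j, hj⟩ := ρ.nonempty_of_mem_parts hV
      have e1 : ((chiList χ).filter (ρ.part · = V)).map
          (fun i => leftRep S (ω i) (T (ω i) i)) =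
          (((chiList χ).filter (ρ.part · = V)).map fun i =>
            Multiplicative.ofAdd (blockGen ρ i)).map
            (((leftRep S (ω j) : Module.End ℂ (BlockGroup ρ →₀ ℂ) →* _).comp translation)) := by
        rw [List.map_map]
        refine List.map_congr_left fun i hi => ?_
        -- One colour on the block: its operators all come from one homomorphism, so their product
        -- is that of the translations.
        rw [hω V hV i ((hmemV i).1 hi) j hj]
        rfl
      have e2 : ((chiList χ).filter (ρ.part · = V)).toFinset = V := by
        ext i
        rw [List.mem_toFinset, hmemV]
      have e3 : (((chiList χ).filter (ρ.part · = V)).map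
          (fun i => leftRep S (ω i) (T (ω i) i))).prod = 1 := by
        rw [e1, ← map_list_prod, ← List.prod_toFinset _ ((nodup_chiList χ).filter _), e2,
          ← ofAdd_sum, sum_blockGen_block ρ hV, ofAdd_zero, map_one]
      convert e3 <;> rfl
    · rw [List.filter_eq_nil_iff.2 fun i _ => by simpa using fun e => hV (by rw [← e]; exact hpart i)]
      simp
  rw [prod_sideRep_eq_prod_leftRep S χ ω T
    (fun k i j => by
      exact (Commute.all (Multiplicative.ofAdd (blockGen ρ i))
        (Multiplicative.ofAdd (blockGen ρ j))).map translation), hprod, Module.End.one_apply] at key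
  have e1 : tensorsFunctional S (fun k => (S k).ψ) ((freeProduct S).ξ : Tensors S) = 1 :=
    map_one _
  rw [e1] at key
  rw [key, Finset.sum_filter]
  refine Finset.sum_congr rfl fun E _ => ?_
  rw [diagramValue_self]
  simp only [m]
  rw [Finset.prod_ite_zero]
  simp only [forall_sum_blockGen_eq_zero_iff, Finset.prod_const_one]
  split_ifs <;> simp

/-- The coefficient of the moment `ψ_π`. -/
def partCoeff (χ : Fin n → Side) (ω : Fin n → K) (π : BNC χ) : ℂ :=
  ∑ E ∈ LRLatCap χ ω with E.part = π.1, latCapCoeff χ ω E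

/-- Grouping by partition is exhaustive because every partition that occurs is bi-non-crossing. -/
theorem sum_partCoeff (χ : Fin n → Side) (ω : Fin n → K) (F : Part n → ℂ) :
    ∑ π : BNC χ, partCoeff χ ω π * F π.1 =
      ∑ E ∈ LRLatCap χ ω, latCapCoeff χ ω E * F E.part := by
  simp only [partCoeff, Finset.sum_filter, Finset.sum_mul]
  rw [Finset.sum_comm]
  refine Finset.sum_congr rfl fun E hE => ?_
  rw [Finset.sum_eq_single ⟨E.part, isBNC_of_mem_LRLatCap hE⟩]
  · simp
  · intro π _ hπ
    rw [if_neg, zero_mul]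
    exact fun e => hπ (Subtype.ext e.symm)
  · simp

/-- If `ρ` is not monochrome, the sum is empty: the partitions that occur are monochrome, and so is
every refinement of them. -/
theorem sum_partCoeff_ge (χ : Fin n → Side) (ω : Fin n → K) (ρ : BNC χ) :
    ∑ π : BNC χ, (if ρ ≤ π then partCoeff χ ω π else 0) =
      if Monochrome ω ρ.1 then 1 else 0 := by
  have e := sum_partCoeff χ ω fun π => if ρ.1 ≤ π then 1 else 0
  simp only [mul_ite, mul_one, mul_zero] at e
  refine Eq.trans e ?_
  rw [← Finset.sum_filter]
  split_ifs with h
  · exact sum_latCapCoeff_of_monochrome ρ.2 h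
  · refine Finset.sum_eq_zero fun E hE => absurd ?_ h
    rw [Finset.mem_filter] at hE
    intro V hV i hi j hj
    obtain ⟨W, hW, hVW⟩ := hE.2 hV
    exact monochrome_of_mem_LRLatCap hE.1 W hW i (hVW hi) j (hVW hj)

/-- Möbius inversion of `sum_partCoeff_ge`: the indicator of `σ ≤ ω` is the sum of the coefficients
above `σ`. -/
theorem partCoeff_eq_sum_mu (χ : Fin n → Side) (ω : Fin n → K) (π : BNC χ) :
    partCoeff χ ω π = ((∑ σ : BNC χ with π ≤ σ ∧ Monochrome ω σ.1, muBNC χ π σ : ℤ) : ℂ) := by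
  have hmu : ∀ τ : BNC χ, ∑ σ : BNC χ, (if π ≤ σ ∧ σ ≤ τ then (muBNC χ π σ : ℂ) else 0) =
      if π = τ then 1 else 0 := by
    intro τ
    have h := IncidenceAlgebra.sum_Icc_mu_right (𝕜 := ℤ) π τ
    rw [← Finset.sum_filter]
    have e : Finset.univ.filter (fun σ : BNC χ => π ≤ σ ∧ σ ≤ τ) = Finset.Icc π τ := by
      ext σ
      simp
    rw [e]
    have h' := congrArg (Int.cast : ℤ → ℂ) h
    push_cast at h'
    exact h'
  push_cast
  rw [Finset.sum_filter]
  have step : ∀ σ : BNC χ, (if π ≤ σ ∧ Monochrome ω σ.1 then (muBNC χ π σ : ℂ) else 0) =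
      ∑ τ : BNC χ, (if π ≤ σ ∧ σ ≤ τ then (muBNC χ π σ : ℂ) else 0) * partCoeff χ ω τ := by
    intro σ
    have h := sum_partCoeff_ge χ ω σ
    by_cases hπ : π ≤ σ
    · simp only [hπ, true_and]
      have : (if Monochrome ω σ.1 then (muBNC χ π σ : ℂ) else 0) =
          muBNC χ π σ * if Monochrome ω σ.1 then 1 else 0 := by simp
      rw [this, ← h, Finset.mul_sum]
      refine Finset.sum_congr rfl fun τ _ => ?_
      split_ifs <;> simp
    · simp [hπ]
  rw [Finset.sum_congr rfl fun σ _ => step σ, Finset.sum_comm]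
  simp only [← Finset.sum_mul, hmu]
  simp

end Coefficients

/-! ### Functionals on free products of algebras -/

section FreeProductAlgebra

theorem freeProduct_algHom_ext {I : Type*} [DecidableEq I] {A : I → Type*} [∀ i, Semiring (A i)]
    [∀ i, Algebra ℂ (A i)] {B : Type*} [Semiring B] [Algebra ℂ B]
    {f g : LinearAlgebra.FreeProduct ℂ A →ₐ[ℂ] B}
    (h : ∀ i x, f (LinearAlgebra.FreeProduct.ι ℂ A i x) = g (LinearAlgebra.FreeProduct.ι ℂ A i x)) :
    f = g := by
  refine (LinearAlgebra.FreeProduct.lift ℂ A).symm.injective ?_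
  funext i
  exact AlgHom.ext (h i)

theorem freeProduct_lift_ι {I : Type*} [DecidableEq I] {A : I → Type*} [∀ i, Semiring (A i)]
    [∀ i, Algebra ℂ (A i)] {B : Type*} [Semiring B] [Algebra ℂ B]
    (maps : {i : I} → A i →ₐ[ℂ] B) (i : I) (x : A i) :
    LinearAlgebra.FreeProduct.lift ℂ A maps (LinearAlgebra.FreeProduct.ι ℂ A i x) = maps x :=
  DFunLike.congr_fun (LinearAlgebra.FreeProduct.lift_comp_ι ℂ A maps) x

/-- The universal property gives a homomorphism into the subalgebra generated by the factors;
composed with the inclusion it is the identity, so that subalgebra is everything. It is spanned by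
words in its generators. -/
theorem freeProduct_span_eq_top {I : Type*} [DecidableEq I] (A : I → Type*) [∀ i, Ring (A i)]
    [∀ i, Algebra ℂ (A i)] :
    Submodule.span ℂ (Set.range fun l : List (Σ i, A i) =>
      (l.map fun p => LinearAlgebra.FreeProduct.ι ℂ A p.1 p.2).prod) = ⊤ := by
  let s : Set (LinearAlgebra.FreeProduct ℂ A) :=
    Set.range fun p : Σ i, A i => LinearAlgebra.FreeProduct.ι ℂ A p.1 p.2
  let j : LinearAlgebra.FreeProduct ℂ A →ₐ[ℂ] Algebra.adjoin ℂ s :=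
    LinearAlgebra.FreeProduct.lift ℂ A fun {i} =>
      (LinearAlgebra.FreeProduct.ι ℂ A i).codRestrict (Algebra.adjoin ℂ s)
        fun x => Algebra.subset_adjoin ⟨⟨i, x⟩, rfl⟩
  have hj : (Algebra.adjoin ℂ s).val.comp j = AlgHom.id ℂ _ := by
    refine freeProduct_algHom_ext fun i x => ?_
    rw [AlgHom.comp_apply, freeProduct_lift_ι]
    rfl
  rw [eq_top_iff]
  intro x _
  have hx : x ∈ Subalgebra.toSubmodule (Algebra.adjoin ℂ s) := by
    have := DFunLike.congr_fun hj x
    rw [AlgHom.comp_apply, AlgHom.id_apply] at this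
    rw [← this]
    exact (j x).2
  rw [Algebra.adjoin_eq_span] at hx
  refine Submodule.span_mono ?_ hx
  intro y hy
  obtain ⟨l, hl, rfl⟩ := Submonoid.exists_list_of_mem_closure hy
  clear hx hy
  induction l with
  | nil => exact ⟨[], rfl⟩
  | cons a l ih =>
    obtain ⟨l', hl'⟩ := ih fun b hb => hl b (List.mem_cons_of_mem _ hb)
    obtain ⟨p, rfl⟩ := hl a List.mem_cons_self
    refine ⟨p :: l', ?_⟩
    simp only [List.map_cons, List.prod_cons] at hl' ⊢
    rw [hl']

theorem freeProduct_functional_ext {I : Type*} [DecidableEq I] {A : I → Type*} [∀ i, Ring (A i)]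
    [∀ i, Algebra ℂ (A i)] {f g : LinearAlgebra.FreeProduct ℂ A →ₗ[ℂ] ℂ}
    (h : ∀ l : List (Σ i, A i), f (l.map fun p => LinearAlgebra.FreeProduct.ι ℂ A p.1 p.2).prod =
      g (l.map fun p => LinearAlgebra.FreeProduct.ι ℂ A p.1 p.2).prod) : f = g := by
  refine LinearMap.ext_on_range (freeProduct_span_eq_top A) h

end FreeProductAlgebra

/-! ### Joint and pair-distributions on words -/

section Distributions

variable {K : Type v} {A : Type u} [Ring A] [Algebra ℂ A] {𝒜 : K → Side → Subalgebra ℂ A}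

/-- The word `a_1 ⋯ a_n` in the free product of all the algebras. -/
def jointWord {n : ℕ} (χ : Fin n → Side) (ω : Fin n → K) (a : ∀ i, 𝒜 (ω i) (χ i)) :
    JointAlgebra 𝒜 :=
  (List.ofFn fun i => LinearAlgebra.FreeProduct.ι ℂ (fun p : K × Side => 𝒜 p.1 p.2)
    (ω i, χ i) (a i)).prod

theorem joint_functional_ext {f g : JointAlgebra 𝒜 →ₗ[ℂ] ℂ}
    (h : ∀ (n : ℕ) (χ : Fin n → Side) (ω : Fin n → K) (a : ∀ i, 𝒜 (ω i) (χ i)),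
      f (jointWord χ ω a) = g (jointWord χ ω a)) : f = g := by
  refine freeProduct_functional_ext fun l => ?_
  have := h l.length (fun i => (l.get i).1.2) (fun i => (l.get i).1.1) fun i => (l.get i).2
  rw [jointWord] at this
  have e : (l.map fun p => LinearAlgebra.FreeProduct.ι ℂ
      (fun p : K × Side => 𝒜 p.1 p.2) p.1 p.2) = List.ofFn fun i : Fin l.length =>
        LinearAlgebra.FreeProduct.ι ℂ (fun p : K × Side => 𝒜 p.1 p.2)
          ((l.get i).1.1, (l.get i).1.2) (l.get i).2 := by
    conv_lhs => rw [← List.ofFn_get l, List.map_ofFn]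
    rfl
  rw [e]
  exact this

theorem jointDistribution_jointWord {B : Type*} [Semiring B] [Algebra ℂ B] (f : B →ₗ[ℂ] ℂ)
    (h : ∀ k s, 𝒜 k s →ₐ[ℂ] B) {n : ℕ} (χ : Fin n → Side) (ω : Fin n → K)
    (a : ∀ i, 𝒜 (ω i) (χ i)) :
    jointDistribution 𝒜 f h (jointWord χ ω a) =
      f (List.ofFn fun i => h (ω i) (χ i) (a i)).prod := by
  rw [jointDistribution, LinearMap.comp_apply, AlgHom.toLinearMap_apply, jointWord,
    map_list_prod, List.map_ofFn]
  congr 3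
  funext i
  exact freeProduct_lift_ι _ _ _

/-- The operator or algebra element of node `i`, seen by the colour `k`. -/
def atColour {n : ℕ} {χ : Fin n → Side} {ω : Fin n → K} (a : ∀ i, 𝒜 (ω i) (χ i)) {k : K}
    {B : Type*} [Semiring B] [Algebra ℂ B] (h : ∀ s, 𝒜 k s →ₐ[ℂ] B) (i : Fin n) : B :=
  -- The value `0` at other colours is harmless: operators are taken at their own colour, and
  -- moments only on blocks of colour `k`.
  if e : ω i = k then h (χ i) ⟨a i, e ▸ (a i).2⟩ else 0

theorem atColour_self {n : ℕ} {χ : Fin n → Side} {ω : Fin n → K} (a : ∀ i, 𝒜 (ω i) (χ i))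
    {B : Type*} [Semiring B] [Algebra ℂ B] (i : Fin n) (h : ∀ s, 𝒜 (ω i) s →ₐ[ℂ] B) :
    atColour a h i = h (χ i) (a i) := by
  simp [atColour]

theorem blockProd_congr {B : Type*} [Monoid B] {n : ℕ} {a b : Fin n → B} {V : Finset (Fin n)}
    (h : ∀ i ∈ V, a i = b i) : blockProd a V = blockProd b V := by
  rw [blockProd, blockProd, List.map_congr_left fun i hi => h i ((Finset.mem_sort _).1 hi)]

/-- The product of the nodes in `V` in the free product of the two algebras of colour `k`. -/
def pairWord {n : ℕ} {χ : Fin n → Side} {ω : Fin n → K} (a : ∀ i, 𝒜 (ω i) (χ i)) (k : K)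
    (V : Finset (Fin n)) : PairAlgebra 𝒜 k :=
  blockProd (atColour a fun s => LinearAlgebra.FreeProduct.ι ℂ (fun s : Side => 𝒜 k s) s) V

theorem pairDistribution_pairWord {B : Type*} [Semiring B] [Algebra ℂ B] (f : B →ₗ[ℂ] ℂ) {k : K}
    (h : ∀ s, 𝒜 k s →ₐ[ℂ] B) {n : ℕ} {χ : Fin n → Side} {ω : Fin n → K}
    (a : ∀ i, 𝒜 (ω i) (χ i)) (V : Finset (Fin n)) :
    pairDistribution 𝒜 f k h (pairWord a k V) = f (blockProd (atColour a h) V) := by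
  rw [pairDistribution, LinearMap.comp_apply, AlgHom.toLinearMap_apply, pairWord, blockProd,
    map_list_prod, List.map_map, blockProd]
  congr 3
  funext i
  simp only [Function.comp_apply, atColour]
  split_ifs with e
  · exact freeProduct_lift_ι _ _ _
  · exact map_zero _

theorem Rep.act_eq_sideRep (R : Rep.{u, v, w} 𝒜) (k : K) (s : Side) (a : 𝒜 k s) :
    R.act k s a = sideRep R.space s k (R.hom k s a) := by
  cases s <;> rfl

/-- `m V` is the value of the `k`-th functional at the product of the nodes in `V`, for every
nonempty `V` of colour `k`. -/
def IsPairMoment {n : ℕ} {χ : Fin n → Side} {ω : Fin n → K} (a : ∀ i, 𝒜 (ω i) (χ i))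
    (f : ∀ k, PairAlgebra 𝒜 k →ₗ[ℂ] ℂ) (m : Finset (Fin n) → ℂ) : Prop :=
  ∀ k V, V.Nonempty → (∀ i ∈ V, ω i = k) → m V = f k (pairWord a k V)

/-- A block of colour `k` determines `k`, so one function of the block serves all colours. -/
theorem exists_isPairMoment {n : ℕ} {χ : Fin n → Side} {ω : Fin n → K} (a : ∀ i, 𝒜 (ω i) (χ i))
    (f : ∀ k, PairAlgebra 𝒜 k →ₗ[ℂ] ℂ) : ∃ m, IsPairMoment a f m := by
  refine ⟨fun V => if h : V.Nonempty then f (ω h.choose) (pairWord a (ω h.choose) V) else 0, ?_⟩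
  intro k V hV hk
  have := hk _ hV.choose_spec
  simp only [hV, dif_pos]
  rw [this]

theorem isPairMoment_blockProd {n : ℕ} {χ : Fin n → Side} {ω : Fin n → K}
    (a : ∀ i, 𝒜 (ω i) (χ i)) (f : A →ₗ[ℂ] ℂ) :
    IsPairMoment a (fun k => pairDistribution 𝒜 f k fun s => (𝒜 k s).val)
      fun V => f (blockProd (fun i => (a i : A)) V) := by
  intro k V _ hk
  rw [pairDistribution_pairWord]
  refine congrArg f (blockProd_congr (B := A) fun i hi => ?_)
  rw [atColour, dif_pos (hk i hi)]
  rfl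

theorem Rep.isMomentFamily (R : Rep.{u, v, w} 𝒜) {n : ℕ} {χ : Fin n → Side} {ω : Fin n → K}
    (a : ∀ i, 𝒜 (ω i) (χ i)) (f : ∀ k, R.X k →ₗ[ℂ] ℂ) {m : Finset (Fin n) → ℂ}
    (hm : IsPairMoment a (fun k => pairDistribution 𝒜
      (f k ∘ₗ LinearMap.applyₗ (R.space k).ξ) k (R.hom k)) m) :
    IsMomentFamily R.space ω (fun k => atColour a (R.hom k)) f m := by
  intro k V hV hk
  rw [hm k V hV hk, pairDistribution_pairWord]
  rfl

theorem Rep.list_act_eq (R : Rep.{u, v, w} 𝒜) {n : ℕ} {χ : Fin n → Side} {ω : Fin n → K}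
    (a : ∀ i, 𝒜 (ω i) (χ i)) :
    (List.ofFn fun i => R.act (ω i) (χ i) (a i)) =
      List.ofFn fun i => sideRep R.space (χ i) (ω i) (atColour a (R.hom (ω i)) i) := by
  congr 1
  funext i
  rw [R.act_eq_sideRep, atColour_self]

/-- The right side sees the representation only through its pair-distributions. -/
theorem Rep.jointφ_jointWord (R : Rep.{u, v, w} 𝒜) {n : ℕ} (χ : Fin n → Side) (ω : Fin n → K)
    (a : ∀ i, 𝒜 (ω i) (χ i)) {m m' : Finset (Fin n) → ℂ} (hm : IsPairMoment a R.pairφ m)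
    (hm' : IsPairMoment a R.pairψ m') :
    R.jointφ (jointWord χ ω a) =
      ∑ E ∈ LRLatCap χ ω, latCapCoeff χ ω E * diagramValue m m' E := by
  rw [Rep.jointφ, jointDistribution_jointWord, R.list_act_eq]
  exact tensorsFunctional_prod_eq_sum_LRLatCap R.space χ ω (fun k => atColour a (R.hom k))
    (fun k => (R.space k).φ) (fun k => (R.space k).φ_ξ) m m'
    (R.isMomentFamily a _ hm) (R.isMomentFamily a _ hm')

/-- The general formula with `f = ψ`: capping does not change the moments, so diagrams are grouped
by partition. -/
theorem Rep.jointψ_jointWord (R : Rep.{u, v, w} 𝒜) {n : ℕ} (χ : Fin n → Side) (ω : Fin n → K)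
    (a : ∀ i, 𝒜 (ω i) (χ i)) {m : Finset (Fin n) → ℂ} (hm : IsPairMoment a R.pairψ m) :
    R.jointψ (jointWord χ ω a) = ∑ π : BNC χ,
      ((∑ σ : BNC χ with π ≤ σ ∧ Monochrome ω σ.1, muBNC χ π σ : ℤ) : ℂ) *
        ∏ V ∈ π.1.parts, m V := by
  rw [Rep.jointψ, jointDistribution_jointWord, R.list_act_eq]
  refine (freeProduct_ψ_apply R.space _).trans ?_
  refine (tensorsFunctional_prod_eq_sum_LRLatCap R.space χ ω (fun k => atColour a (R.hom k))
    (fun k => (R.space k).ψ) (fun k => (R.space k).ψ_ξ) m m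
    (R.isMomentFamily a _ hm) (R.isMomentFamily a _ hm)).trans ?_
  simp only [diagramValue_self]
  rw [← sum_partCoeff χ ω fun π => ∏ V ∈ π.parts, m V]
  refine Finset.sum_congr rfl fun π _ => ?_
  rw [partCoeff_eq_sum_mu]

/-- The same numbers `m`, `m'` serve both representations, and words determine a functional. -/
theorem Rep.joint_eq_of_pair_eq (R : Rep.{u, v, w} 𝒜) (R₁ : Rep.{u, v, w₁} 𝒜)
    (h : ∀ k, R.pairφ k = R₁.pairφ k ∧ R.pairψ k = R₁.pairψ k) :
    R.jointφ = R₁.jointφ ∧ R.jointψ = R₁.jointψ := by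
  have hφ : R.pairφ = R₁.pairφ := funext fun k => (h k).1
  have hψ : R.pairψ = R₁.pairψ := funext fun k => (h k).2
  constructor
  · refine joint_functional_ext fun n χ ω a => ?_
    obtain ⟨m, hm⟩ := exists_isPairMoment a R.pairφ
    obtain ⟨m', hm'⟩ := exists_isPairMoment a R.pairψ
    rw [R.jointφ_jointWord χ ω a hm hm',
      R₁.jointφ_jointWord χ ω a (by rwa [← hφ]) (by rwa [← hψ])]
  · refine joint_functional_ext fun n χ ω a => ?_
    obtain ⟨m', hm'⟩ := exists_isPairMoment a R.pairψ
    rw [R.jointψ_jointWord χ ω a hm', R₁.jointψ_jointWord χ ω a (by rwa [← hψ])]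

/-! ### Comparison of a representation with the family in `A` -/

theorem Realizes.jointφ_jointWord {φ ψ : A →ₗ[ℂ] ℂ} {R : Rep.{u, v, w} 𝒜}
    (hR : Realizes 𝒜 φ ψ R) {n : ℕ} (χ : Fin n → Side) (ω : Fin n → K)
    (a : ∀ i, 𝒜 (ω i) (χ i)) :
    R.jointφ (jointWord χ ω a) =
      ∑ E ∈ LRLatCap χ ω, latCapCoeff χ ω E * diagramMoment φ ψ E fun i => (a i : A) := by
  have hφ : R.pairφ = fun k => pairDistribution 𝒜 φ k fun s => (𝒜 k s).val :=
    funext fun k => (hR k).1.symm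
  have hψ : R.pairψ = fun k => pairDistribution 𝒜 ψ k fun s => (𝒜 k s).val :=
    funext fun k => (hR k).2.symm
  exact R.jointφ_jointWord χ ω a (by rw [hφ]; exact isPairMoment_blockProd a φ)
    (by rw [hψ]; exact isPairMoment_blockProd a ψ)

theorem Realizes.jointψ_jointWord {φ ψ : A →ₗ[ℂ] ℂ} {R : Rep.{u, v, w} 𝒜}
    (hR : Realizes 𝒜 φ ψ R) {n : ℕ} (χ : Fin n → Side) (ω : Fin n → K)
    (a : ∀ i, 𝒜 (ω i) (χ i)) :
    R.jointψ (jointWord χ ω a) = ∑ π : BNC χ,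
      ((∑ σ : BNC χ with π ≤ σ ∧ Monochrome ω σ.1, muBNC χ π σ : ℤ) : ℂ) *
        partMoment ψ π.1 fun i => (a i : A) := by
  have hψ : R.pairψ = fun k => pairDistribution 𝒜 ψ k fun s => (𝒜 k s).val :=
    funext fun k => (hR k).2.symm
  exact R.jointψ_jointWord χ ω a (by rw [hψ]; exact isPairMoment_blockProd a ψ)

theorem Realizes.computes_iff {φ ψ : A →ₗ[ℂ] ℂ} (hφ : φ 1 = 1) (hψ : ψ 1 = 1)
    {R : Rep.{u, v, w} 𝒜} (hR : Realizes 𝒜 φ ψ R) :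
    Computes 𝒜 φ ψ R ↔
      ∀ (n : ℕ), 1 ≤ n → ∀ (χ : Fin n → Side) (ω : Fin n → K) (a : Fin n → A),
        (∀ i, a i ∈ 𝒜 (ω i) (χ i)) → PsiFormula ψ χ ω a ∧ PhiFormula φ ψ χ ω a := by
  constructor
  · intro h n _ χ ω a ha
    let b : ∀ i, 𝒜 (ω i) (χ i) := fun i => ⟨a i, ha i⟩
    have h1 := DFunLike.congr_fun h.1 (jointWord χ ω b)
    have h2 := DFunLike.congr_fun h.2 (jointWord χ ω b)
    rw [jointDistribution_jointWord, hR.jointφ_jointWord] at h1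
    rw [jointDistribution_jointWord, hR.jointψ_jointWord] at h2
    exact ⟨h2, h1⟩
  · intro h
    constructor
    · refine joint_functional_ext fun n χ ω a => ?_
      rw [jointDistribution_jointWord]
      -- The formulas are assumed only for `n ≥ 1`; on the empty word both sides are `1` by
      -- normalisation.
      rcases Nat.eq_zero_or_pos n with rfl | hn
      · rw [Rep.jointφ, jointDistribution_jointWord]
        simp only [List.ofFn_zero, List.prod_nil, hφ]
        exact (freeProduct R.space).φ_ξ.symm
      · rw [hR.jointφ_jointWord]
        exact (h n hn χ ω (fun i => a i) fun i => (a i).2).2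
    · refine joint_functional_ext fun n χ ω a => ?_
      rw [jointDistribution_jointWord]
      rcases Nat.eq_zero_or_pos n with rfl | hn
      · rw [Rep.jointψ, jointDistribution_jointWord]
        simp only [List.ofFn_zero, List.prod_nil, hψ]
        exact (freeProduct R.space).ψ_ξ.symm
      · rw [hR.jointψ_jointWord]
        exact (h n hn χ ω (fun i => a i) fun i => (a i).2).1

theorem pairDistribution_list {B : Type*} [Semiring B] [Algebra ℂ B] (f : B →ₗ[ℂ] ℂ) {k : K}
    (h : ∀ s, 𝒜 k s →ₐ[ℂ] B) (l : List (Σ s, 𝒜 k s)) :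
    pairDistribution 𝒜 f k h
        (l.map fun p => LinearAlgebra.FreeProduct.ι ℂ (fun s : Side => 𝒜 k s) p.1 p.2).prod =
      f (l.map fun p => h p.1 p.2).prod := by
  rw [pairDistribution, LinearMap.comp_apply, AlgHom.toLinearMap_apply, map_list_prod,
    List.map_map]
  congr 3
  funext p
  exact freeProduct_lift_ι _ _ _

theorem jointDistribution_list {B : Type*} [Semiring B] [Algebra ℂ B] (f : B →ₗ[ℂ] ℂ) (k : K)
    (h : ∀ k s, 𝒜 k s →ₐ[ℂ] B) (l : List (Σ s, 𝒜 k s)) :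
    jointDistribution 𝒜 f h (l.map fun p =>
        LinearAlgebra.FreeProduct.ι ℂ (fun p : K × Side => 𝒜 p.1 p.2) (k, p.1) p.2).prod =
      f (l.map fun p => h k p.1 p.2).prod := by
  rw [jointDistribution, LinearMap.comp_apply, AlgHom.toLinearMap_apply, map_list_prod,
    List.map_map]
  congr 3
  funext p
  exact freeProduct_lift_ι _ _ _

theorem Rep.list_act_ξ (R : Rep.{u, v, w} 𝒜) (k : K) (l : List (Σ s, 𝒜 k s)) :
    ((l.map fun p => R.act k p.1 p.2).prod (freeProduct R.space).ξ : Tensors R.space) =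
      embed R.space k ((l.map fun p => R.hom k p.1 p.2).prod (R.space k).ξ) := by
  simp only [R.act_eq_sideRep]
  exact sideRep_prod_embed R.space (fun p : Σ s, 𝒜 k s => p.1) (fun p => R.hom k p.1 p.2) l
    (embed_ξ R.space k).symm

/-- Operators of a single colour keep `ξ` inside the copy of `X_k`, where the states of the free
product restrict to `φ_k` and `ψ_k`. -/
theorem Computes.realizes {φ ψ : A →ₗ[ℂ] ℂ} {R : Rep.{u, v, w} 𝒜} (h : Computes 𝒜 φ ψ R) :
    Realizes 𝒜 φ ψ R := by
  intro k
  constructor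
  · refine freeProduct_functional_ext fun l => ?_
    rw [pairDistribution_list, Rep.pairφ, pairDistribution_list,
      ← jointDistribution_list φ k fun k s => (𝒜 k s).val, h.1, Rep.jointφ,
      jointDistribution_list]
    refine (freeProduct_φ_apply R.space _).trans ?_
    rw [LinearMap.applyₗ_apply_apply, R.list_act_ξ,
      tensorsFunctional_embed _ _ fun k => (R.space k).φ_ξ]
    rfl
  · refine freeProduct_functional_ext fun l => ?_
    rw [pairDistribution_list, Rep.pairψ, pairDistribution_list,
      ← jointDistribution_list ψ k fun k s => (𝒜 k s).val, h.2, Rep.jointψ,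
      jointDistribution_list]
    refine (freeProduct_ψ_apply R.space _).trans ?_
    rw [LinearMap.applyₗ_apply_apply, R.list_act_ξ,
      tensorsFunctional_embed _ _ fun k => (R.space k).ψ_ξ]
    rfl

/-! ### The regular representation and the end of the proof -/

variable (𝒜) in
/-- The representation of every pair by left multiplications on `A`. -/
def regularRep (φ ψ : A →ₗ[ℂ] ℂ) (hφ : φ 1 = 1) (hψ : ψ 1 = 1) : Rep.{u, v, u} 𝒜 where
  X := fun _ => A
  space := fun _ => TwoStateSpace.ofFunctionals 1 φ ψ hφ hψ
  hom := fun k s => (Algebra.lmul ℂ A).comp (𝒜 k s).val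

theorem realizes_regularRep {φ ψ : A →ₗ[ℂ] ℂ} (hφ : φ 1 = 1) (hψ : ψ 1 = 1) :
    Realizes 𝒜 φ ψ (regularRep 𝒜 φ ψ hφ hψ) := by
  intro k
  have hprod : ∀ l : List (Σ s, 𝒜 k s),
      (l.map fun p => (regularRep 𝒜 φ ψ hφ hψ).hom k p.1 p.2).prod =
        Algebra.lmul ℂ A (l.map fun p => (p.2 : A)).prod := by
    intro l
    rw [map_list_prod, List.map_map]
    rfl
  constructor
  · refine freeProduct_functional_ext fun l => ?_
    rw [pairDistribution_list, Rep.pairφ, pairDistribution_list, hprod]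
    change _ = φ ((l.map fun p => (p.2 : A)).prod * 1)
    rw [mul_one]
    rfl
  · refine freeProduct_functional_ext fun l => ?_
    rw [pairDistribution_list, Rep.pairψ, pairDistribution_list, hprod]
    change _ = (TwoStateSpace.ofFunctionals 1 φ ψ hφ hψ).ψ ((l.map fun p => (p.2 : A)).prod * 1)
    rw [mul_one, TwoStateSpace.ψ_ofFunctionals]
    rfl

/-- A representation witnessing c-bi-freeness realizes the pair-distributions, so the formulas
follow; conversely the regular representation always realizes them and is a witness as soon as the
formulas hold. -/
theorem isCBiFree_iff {φ ψ : A →ₗ[ℂ] ℂ} (hφ : φ 1 = 1) (hψ : ψ 1 = 1) :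
    IsCBiFree 𝒜 φ ψ ↔
      ∀ (n : ℕ), 1 ≤ n → ∀ (χ : Fin n → Side) (ω : Fin n → K) (a : Fin n → A),
        (∀ i, a i ∈ 𝒜 (ω i) (χ i)) → PsiFormula ψ χ ω a ∧ PhiFormula φ ψ χ ω a := by
  constructor
  · rintro ⟨R, hR⟩
    exact (hR.realizes.computes_iff hφ hψ).1 hR
  · intro h
    exact ⟨_, ((realizes_regularRep hφ hψ).computes_iff hφ hψ).2 h⟩

end Distributions

end CBiFree

end

theorem mainTheorem2 {K : Type v} {A : Type u} [Ring A] [Algebra ℂ A]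
    (φ ψ : A →ₗ[ℂ] ℂ) (hφ : φ 1 = 1) (hψ : ψ 1 = 1)
    (𝒜 : K → CBiFree.Side → Subalgebra ℂ A) :
    (CBiFree.IsCBiFree 𝒜 φ ψ ↔
      ∀ (n : ℕ), 1 ≤ n → ∀ (χ : Fin n → CBiFree.Side) (ω : Fin n → K) (a : Fin n → A),
        (∀ i, a i ∈ 𝒜 (ω i) (χ i)) →
          CBiFree.PsiFormula ψ χ ω a ∧ CBiFree.PhiFormula φ ψ χ ω a) ∧
    (∀ (R : CBiFree.Rep.{u, v, w} 𝒜) (R₁ : CBiFree.Rep.{u, v, w₁} 𝒜),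
      (∀ k, R.pairφ k = R₁.pairφ k ∧ R.pairψ k = R₁.pairψ k) →
        R.jointφ = R₁.jointφ ∧ R.jointψ = R₁.jointψ) ∧
    (∀ R : CBiFree.Rep.{u, v, w} 𝒜, CBiFree.Realizes 𝒜 φ ψ R →
      (CBiFree.IsCBiFree 𝒜 φ ψ ↔ CBiFree.Computes 𝒜 φ ψ R)) :=
  ⟨CBiFree.isCBiFree_iff hφ hψ, fun R R₁ h => R.joint_eq_of_pair_eq R₁ h, fun _ hR =>
    -- Both sides are equivalent to the two formulas, which mention no representation; hence `R` may
    -- live in any universe.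
    (CBiFree.isCBiFree_iff hφ hψ).trans (hR.computes_iff hφ hψ).symm⟩
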